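/- Let $\Omega$ be the category of non-empty finite rooted trees, a morphism $S\to T$ being a morphism $\Omega(S)\to\Omega(T)$ between the coloured symmetric operads freely generated by the vertices. A dendroidal set is a presheaf of sets $X$ on $\Omega$; it is normal if for every tree $T$ the group $\mathrm{Aut}(T)$ acts freely on $X_T$. Write $|T|$ for the number of vertices of $T$, and $P_T$ for the set of planar structures on $T$ (a linear order on the inputs of each vertex); $P$ is a presheaf on $\Omega$. A planar structure $p$ labels the vertices of $T$ by $0,\dots,|T|-1$ in depth-first order, starting from the root vertex and taking the branches from left to right, and $\mathrm{sgn}(p',p)$ is the sign of the permutation of labels taking the labelling induced by $p'$ to the one induced by $p$. The elementary faces $\partial_a\colon\partial_aT\to T$ are: the inner faces (contract an inner edge), with sign $\mathrm{sgn}_p(\partial_a)=(-1)^k$, where $k$ is the label of the vertex above the edge; the top faces (chop off a vertex all of whose inputs are leaves, together with its inputs), with sign $(-1)^{k+1}$, where $k$ is the label of that vertex; and the bottom faces (chop off the root vertex, keeping the part of $T$ above one of its inputs $e$, provided that all its other inputs are leaves), with sign $+1$. For a dendroidal set $X$ let $\mathrm{Ch}^{un}(X)_n$ be the free abelian group on the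 triples $(T,p,x)$ with $|T|=n$, $p\in P_T$, $x\in X_T$, modulo the relations $(T,p,x)=\mathrm{sgn}(p',\tau^*p)\,(T',p',\tau^*x)$ for all isomorphisms $\tau\colon T'\to T$ and all $p'\in P_{T'}$; write $[T,p,x]$ for the class of $(T,p,x)$, and put $$d[T,p,x]=\sum_{\partial_a}\mathrm{sgn}_p(\partial_a)\,[\partial_aT,\partial_a^*p,\partial_a^*x],$$ the sum running over the elementary faces of $T$. Let $D(X)_n\subseteq\mathrm{Ch}^{un}(X)_n$ be the subgroup generated by the classes of degenerate dendrices, i.e. of those in the image of $\sigma_e^*$ for some elementary degeneracy $\sigma_e\colon\sigma_eS\to S$ (where $\sigma_eS$ is $S$ with an additional unary vertex inserted on the edge $e$). Then, for every normal dendroidal set $X$: the map $d$ is well defined, $d^2=0$, $D(X)$ is a subcomplex of $\mathrm{Ch}^{un}(X)$, and the quotient map $$\mathrm{Ch}^{un}(X)\longrightarrow \mathrm{Ch}(X):=\mathrm{Ch}^{un}(X)/D(X)$$ is a quasi-isomorphism. -/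

import Mathlib

open CategoryTheory

universe u

/-- A finite, non-empty, rooted tree with edge set `E`. A vertex has exactly one output edge, and
distinct vertices have distinct output edges, so a vertex is identified with its output edge:
`vert` is the set of those edges which are the output of a vertex (the other edges are the leaves).
If `e ≠ root`, then `e` is an input of the vertex `next e`; at the root, which is not an input of any
vertex, `next` takes the dummy value `root`. -/
structure OTree : Type 1 where
  E : Type
  finite : Finite E
  root : E
  next : E → E
  next_root : next root = root
  reach : ∀ e, ∃ n : ℕ, next^[n] e = root
  vert : Set E
  next_mem : ∀ e, e ≠ root → next e ∈ vert

namespace OTree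

instance (T : OTree) : Finite T.E := T.finite

noncomputable instance (T : OTree) : Fintype T.E := Fintype.ofFinite _

/-- The number `|T|` of vertices. -/
noncomputable def size (T : OTree) : ℕ := Nat.card T.vert

open Classical in
/-- The set of inputs of the vertex `v`. -/
noncomputable def inputs (T : OTree) (v : T.E) : Finset T.E :=
  Finset.univ.filter fun e => e ≠ T.root ∧ T.next e = v

theorem mem_inputs {T : OTree} {v e : T.E} : e ∈ T.inputs v ↔ e ≠ T.root ∧ T.next e = v := by
  simp [inputs]

theorem reach_of_height {E : Type} (root : E) (next : E → E) (h : E → ℕ)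
    (hh : ∀ e, e ≠ root → h (next e) < h e) (e : E) : ∃ n : ℕ, next^[n] e = root := by
  induction hk : h e using Nat.strong_induction_on generalizing e with
  | _ k ih =>
    by_cases he : e = root
    · exact ⟨0, he⟩
    · obtain ⟨n, hn⟩ := ih _ (hk ▸ hh e he) (next e) rfl
      exact ⟨n + 1, hn⟩

theorem iterate_root (T : OTree) (n : ℕ) : T.next^[n] T.root = T.root := by
  induction n with
  | zero => rfl
  | succ n ih => rw [Function.iterate_succ_apply, T.next_root, ih]

open Classical in
/-- The distance of an edge from the root. -/
noncomputable def height (T : OTree) (e : T.E) : ℕ := Nat.find (T.reach e)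

theorem height_next (T : OTree) (e : T.E) (he : e ≠ T.root) :
    T.height e = T.height (T.next e) + 1 := by
  classical
  apply le_antisymm
  · exact Nat.find_min' (T.reach e) (Nat.find_spec (T.reach (T.next e)))
  · have h1 := Nat.find_spec (T.reach e)
    have h0 : T.height e ≠ 0 := fun h => he (by
      have : T.next^[T.height e] e = T.root := h1
      rwa [h] at this)
    obtain ⟨k, hk⟩ := Nat.exists_eq_succ_of_ne_zero h0
    have h2 : T.next^[k] (T.next e) = T.root := by
      have : T.next^[T.height e] e = T.root := h1
      rwa [hk] at this
    have : T.height (T.next e) ≤ k := Nat.find_min' _ h2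
    omega

theorem height_next_le (T : OTree) (e : T.E) : T.height (T.next e) ≤ T.height e := by
  by_cases he : e = T.root
  · rw [he, T.next_root]
  · have := T.height_next e he; omega

theorem height_iterate_le (T : OTree) (n : ℕ) (e : T.E) : T.height (T.next^[n] e) ≤ T.height e := by
  induction n generalizing e with
  | zero => exact le_rfl
  | succ n ih => exact (ih _).trans (T.height_next_le e)

/-- The order on edges: `a ≤ x` if `a` lies on the path from `x` down to the root. -/
instance (T : OTree) : PartialOrder T.E where
  le a x := ∃ n : ℕ, T.next^[n] x = a
  le_refl a := ⟨0, rfl⟩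
  le_trans := by
    rintro a b c ⟨n, rfl⟩ ⟨m, rfl⟩
    exact ⟨n + m, Function.iterate_add_apply _ _ _ _⟩
  le_antisymm := by
    rintro a b ⟨n, rfl⟩ ⟨m, hm⟩
    cases n with
    | zero => rfl
    | succ n =>
      by_cases hb : b = T.root
      · rw [hb, iterate_root]
      · exfalso
        have h1 := T.height_next b hb
        have h2 := T.height_iterate_le n (T.next b)
        have h3 := T.height_iterate_le m (T.next^[n + 1] b)
        rw [hm] at h3
        rw [Function.iterate_succ_apply] at h3
        omega

theorem le_def {T : OTree} {a x : T.E} : a ≤ x ↔ ∃ n : ℕ, T.next^[n] x = a := Iff.rfl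

theorem next_le {T : OTree} (x : T.E) : T.next x ≤ x := ⟨1, rfl⟩

theorem root_le {T : OTree} (x : T.E) : T.root ≤ x := T.reach x

theorem next_ne {T : OTree} {x : T.E} (hx : x ≠ T.root) : T.next x ≠ x := fun h => by
  have := T.height_next x hx
  rw [h] at this
  omega

theorem next_lt {T : OTree} {x : T.E} (hx : x ≠ T.root) : T.next x < x :=
  lt_of_le_of_ne (next_le x) (next_ne hx)

theorem le_next_of_lt {T : OTree} {a x : T.E} (h : a < x) : a ≤ T.next x := by
  obtain ⟨n, hn⟩ := h.le
  cases n with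
  | zero => exact absurd hn h.ne'
  | succ n => exact ⟨n, hn⟩

theorem ne_root_of_lt {T : OTree} {a x : T.E} (h : a < x) : x ≠ T.root := by
  rintro rfl
  exact absurd (root_le a) (not_le_of_gt h)

theorem comparable {T : OTree} {a b x : T.E} (ha : a ≤ x) (hb : b ≤ x) : a ≤ b ∨ b ≤ a := by
  obtain ⟨n, rfl⟩ := ha
  obtain ⟨m, rfl⟩ := hb
  rcases le_total n m with h | h
  · right
    refine ⟨m - n, ?_⟩
    rw [← Function.iterate_add_apply, Nat.sub_add_cancel h]
  · left
    refine ⟨n - m, ?_⟩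
    rw [← Function.iterate_add_apply, Nat.sub_add_cancel h]

theorem exists_child {T : OTree} {a x : T.E} (h : a < x) :
    ∃ b, b ≤ x ∧ b ≠ T.root ∧ T.next b = a := by
  obtain ⟨n, hn⟩ := h.le
  induction n generalizing x with
  | zero => exact absurd hn h.ne'
  | succ n ih =>
    have hx := ne_root_of_lt h
    rcases eq_or_lt_of_le (le_next_of_lt h) with h1 | h1
    · exact ⟨x, le_rfl, hx, h1.symm⟩
    · obtain ⟨b, hb, hb'⟩ := ih h1 hn
      exact ⟨b, hb.trans (next_le x), hb'⟩

/-- Two edges are siblings if they are inputs of the same vertex. -/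
def Sib (T : OTree) (a b : T.E) : Prop := a ≠ T.root ∧ b ≠ T.root ∧ T.next a = T.next b

theorem Sib.lt_of_lt {T : OTree} {a b u : T.E} (h : T.Sib a b) (hu : u < a) : u < b :=
  lt_of_le_of_lt ((le_next_of_lt hu).trans_eq h.2.2) (next_lt h.2.1)

theorem Sib.symm {T : OTree} {a b : T.E} (h : T.Sib a b) : T.Sib b a := ⟨h.2.1, h.1, h.2.2.symm⟩

theorem Sib.not_lt {T : OTree} {a b : T.E} (h : T.Sib a b) : ¬ a < b :=
  fun h' => lt_irrefl _ (h.symm.lt_of_lt h')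

theorem Sib.eq_of_le {T : OTree} {a b : T.E} (h : T.Sib a b) (h' : a ≤ b) : a = b :=
  h'.eq_or_lt.resolve_right h.not_lt

theorem exists_sib {T : OTree} {u v : T.E} (h1 : ¬ u ≤ v) (h2 : ¬ v ≤ u) :
    ∃ a b, T.Sib a b ∧ a ≠ b ∧ a ≤ u ∧ b ≤ v := by
  induction hk : T.height u using Nat.strong_induction_on generalizing u with
  | _ k ih =>
    have hu : u ≠ T.root := by rintro rfl; exact h1 (root_le v)
    by_cases h3 : T.next u ≤ v
    · have h4 : T.next u < v := lt_of_le_of_ne h3 (by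
        rintro rfl; exact h2 (next_le u))
      obtain ⟨b, hb, hb', hb''⟩ := exists_child h4
      refine ⟨u, b, ⟨hu, hb', hb''.symm⟩, ?_, le_rfl, hb⟩
      rintro rfl; exact h1 hb
    · obtain ⟨a, b, hs, hn, ha, hb⟩ := ih (T.height (T.next u))
        (by rw [← hk, T.height_next u hu]; omega) h3 (fun h => h2 (h.trans (next_le u))) rfl
      exact ⟨a, b, hs, hn, ha.trans (next_le u), hb⟩

/-! ### The category `Ω` -/

/-- The coloured symmetric operad `Ω(T)` freely generated by the vertices of `T` has the edges as
colours, and for colours `c₁, …, cₖ, c` the set of operations `Ω(T)(c₁, …, cₖ; c)` is either empty or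
a singleton; whether it is inhabited does not depend on the order of the inputs.
`T.Op {c₁, …, cₖ} c` says that it is inhabited: operations are generated from identities by composing
with vertices at the inputs. -/
inductive Op (T : OTree) : Multiset T.E → T.E → Prop
  | id (e : T.E) : Op T {e} e
  | comp (m : Multiset T.E) (x e : T.E) (hx : x ∈ T.vert) :
      Op T (x ::ₘ m) e → Op T ((T.inputs x).val + m) e

/-- Morphisms of `Ω`: morphisms of operads `Ω(S) → Ω(T)`. As `Ω(S)` is free on the vertices of `S` and
`Ω(T)` has at most one operation with given inputs and output, such a morphism is a map of colours
for which the image of every generator exists. -/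
@[ext]
structure Hom (S T : OTree) where
  toFun : S.E → T.E
  map_vert : ∀ v ∈ S.vert, T.Op ((S.inputs v).val.map toFun) (toFun v)

theorem Op.vertex {T : OTree} {v : T.E} (hv : v ∈ T.vert) : T.Op (T.inputs v).val v := by
  simpa using Op.comp 0 v v hv (Op.id v)

theorem Op.subst {T : OTree} {m m' : Multiset T.E} {x e : T.E} (h : T.Op (x ::ₘ m) e)
    (h' : T.Op m' x) : T.Op (m' + m) e := by
  induction h' with
  | id x => simpa using h
  | comp m' y x hy _ ih =>
    have := ih h
    rw [Multiset.cons_add] at this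
    have := Op.comp _ _ _ hy this
    rwa [← add_assoc] at this

theorem Op.map {S T : OTree} (f : Hom S T) {m : Multiset S.E} {e : S.E} (h : S.Op m e) :
    T.Op (m.map f.toFun) (f.toFun e) := by
  induction h with
  | id e => simpa using Op.id (f.toFun e)
  | comp m x e hx _ ih =>
    rw [Multiset.map_cons] at ih
    rw [Multiset.map_add]
    exact ih.subst (f.map_vert x hx)

/-- The category `Ω` of trees. -/
instance : Category.{0} OTree where
  Hom := Hom
  id T := ⟨fun e => e, fun v hv => by simpa using Op.vertex hv⟩
  comp f g := ⟨fun e => g.toFun (f.toFun e), fun v hv => by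
    simpa using Op.map g (f.map_vert v hv)⟩

/-- The map on edges of a morphism of trees. -/
def onEdges {S T : OTree} (f : S ⟶ T) : S.E → T.E := Hom.toFun f

theorem Op.antichain {T : OTree} {m : Multiset T.E} {e : T.E} (h : T.Op m e) :
    m.Nodup ∧ ∀ x ∈ m, ∀ y ∈ m, x ≤ y → x = y := by
  induction h with
  | id e => simp
  | comp m x e hx _ ih =>
    obtain ⟨hn, hi⟩ := ih
    rw [Multiset.nodup_cons] at hn
    have key : ∀ y ∈ (T.inputs x).val, ∀ z ∈ m, ¬ y ≤ z ∧ ¬ z ≤ y := by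
      intro y hy z hz
      have hy' := mem_inputs.1 (Finset.mem_def.2 hy)
      have hxy : x < y := hy'.2 ▸ next_lt hy'.1
      have hxz : x ≠ z := by rintro rfl; exact hn.1 hz
      have h1 : ¬ x ≤ z := fun h => hxz (hi x (by simp) z (by simp [hz]) h)
      have h2 : ¬ z ≤ x := fun h => hxz (hi z (by simp [hz]) x (by simp) h).symm
      refine ⟨fun h => h1 (hxy.le.trans h), fun h => ?_⟩
      rcases h.eq_or_lt with rfl | h
      · exact h1 hxy.le
      · exact h2 (hy'.2 ▸ le_next_of_lt h)
    refine ⟨?_, ?_⟩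
    · rw [Multiset.nodup_add]
      refine ⟨(T.inputs x).nodup, hn.2, ?_⟩
      rw [Multiset.disjoint_left]
      intro a ha ha'
      exact (key a ha a ha').1 le_rfl
    · intro a ha b hb hab
      rw [Multiset.mem_add] at ha hb
      rcases ha with ha | ha <;> rcases hb with hb | hb
      · have ha' := mem_inputs.1 (Finset.mem_def.2 ha)
        have hb' := mem_inputs.1 (Finset.mem_def.2 hb)
        exact Sib.eq_of_le ⟨ha'.1, hb'.1, ha'.2.trans hb'.2.symm⟩ hab
      · exact absurd hab (key a ha b hb).1
      · exact absurd hab (key b hb a ha).2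
      · exact hi a (by simp [ha]) b (by simp [hb]) hab

theorem Hom.sib_eq {S T : OTree} (f : S ⟶ T) {a b : S.E} (h : S.Sib a b)
    (hab : onEdges f a ≤ onEdges f b) : a = b := by
  obtain ⟨hn, hi⟩ := (f.map_vert (S.next a) (S.next_mem a h.1)).antichain
  have ha : a ∈ (S.inputs (S.next a)).val := mem_inputs.2 ⟨h.1, rfl⟩
  have hb : b ∈ (S.inputs (S.next a)).val := mem_inputs.2 ⟨h.2.1, h.2.2.symm⟩
  have := hi _ (Multiset.mem_map_of_mem _ ha) _ (Multiset.mem_map_of_mem _ hb) hab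
  exact Multiset.inj_on_of_nodup_map hn a ha b hb this

/-! ### Planar structures -/

/-- A planar structure: a linear order (here its strict part) on the inputs of each vertex. -/
@[ext]
structure Planar (T : OTree) where
  lt : T.E → T.E → Prop
  sib : ∀ a b, lt a b → T.Sib a b
  irrefl : ∀ a, ¬ lt a a
  trans : ∀ a b c, lt a b → lt b c → lt a c
  total : ∀ a b, T.Sib a b → a ≠ b → lt a b ∨ lt b a

namespace Planar

variable {T : OTree} (p : Planar T)

/-- `x` is drawn to the left of `y`: their paths to the root enter some vertex through different
inputs, the one of `x` being the smaller. -/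
def LeftOf (x y : T.E) : Prop := ∃ a b, p.lt a b ∧ a ≤ x ∧ b ≤ y

variable {p}

theorem LeftOf.trans {x y z : T.E} (h1 : p.LeftOf x y) (h2 : p.LeftOf y z) : p.LeftOf x z := by
  obtain ⟨a, b, hab, ha, hb⟩ := h1
  obtain ⟨c, d, hcd, hc, hd⟩ := h2
  rcases comparable hb hc with h | h
  · rcases h.eq_or_lt with rfl | h
    · exact ⟨a, d, p.trans _ _ _ hab hcd, ha, hd⟩
    · exact ⟨a, b, hab, ha, ((p.sib _ _ hcd).lt_of_lt h).le.trans hd⟩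
  · rcases h.eq_or_lt with rfl | h
    · exact ⟨a, d, p.trans _ _ _ hab hcd, ha, hd⟩
    · exact ⟨c, d, hcd, ((p.sib _ _ hab).symm.lt_of_lt h).le.trans ha, hd⟩

theorem LeftOf.irrefl {x : T.E} : ¬ p.LeftOf x x := by
  rintro ⟨a, b, hab, ha, hb⟩
  have hs := p.sib _ _ hab
  rcases comparable ha hb with h | h
  · exact p.irrefl b (hs.eq_of_le h ▸ hab)
  · exact p.irrefl a (hs.symm.eq_of_le h ▸ hab)

theorem LeftOf.total {x y : T.E} (h1 : ¬ x ≤ y) (h2 : ¬ y ≤ x) : p.LeftOf x y ∨ p.LeftOf y x := by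
  obtain ⟨a, b, hs, hn, ha, hb⟩ := exists_sib h1 h2
  rcases p.total a b hs hn with h | h
  · exact Or.inl ⟨a, b, h, ha, hb⟩
  · exact Or.inr ⟨b, a, h, hb, ha⟩

variable (p)

/-- The presheaf of planar structures on morphisms: the inputs of a vertex `v` of `S` are sent by
`f : S ⟶ T` to the leaves of a subtree of `T`, and are ordered from left to right as these. -/
def pullback {S : OTree} (f : S ⟶ T) : Planar S where
  lt a b := S.Sib a b ∧ p.LeftOf (onEdges f a) (onEdges f b)
  sib _ _ h := h.1
  irrefl _ h := h.2.irrefl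
  trans _ _ _ h1 h2 := ⟨⟨h1.1.1, h2.1.2.1, h1.1.2.2.trans h2.1.2.2⟩, h1.2.trans h2.2⟩
  total _ _ hs hn := by
    rcases LeftOf.total (p := p) (fun h => hn (Hom.sib_eq f hs h))
      (fun h => hn (Hom.sib_eq f hs.symm h).symm) with h | h
    · exact Or.inl ⟨hs, h⟩
    · exact Or.inr ⟨hs.symm, h⟩

/-- The order in which vertices are labelled: a vertex comes before everything above it, and the
vertices on a branch come before those on the branches to its right. -/
def Before (u v : T.E) : Prop := u < v ∨ p.LeftOf u v

variable {p}

theorem Before.trans {u v w : T.E} (h1 : p.Before u v) (h2 : p.Before v w) : p.Before u w := by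
  rcases h1 with h1 | h1 <;> rcases h2 with h2 | h2
  · exact Or.inl (h1.trans h2)
  · obtain ⟨a, b, hab, ha, hb⟩ := h2
    rcases comparable h1.le ha with h | h
    · rcases h.eq_or_lt with rfl | h
      · exact Or.inr ⟨_, _, hab, le_rfl, hb⟩
      · exact Or.inl (((p.sib _ _ hab).lt_of_lt h).trans_le hb)
    · exact Or.inr ⟨_, _, hab, h, hb⟩
  · obtain ⟨a, b, hab, ha, hb⟩ := h1
    exact Or.inr ⟨a, b, hab, ha, hb.trans h2.le⟩
  · exact Or.inr (h1.trans h2)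

theorem Before.irrefl {u : T.E} : ¬ p.Before u u := by
  rintro (h | h)
  · exact lt_irrefl _ h
  · exact LeftOf.irrefl h

theorem Before.total {u v : T.E} (h : u ≠ v) : p.Before u v ∨ p.Before v u := by
  by_cases h1 : u ≤ v
  · exact Or.inl (Or.inl (lt_of_le_of_ne h1 h))
  by_cases h2 : v ≤ u
  · exact Or.inr (Or.inl (lt_of_le_of_ne h2 h.symm))
  rcases LeftOf.total (p := p) h1 h2 with h | h
  · exact Or.inl (Or.inr h)
  · exact Or.inr (Or.inr h)

variable (p)

/-- The label of a vertex: the number of vertices labelled before it. -/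
noncomputable def label (v : T.E) : ℕ := {u : T.vert | p.Before u v}.ncard

variable {p}

theorem label_lt_label {u v : T.E} (hu : u ∈ T.vert) (h : p.Before u v) :
    p.label u < p.label v := by
  apply Set.ncard_lt_ncard _ (Set.toFinite _)
  refine ⟨fun w hw => hw.trans h, fun hs => ?_⟩
  exact Before.irrefl (hs (show (⟨u, hu⟩ : T.vert) ∈ {w : T.vert | p.Before w v} from h))

theorem label_lt_size {v : T.E} (hv : v ∈ T.vert) : p.label v < T.size := by
  have : p.label v < (Set.univ : Set T.vert).ncard := by
    apply Set.ncard_lt_ncard _ (Set.toFinite _)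
    refine ⟨Set.subset_univ _, fun hs => ?_⟩
    exact Before.irrefl (hs (Set.mem_univ (⟨v, hv⟩ : T.vert)))
  rwa [Set.ncard_univ] at this

variable (p)

/-- The labelling of the vertices by `0, …, |T| - 1`. -/
noncomputable def labelling : T.vert ≃ Fin T.size :=
  Equiv.ofBijective (fun v => ⟨p.label v, label_lt_size v.2⟩) <| by
    rw [Nat.bijective_iff_injective_and_card]
    refine ⟨fun u v huv => ?_, by simp [size]⟩
    by_contra hne
    have huv' : p.label u = p.label v := congrArg Fin.val huv
    rcases Before.total (p := p) (fun h => hne (Subtype.ext h) : (u : T.E) ≠ v) with h | h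
    · exact absurd (label_lt_label u.2 h) (by omega)
    · exact absurd (label_lt_label v.2 h) (by omega)

/-- `sgn(p', p)`, the sign of the permutation of the labels which sends the labelling induced by `p'`
to the one induced by `p`. (The label `0` is fixed, and so does not contribute to the sign.) -/
noncomputable def sgn (p' p : Planar T) : ℤ :=
  Equiv.Perm.sign (p'.labelling.symm.trans p.labelling)

end Planar

/-! ### Elementary faces -/

/-- Elementary faces of `T`: inner faces, given by an inner edge `e`; top faces, given by a vertex `w`
all of whose inputs are leaves; bottom faces, given by an input `e` of the root vertex such that all
other inputs of the root vertex are leaves. -/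
inductive Face (T : OTree) : Type
  | inner (e : T.E) (he : e ≠ T.root) (hv : e ∈ T.vert)
  | top (w : T.E) (hw : w ∈ T.vert) (hl : ∀ e ∈ T.inputs w, e ∉ T.vert)
  | bottom (e : T.E) (he : e ∈ T.inputs T.root) (hl : ∀ e' ∈ T.inputs T.root, e' ≠ e → e' ∉ T.vert)

instance (T : OTree) : Finite T.Face := by
  refine Finite.of_injective (β := Fin 3 × T.E) (fun a => match a with
    | .inner e _ _ => (0, e)
    | .top w _ _ => (1, w)
    | .bottom e _ _ => (2, e)) ?_
  rintro (_ | _ | _) (_ | _ | _) h <;> simp_all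

noncomputable instance (T : OTree) : Fintype T.Face := Fintype.ofFinite _

open Classical in
/-- The tree obtained by contracting the inner edge `e`. -/
noncomputable def innerFace (T : OTree) (e : T.E) (he : e ≠ T.root) : OTree where
  E := {x : T.E // x ≠ e}
  finite := inferInstance
  root := ⟨T.root, he.symm⟩
  next x := if h : T.next x = e then ⟨T.next e, next_ne he⟩ else ⟨T.next x, h⟩
  next_root := by
    have h : ¬ T.next T.root = e := by rw [T.next_root]; exact he.symm
    rw [dif_neg h]
    exact Subtype.ext T.next_root
  reach := reach_of_height _ _ (fun x => T.height x) <| by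
    rintro ⟨x, hx⟩ hx'
    have hx' : x ≠ T.root := fun h => hx' (Subtype.ext h)
    have h1 := T.height_next x hx'
    dsimp only
    split_ifs with h
    · have h2 := T.height_next e he
      rw [h] at h1
      dsimp only
      omega
    · dsimp only
      omega
  vert := {x | (x : T.E) ∈ T.vert}
  next_mem := by
    rintro ⟨x, hx⟩ hx'
    have hx' : x ≠ T.root := fun h => hx' (Subtype.ext h)
    dsimp only
    split_ifs with h
    · exact T.next_mem e he
    · exact T.next_mem x hx'

/-- The tree obtained by chopping off the top vertex `w` and all its inputs. -/
noncomputable def topFace (T : OTree) (w : T.E) (hl : ∀ e ∈ T.inputs w, e ∉ T.vert) : OTree where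
  E := {x : T.E // x ∉ T.inputs w}
  finite := inferInstance
  root := ⟨T.root, fun h => (mem_inputs.1 h).1 rfl⟩
  next x := ⟨T.next x, fun h => by
    have hx : (x : T.E) ≠ T.root := by
      intro hx
      rw [hx, T.next_root] at h
      exact (mem_inputs.1 h).1 rfl
    exact hl _ h (T.next_mem x hx)⟩
  next_root := Subtype.ext T.next_root
  reach := reach_of_height _ _ (fun x => T.height x) <| by
    rintro ⟨x, hx⟩ hx'
    have hx' : x ≠ T.root := fun h => hx' (Subtype.ext h)
    have h1 := T.height_next x hx'
    dsimp only
    omega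
  vert := {x | (x : T.E) ∈ T.vert ∧ (x : T.E) ≠ w}
  next_mem := by
    rintro ⟨x, hx⟩ hx'
    have hx' : x ≠ T.root := fun h => hx' (Subtype.ext h)
    exact ⟨T.next_mem x hx', fun h => hx (mem_inputs.2 ⟨hx', h⟩)⟩

open Classical in
/-- The part of the tree above the edge `e`; this is the tree obtained by chopping off the root vertex
with the root and all inputs other than `e`, if these other inputs are leaves. -/
noncomputable def bottomFace (T : OTree) (e : T.E) : OTree where
  E := {x : T.E // e ≤ x}
  finite := inferInstance
  root := ⟨e, le_rfl⟩
  next x := if h : (x : T.E) = e then ⟨e, le_rfl⟩ else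
    ⟨T.next x, le_next_of_lt (lt_of_le_of_ne x.2 (Ne.symm h))⟩
  next_root := by simp
  reach := reach_of_height _ _ (fun x => T.height x) <| by
    rintro ⟨x, hx⟩ hx'
    have hx' : x ≠ e := fun h => hx' (Subtype.ext h)
    have h1 := T.height_next x (ne_root_of_lt (lt_of_le_of_ne hx hx'.symm))
    simp only [hx', dite_false]
    omega
  vert := {x | (x : T.E) ∈ T.vert}
  next_mem := by
    rintro ⟨x, hx⟩ hx'
    have hx' : x ≠ e := fun h => hx' (Subtype.ext h)
    simp only [hx', dite_false]
    exact T.next_mem x (ne_root_of_lt (lt_of_le_of_ne hx hx'.symm))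

theorem innerFace_mem_inputs {T : OTree} {e : T.E} (he : e ≠ T.root) {v x : (T.innerFace e he).E} :
    x ∈ (T.innerFace e he).inputs v ↔
      x.1 ∈ T.inputs v.1 ∨ (T.next e = v.1 ∧ x.1 ∈ T.inputs e) := by
  classical
  refine mem_inputs.trans ?_
  obtain ⟨v, hv⟩ := v
  obtain ⟨x, hx⟩ := x
  change ((⟨x, hx⟩ : {x : T.E // x ≠ e}) ≠ ⟨T.root, he.symm⟩ ∧
    (if h : T.next x = e then (⟨T.next e, next_ne he⟩ : {x : T.E // x ≠ e}) else ⟨T.next x, h⟩)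
      = ⟨v, hv⟩) ↔ x ∈ T.inputs v ∨ (T.next e = v ∧ x ∈ T.inputs e)
  rw [mem_inputs, mem_inputs]
  split_ifs with h
  · simp only [ne_eq, Subtype.mk.injEq, h]
    constructor
    · rintro ⟨h1, h2⟩
      exact Or.inr ⟨h2, h1, trivial⟩
    · rintro (⟨-, h2⟩ | ⟨h1, h2, -⟩)
      · exact absurd h2.symm hv
      · exact ⟨h2, h1⟩
  · simp [h]

theorem topFace_mem_inputs {T : OTree} {w : T.E} (hl : ∀ e ∈ T.inputs w, e ∉ T.vert)
    {v x : (T.topFace w hl).E} :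
    x ∈ (T.topFace w hl).inputs v ↔ x.1 ∈ T.inputs v.1 := by
  refine mem_inputs.trans (Iff.trans ?_ mem_inputs.symm)
  exact and_congr (not_congr Subtype.ext_iff) Subtype.ext_iff

theorem bottomFace_mem_inputs {T : OTree} {e : T.E} {v x : (T.bottomFace e).E} :
    x ∈ (T.bottomFace e).inputs v ↔ x.1 ∈ T.inputs v.1 := by
  classical
  refine mem_inputs.trans (Iff.trans ?_ mem_inputs.symm)
  obtain ⟨v, hv⟩ := v
  obtain ⟨x, hx⟩ := x
  change ((⟨x, hx⟩ : {x : T.E // e ≤ x}) ≠ ⟨e, le_rfl⟩ ∧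
    (if h : x = e then (⟨e, le_rfl⟩ : {x : T.E // e ≤ x}) else
      ⟨T.next x, le_next_of_lt (lt_of_le_of_ne hx (Ne.symm h))⟩) = ⟨v, hv⟩) ↔
    x ≠ T.root ∧ T.next x = v
  by_cases h : x = e
  · subst h
    simp only [ne_eq, not_true_eq_false, false_and, false_iff, not_and]
    rintro h rfl
    exact absurd (next_lt h) (not_lt_of_ge hv)
  · have h' := ne_root_of_lt (lt_of_le_of_ne hx (Ne.symm h))
    simp [h, h']

theorem Op.map_inputs {S T : OTree} {f : S.E → T.E} {v : S.E} {m : Multiset T.E} {e : T.E}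
    (h : T.Op m e) (hf : ∀ x ∈ S.inputs v, ∀ y ∈ S.inputs v, f x = f y → x = y)
    (hm : ∀ x, (∃ y ∈ S.inputs v, f y = x) ↔ x ∈ m) : T.Op ((S.inputs v).val.map f) e := by
  have h1 : ((S.inputs v).val.map f).Nodup :=
    Multiset.Nodup.map_on hf (S.inputs v).nodup
  rwa [(h1.ext h.antichain.1).2 fun x => by simpa using hm x]

namespace Face

variable {T : OTree}

/-- The elementary face `∂_a T`. -/
noncomputable def tree : T.Face → OTree
  | inner e he _ => T.innerFace e he
  | top w _ hl => T.topFace w hl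
  | bottom e _ _ => T.bottomFace e

/-- The elementary face map `∂_a : ∂_a T ⟶ T`; on edges it is the inclusion. -/
noncomputable def map : (a : T.Face) → (a.tree ⟶ T)
  | inner e he hv => Hom.mk (S := T.innerFace e he) Subtype.val <| by
      intro v hv'
      by_cases h : T.next e = v.1
      · have h1 : e ∈ (T.inputs v.1).val := mem_inputs.2 ⟨he, h⟩
        obtain ⟨m, hm⟩ := Multiset.exists_cons_of_mem h1
        have h2 := Op.vertex (T := T) (v := v.1) hv'
        have hem : e ∉ m := (Multiset.nodup_cons.1 (hm ▸ h2.antichain.1)).1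
        rw [hm] at h2
        refine (Op.comp _ _ _ hv h2).map_inputs
          (fun x _ y _ hxy => Subtype.val_injective hxy) fun x => ?_
        have h3 : x ∈ T.inputs v.1 ↔ x = e ∨ x ∈ m := by
          rw [← Finset.mem_val, hm, Multiset.mem_cons]
        rw [Multiset.mem_add, Finset.mem_val]
        constructor
        · rintro ⟨y, hy, rfl⟩
          rcases (innerFace_mem_inputs he).1 hy with hy | hy
          · exact Or.inr ((h3.1 hy).resolve_left y.2)
          · exact Or.inl hy.2
        · intro hx
          have hxe : x ≠ e := by
            rintro rfl
            rcases hx with hx | hx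
            · exact next_ne he (mem_inputs.1 hx).2
            · exact hem hx
          refine ⟨⟨x, hxe⟩, (innerFace_mem_inputs he).2 ?_, rfl⟩
          rcases hx with hx | hx
          · exact Or.inr ⟨h, hx⟩
          · exact Or.inl (h3.2 (Or.inr hx))
      · refine (Op.vertex (T := T) (v := v.1) hv').map_inputs
          (fun x _ y _ hxy => Subtype.val_injective hxy) fun x => ?_
        rw [Finset.mem_val]
        constructor
        · rintro ⟨y, hy, rfl⟩
          exact ((innerFace_mem_inputs he).1 hy).resolve_right fun h' => h h'.1
        · intro hx
          have hxe : x ≠ e := by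
            rintro rfl
            exact h (mem_inputs.1 hx).2
          exact ⟨⟨x, hxe⟩, (innerFace_mem_inputs he).2 (Or.inl hx), rfl⟩
  | top w hw hl => Hom.mk (S := T.topFace w hl) Subtype.val <| by
      intro v hv'
      refine (Op.vertex (T := T) (v := v.1) hv'.1).map_inputs
        (fun x _ y _ hxy => Subtype.val_injective hxy) fun x => ?_
      rw [Finset.mem_val]
      constructor
      · rintro ⟨y, hy, rfl⟩
        exact (topFace_mem_inputs hl).1 hy
      · intro hx
        exact ⟨⟨x, fun h => hv'.2 ((mem_inputs.1 hx).2.symm.trans (mem_inputs.1 h).2)⟩,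
          (topFace_mem_inputs hl).2 hx, rfl⟩
  | bottom e he hl => Hom.mk (S := T.bottomFace e) Subtype.val <| by
      intro v hv'
      refine (Op.vertex (T := T) (v := v.1) hv').map_inputs
        (fun x _ y _ hxy => Subtype.val_injective hxy) fun x => ?_
      rw [Finset.mem_val]
      constructor
      · rintro ⟨y, hy, rfl⟩
        exact bottomFace_mem_inputs.1 hy
      · intro hx
        exact ⟨⟨x, v.2.trans ((mem_inputs.1 hx).2 ▸ next_le x)⟩, bottomFace_mem_inputs.2 hx, rfl⟩

theorem size_add_one (a : T.Face) : a.tree.size + 1 = T.size := by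
  have key : ∀ (S : OTree) (f : S.E → T.E), Function.Injective f → ∀ w ∈ T.vert,
      (∀ x, x ∈ T.vert ∧ x ≠ w ↔ ∃ y ∈ S.vert, f y = x) → S.size + 1 = T.size := by
    intro S f hf w hw h
    have h1 : T.vert \ {w} = f '' S.vert := by
      ext x
      simpa using h x
    have h2 := Set.ncard_sdiff_singleton_add_one hw (Set.toFinite _)
    rw [h1, Set.ncard_image_of_injective _ hf] at h2
    exact h2
  cases a with
  | inner e he hv =>
    refine key (T.innerFace e he) Subtype.val Subtype.val_injective e hv fun x => ?_
    exact ⟨fun h => ⟨⟨x, h.2⟩, h.1, rfl⟩, by rintro ⟨y, hy, rfl⟩; exact ⟨hy, y.2⟩⟩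
  | top w hw hl =>
    refine key (T.topFace w hl) Subtype.val Subtype.val_injective w hw fun x => ?_
    exact ⟨fun h => ⟨⟨x, fun h' => hl x h' h.1⟩, h, rfl⟩, by rintro ⟨y, hy, rfl⟩; exact hy⟩
  | bottom e he hl =>
    have he' := mem_inputs.1 he
    have hr : T.root ∈ T.vert := he'.2 ▸ T.next_mem e he'.1
    refine key (T.bottomFace e) Subtype.val Subtype.val_injective T.root hr fun x => ?_
    constructor
    · rintro ⟨hx, hx'⟩
      refine ⟨⟨x, ?_⟩, hx, rfl⟩
      obtain ⟨b, hb, hb', hb''⟩ := exists_child (lt_of_le_of_ne (root_le x) (Ne.symm hx'))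
      by_cases hbe : b = e
      · exact hbe ▸ hb
      · have hbl := hl b (mem_inputs.2 ⟨hb', hb''⟩) hbe
        exfalso
        rcases hb.eq_or_lt with rfl | h
        · exact hbl hx
        · obtain ⟨c, -, hc, hc'⟩ := exists_child h
          exact hbl (hc' ▸ T.next_mem c hc)
    · rintro ⟨y, hy, rfl⟩
      refine ⟨hy, fun h => ?_⟩
      have h1 : e ≤ T.root := h ▸ y.2
      exact he'.1 (le_antisymm h1 (root_le e))

/-- The sign `sgn_p(∂_a)`, for a planar structure `p`. -/
noncomputable def sgn (p : Planar T) : T.Face → ℤ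
  | inner e _ _ => (-1) ^ p.label e
  | top w _ _ => (-1) ^ (p.label w + 1)
  | bottom _ _ _ => 1

end Face

/-! ### Elementary degeneracies -/

open Classical in
/-- The tree `σ_e T` obtained from `T` by adding a copy `none` of the edge `e = some e` and a unary
vertex with input `none` and output `some e`. -/
noncomputable def degen (T : OTree) (e : T.E) : OTree where
  E := Option T.E
  finite := inferInstance
  root := some T.root
  next
    | none => some e
    | some x => if x = T.root then some T.root else if T.next x = e then none else some (T.next x)
  next_root := by simp
  reach := reach_of_height _ _
    (fun x => match x with | none => 2 * T.height e + 1 | some x => 2 * T.height x) <| by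
      rintro (_ | x) hx
      · simp
      · have hx : x ≠ T.root := fun h => hx (congrArg some h)
        have h1 := T.height_next x hx
        simp only [hx, if_false]
        split_ifs with h
        · rw [h] at h1
          dsimp only
          omega
        · dsimp only
          omega
  vert := {x | match x with | none => e ∈ T.vert | some x => x ∈ T.vert ∨ x = e}
  next_mem := by
    rintro (_ | x) hx
    · simp
    · have hx : x ≠ T.root := fun h => hx (congrArg some h)
      simp only [hx, if_false]
      split_ifs with h
      · exact h ▸ T.next_mem x hx
      · exact Or.inl (T.next_mem x hx)

theorem size_degen (T : OTree) (e : T.E) : (T.degen e).size = T.size + 1 := by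
  classical
  have h2 := Set.ncard_sdiff_singleton_add_one (s := (T.degen e).vert) (a := some e) (Or.inr rfl)
    (Set.toFinite (α := Option T.E) _)
  have h3 : ((T.degen e).vert \ {some e}).ncard = T.vert.ncard := by
    symm
    apply Set.ncard_congr (fun x _ => if x = e then none else some x)
    · intro x hx
      by_cases h : x = e
      · subst h
        rw [if_pos rfl]
        exact ⟨hx, fun h => Option.some_ne_none _ (Set.mem_singleton_iff.1 h).symm⟩
      · rw [if_neg h]
        exact ⟨Or.inl hx, fun h' => h (Option.some_injective _ (Set.mem_singleton_iff.1 h'))⟩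
    · intro x y _ _ h
      split_ifs at h with h1 h2 h2
      · exact h1.trans h2.symm
      · exact Option.some_injective _ h
    · rintro (_ | x) ⟨hx, hx'⟩
      · exact ⟨e, hx, if_pos rfl⟩
      · have hx' : x ≠ e := fun h => hx' (congrArg some h)
        exact ⟨x, hx.resolve_right hx', if_neg hx'⟩
  have h4 : (T.degen e).size = (T.degen e).vert.ncard := rfl
  have h5 : T.size = T.vert.ncard := rfl
  omega

theorem degen_mem_inputs_none {T : OTree} {e : T.E} {x : Option T.E} :
    x ∈ (T.degen e).inputs (none : Option T.E) ↔ ∃ y ∈ T.inputs e, some y = x := by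
  classical
  refine mem_inputs.trans ?_
  rcases x with _ | x
  · constructor
    · rintro ⟨-, h⟩
      exact absurd h (Option.some_ne_none _)
    · rintro ⟨y, -, h⟩
      exact absurd h (Option.some_ne_none _)
  · change ((some x : Option T.E) ≠ some T.root ∧ (if x = T.root then some T.root else
      if T.next x = e then none else some (T.next x)) = none) ↔ _
    by_cases h1 : x = T.root <;> by_cases h2 : T.next x = e <;> simp [h1, h2, mem_inputs]

theorem degen_mem_inputs_some {T : OTree} {e v : T.E} {x : Option T.E} :
    x ∈ (T.degen e).inputs (some v : Option T.E) ↔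
      (v = e ∧ x = none) ∨ (v ≠ e ∧ ∃ y ∈ T.inputs v, some y = x) := by
  classical
  refine mem_inputs.trans ?_
  rcases x with _ | x
  · change ((none : Option T.E) ≠ some T.root ∧ some e = some v) ↔ _
    simp [eq_comm]
  · change ((some x : Option T.E) ≠ some T.root ∧ (if x = T.root then some T.root else
      if T.next x = e then none else some (T.next x)) = some v) ↔ _
    by_cases h1 : x = T.root
    · simp [h1, mem_inputs]
    · by_cases h2 : T.next x = e
      · simp [h1, h2, mem_inputs, eq_comm]
      · simp only [ne_eq, Option.some.injEq, h1, not_false_eq_true, if_false, h2, true_and,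
          mem_inputs, reduceCtorEq, and_false, false_or, exists_eq_right]
        constructor
        · rintro rfl
          exact ⟨h2, rfl⟩
        · exact fun h => h.2

/-- The elementary degeneracy map `σ_e : σ_e T ⟶ T`. -/
noncomputable def degenMap (T : OTree) (e : T.E) : T.degen e ⟶ T :=
  Hom.mk (S := T.degen e) (fun x => Option.getD x e) <| by
    rintro (_ | v) hv
    · refine (Op.vertex (T := T) (v := e) hv).map_inputs ?_ ?_
      · intro x hx y hy hxy
        obtain ⟨x, -, rfl⟩ := degen_mem_inputs_none.1 hx
        obtain ⟨y, -, rfl⟩ := degen_mem_inputs_none.1 hy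
        exact congrArg some hxy
      · intro x
        constructor
        · rintro ⟨y, hy, rfl⟩
          obtain ⟨y, hy', rfl⟩ := degen_mem_inputs_none.1 hy
          exact hy'
        · intro hx
          exact ⟨some x, degen_mem_inputs_none.2 ⟨x, hx, rfl⟩, rfl⟩
    · by_cases hve : v = e
      · subst hve
        refine (Op.id (T := T) v).map_inputs ?_ ?_
        · intro x hx y hy _
          have hx := (degen_mem_inputs_some.1 hx).resolve_right fun h => h.1 rfl
          have hy := (degen_mem_inputs_some.1 hy).resolve_right fun h => h.1 rfl
          exact hx.2.trans hy.2.symm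
        · intro x
          rw [Multiset.mem_singleton]
          constructor
          · rintro ⟨y, hy, rfl⟩
            have hy := (degen_mem_inputs_some.1 hy).resolve_right fun h => h.1 rfl
            exact congrArg (fun z => Option.getD z v) hy.2
          · rintro rfl
            exact ⟨(none : Option T.E), degen_mem_inputs_some.2 (Or.inl ⟨rfl, rfl⟩), rfl⟩
      · refine (Op.vertex (T := T) (v := v) (hv.resolve_right hve)).map_inputs ?_ ?_
        · intro x hx y hy hxy
          obtain ⟨-, x, -, rfl⟩ := (degen_mem_inputs_some.1 hx).resolve_left fun h => hve h.1
          obtain ⟨-, y, -, rfl⟩ := (degen_mem_inputs_some.1 hy).resolve_left fun h => hve h.1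
          exact congrArg some hxy
        · intro x
          constructor
          · rintro ⟨y, hy, rfl⟩
            obtain ⟨-, y, hy', rfl⟩ := (degen_mem_inputs_some.1 hy).resolve_left fun h => hve h.1
            exact hy'
          · intro hx
            exact ⟨some x, degen_mem_inputs_some.2 (Or.inr ⟨hve, x, hx, rfl⟩), rfl⟩

end OTree

/-! ### Dendroidal sets and their chain complexes -/

/-- Dendroidal sets: presheaves of sets on the category `Ω` of trees. -/
abbrev DSet := OTreeᵒᵖ ⥤ Type u

namespace DSet

variable (X : DSet.{u})

/-- The set `X_T` of `T`-dendrices of `X`. -/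
abbrev Dendrex (T : OTree) : Type u := X.obj (Opposite.op T)

variable {X} in
/-- The map `f^* : X_T → X_S` induced by `f : S ⟶ T`. -/
def res {S T : OTree} (f : S ⟶ T) (x : X.Dendrex T) : X.Dendrex S := X.map f.op x

/-- `X` is normal: for every tree `T` the group `Aut(T)` acts freely on `X_T`. -/
def IsNormal : Prop := ∀ (T : OTree) (τ : T ≅ T) (x : X.Dendrex T), res τ.hom x = x → τ = Iso.refl T

variable {X} in
/-- A dendrex is degenerate if it is in the image of `σ_e^*` for an elementary degeneracy map `σ_e`
(where the source of `σ_e` may be replaced by an isomorphic tree). -/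
def IsDegenerate {T : OTree} (x : X.Dendrex T) : Prop :=
  ∃ (S : OTree) (e : S.E) (φ : T ≅ S.degen e) (y : X.Dendrex S), x = res φ.hom (res (S.degenMap e) y)

/-- The triples `(T, p, x)` with `T` a tree with `n` vertices, `p` a planar structure on `T` and
`x ∈ X_T`. -/
structure Gen (n : ℕ) where
  tree : OTree
  size_eq : tree.size = n
  planar : tree.Planar
  dendrex : X.Dendrex tree

/-- The free abelian group `C(X)_n` on the triples `(T, p, x)`. -/
abbrev C (n : ℕ) : Type (max 1 u) := X.Gen n →₀ ℤ

/-- The subgroup `A(X)_n` of `C(X)_n` generated by the elements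
`(T, p, x) - sgn(p', τ^* p) (T', p', τ^* x)`, for `τ : T' ≅ T` and `p'` a planar structure on `T'`. -/
noncomputable def A (n : ℕ) : Submodule ℤ (X.C n) :=
  Submodule.span ℤ {c | ∃ (g g' : X.Gen n) (τ : g'.tree ≅ g.tree), g'.dendrex = res τ.hom g.dendrex ∧
    c = Finsupp.single g 1 -
      Finsupp.single g' (OTree.Planar.sgn g'.planar (g.planar.pullback τ.hom))}

variable {X} in
/-- The triple `(∂_a T, p_a, ∂_a^* x)`. -/
noncomputable def Gen.face {n : ℕ} (g : X.Gen (n + 1)) (a : g.tree.Face) : X.Gen n where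
  tree := a.tree
  size_eq := Nat.succ_injective (a.size_add_one.trans g.size_eq)
  planar := g.planar.pullback a.map
  dendrex := res a.map g.dendrex

/-- The differential on representatives: `(T, p, x) ↦ ∑_a sgn_p(∂_a) (∂_a T, p_a, ∂_a^* x)`. -/
noncomputable def boundary (n : ℕ) : X.C (n + 1) →ₗ[ℤ] X.C n :=
  Finsupp.linearCombination ℤ fun g => ∑ a : g.tree.Face, Finsupp.single (g.face a) (a.sgn g.planar)

/-- The group `Ch^{un}(X)_n = C(X)_n / A(X)_n`. -/
abbrev UnGroup (n : ℕ) : Type (max 1 u) := X.C n ⧸ X.A n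

/-- The subgroup `D(X)_n` of `Ch^{un}(X)_n` generated by the classes of degenerate dendrices. -/
noncomputable def D (n : ℕ) : Submodule ℤ (X.UnGroup n) :=
  Submodule.span ℤ {c | ∃ g : X.Gen n, IsDegenerate g.dendrex ∧
    c = (X.A n).mkQ (Finsupp.single g 1)}

/-- The differential is well defined on classes. -/
def BoundaryDescends : Prop := ∀ n, X.A (n + 1) ≤ (X.A n).comap (X.boundary n)

variable {X}

/-- The differential `d : Ch^{un}(X)_{n+1} → Ch^{un}(X)_n`. -/
noncomputable def d (h : X.BoundaryDescends) (n : ℕ) : X.UnGroup (n + 1) →ₗ[ℤ] X.UnGroup n :=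
  (X.A (n + 1)).mapQ (X.A n) (X.boundary n) (h n)

/-- The unnormalized chain complex `Ch^{un}(X)`. -/
noncomputable def chUn (h : X.BoundaryDescends) (hd : ∀ n, d h n ∘ₗ d h (n + 1) = 0) :
    ChainComplex (ModuleCat.{max 1 u} ℤ) ℕ :=
  ChainComplex.of (fun n => ModuleCat.of ℤ (X.UnGroup n)) (fun n => ModuleCat.ofHom (d h n))
    fun n => by rw [← ModuleCat.ofHom_comp, hd n]; rfl

/-- The normalized chain complex `Ch(X) = Ch^{un}(X) / D(X)`. -/
noncomputable def ch (h : X.BoundaryDescends) (hd : ∀ n, d h n ∘ₗ d h (n + 1) = 0)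
    (hD : ∀ n, X.D (n + 1) ≤ (X.D n).comap (d h n)) : ChainComplex (ModuleCat.{max 1 u} ℤ) ℕ :=
  ChainComplex.of (fun n => ModuleCat.of ℤ (X.UnGroup n ⧸ X.D n))
    (fun n => ModuleCat.ofHom ((X.D (n + 1)).mapQ (X.D n) (d h n) (hD n)))
    fun n => by
      refine ModuleCat.hom_ext (LinearMap.ext fun x => ?_)
      obtain ⟨x, rfl⟩ := (X.D (n + 1 + 1)).mkQ_surjective x
      exact congrArg (X.D n).mkQ (LinearMap.congr_fun (hd n) x)

/-- The quotient map `Ch^{un}(X) → Ch(X)`. -/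
noncomputable def chUnToCh (h : X.BoundaryDescends) (hd : ∀ n, d h n ∘ₗ d h (n + 1) = 0)
    (hD : ∀ n, X.D (n + 1) ≤ (X.D n).comap (d h n)) : chUn h hd ⟶ ch h hd hD :=
  ChainComplex.ofHom (fun n => ModuleCat.ofHom (X.D n).mkQ) fun n => by
    have h1 : (chUn h hd).d (n + 1) n = ModuleCat.ofHom (d h n) :=
      ChainComplex.of_d (fun n => ModuleCat.of ℤ (X.UnGroup n)) (fun n => ModuleCat.ofHom (d h n)) n
    have h2 : (ch h hd hD).d (n + 1) n =
        ModuleCat.ofHom ((X.D (n + 1)).mapQ (X.D n) (d h n) (hD n)) :=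
      ChainComplex.of_d (fun n => ModuleCat.of ℤ (X.UnGroup n ⧸ X.D n))
        (fun n => ModuleCat.ofHom ((X.D (n + 1)).mapQ (X.D n) (d h n) (hD n))) n
    refine (congrArg (fun f => ModuleCat.ofHom (X.D (n + 1)).mkQ ≫ f) h2).trans ?_
    exact (congrArg (fun f => f ≫ ModuleCat.ofHom (X.D n).mkQ) h1).symm

end DSet

/-! A tree is handled as its poset of edges with a marked set of vertices; a face is a subtree which
loses exactly one vertex. The sign of a face is ε · (-1)^(label of the lost vertex), with ε = -1 for
top faces and ε = 1 otherwise (`Face.sgn_eq`). Losing a vertex r changes sgn(p', p) by the parity of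
the two labels of r (`Planar.sgn_removes`), so d respects the relations (`bd_iso`). Losing a first
vertex shifts the label of a second one precisely if the first comes before it. So two double faces
which lose the same two vertices in opposite orders cancel if their products of ε agree, and two
which lose them in the same order cancel if these products are opposite. `Face.hasPartner` matches
all double faces in this way, whence d² = 0.

If x is degenerate at a unary vertex, the two faces which miss the output or the input edge of this
vertex have the same class and opposite signs, and all other faces are again degenerate; so D is a
subcomplex (`bd_mem_D`).

As the quotient map is onto, it remains to see that D is acyclic (`exists_of_mem_D`). For normal X
every dendrex is a degeneracy of a nondegenerate one, its core, which is unique up to an isomorphism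
compatible with the degeneracy maps (`Core.exists_iso`). The edges of T with the same image in the
core form chains of degenerate unary vertices. Filter D by the rank, the number of nondegenerate
vertices. A face which keeps all degenerate vertices lowers the rank. The m + 1 faces which miss one
edge of a chain of m degenerate vertices all have the same class, with alternating signs. So modulo
lower rank d shortens each chain of even length by one vertex, up to sign, and chains of odd length
contribute nothing (`bd_sub_mem_F`).

A contracting homotopy for the graded pieces lengthens one chain. If its length is odd, d undoes the
lengthening; if it is even, the homotopy undoes the shortening; the terms from the other chains
cancel (`homotopy_sum`). The chain has to be chosen compatibly with isomorphisms. For this each edge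
gets a colour, the isomorphism class of the core with the image of the edge marked. By normality
different edges of a core have different colours, so a choice of one colour in each nonempty set of
colours selects a chain. Induction on the rank then shows that every cycle of positive degree in D
bounds in D; and D is zero in degree 0. -/

namespace OTree

/-! ### Morphisms of trees on the poset of edges; unary vertices; isomorphisms. -/

variable {R S T : OTree}

@[ext]
theorem hom_ext {f g : S ⟶ T} (h : ∀ x, onEdges f x = onEdges g x) : f = g :=
  Hom.ext (funext h)

@[simp]
theorem onEdges_comp (f : R ⟶ S) (g : S ⟶ T) (x : R.E) :
    onEdges (f ≫ g) x = onEdges g (onEdges f x) := rfl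

@[simp]
theorem onEdges_id (x : T.E) : onEdges (𝟙 T) x = x := rfl

theorem Op.le {m : Multiset T.E} {e : T.E} (h : T.Op m e) : ∀ x ∈ m, e ≤ x := by
  induction h with
  | id e => simp
  | comp m x e hx _ ih =>
    intro y hy
    rcases Multiset.mem_add.1 hy with hy | hy
    · have := mem_inputs.1 (Finset.mem_def.2 hy)
      exact (ih x (by simp)).trans (this.2 ▸ next_le y)
    · exact ih y (by simp [hy])

theorem Op.eq_singleton_of_mem {m : Multiset T.E} {e : T.E} (h : T.Op m e) (he : e ∈ m) :
    m = {e} := by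
  refine (h.antichain.1.ext (Multiset.nodup_singleton e)).2 fun x => ?_
  rw [Multiset.mem_singleton]
  exact ⟨fun hx => (h.antichain.2 e he x hx (h.le x hx)).symm, fun hx => hx ▸ he⟩

/-- Operations are built from the identity by grafting vertices, and at a leaf there is no vertex to
graft first. -/
theorem Op.eq_singleton_of_leaf {m : Multiset T.E} {e : T.E} (h : T.Op m e) (he : e ∉ T.vert) :
    m = {e} := by
  induction h with
  | id e => rfl
  | comp m x e hx _ ih =>
    have h1 : x ∈ ({e} : Multiset T.E) := ih he ▸ Multiset.mem_cons_self x m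
    exact absurd (Multiset.mem_singleton.1 h1 ▸ hx) he

/-- Inputs are thus determined by the order, so that isomorphisms of trees can be checked on the
order and on the set of vertices alone. -/
theorem mem_inputs_iff_covBy {v x : T.E} : x ∈ T.inputs v ↔ v ⋖ x := by
  rw [mem_inputs]
  constructor
  · rintro ⟨h, rfl⟩
    exact ⟨next_lt h, fun c hc hc' => absurd (le_next_of_lt hc') (not_le_of_gt hc)⟩
  · intro h
    have hx := ne_root_of_lt h.lt
    exact ⟨hx, ((le_next_of_lt h.lt).eq_or_lt.resolve_right fun h' => h.2 h' (next_lt hx)).symm⟩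

theorem map_next_le (f : S ⟶ T) (b : S.E) : onEdges f (S.next b) ≤ onEdges f b := by
  by_cases hb : b = S.root
  · rw [hb, S.next_root]
  · exact (f.map_vert (S.next b) (S.next_mem b hb)).le _
      (Multiset.mem_map_of_mem _ (mem_inputs.2 ⟨hb, rfl⟩))

theorem onEdges_mono (f : S ⟶ T) : Monotone (onEdges f) := by
  rintro a b ⟨n, rfl⟩
  induction n generalizing b with
  | zero => exact le_rfl
  | succ n ih => exact (ih (b := S.next b)).trans (map_next_le f b)

/-- Incomparable edges lie above distinct siblings, whose images are incomparable; two elements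
below a common edge would be comparable. -/
theorem le_or_le_of_map_le (f : S ⟶ T) {a b : S.E} (h : onEdges f a ≤ onEdges f b) :
    a ≤ b ∨ b ≤ a := by
  by_contra! hc
  obtain ⟨c, d, hs, hne, hca, hdb⟩ := exists_sib hc.1 hc.2
  rcases comparable ((onEdges_mono f hca).trans h) (onEdges_mono f hdb) with h' | h'
  · exact hne (f.sib_eq hs h')
  · exact hne (f.sib_eq hs.symm h').symm

theorem lt_of_map_lt (f : S ⟶ T) {a b : S.E} (h : onEdges f a < onEdges f b) : a < b := by
  have h1 : ¬ b ≤ a := fun h' => absurd (onEdges_mono f h') (not_le_of_gt h)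
  exact lt_of_le_not_ge ((le_or_le_of_map_le f h.le).resolve_right h1) h1

theorem map_le_iff (f : S ⟶ T) (hf : Function.Injective (onEdges f)) {a b : S.E} :
    onEdges f a ≤ onEdges f b ↔ a ≤ b := by
  refine ⟨fun h => ?_, fun h => onEdges_mono f h⟩
  rcases h.eq_or_lt with h | h
  · exact (hf h).le
  · exact (lt_of_map_lt f h).le

theorem map_lt_iff (f : S ⟶ T) (hf : Function.Injective (onEdges f)) {a b : S.E} :
    onEdges f a < onEdges f b ↔ a < b := by
  rw [lt_iff_le_not_ge, lt_iff_le_not_ge, map_le_iff f hf, map_le_iff f hf]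

/-- `v` is a vertex whose only input is `i`. -/
structure Unary (T : OTree) (v i : T.E) : Prop where
  mem : v ∈ T.vert
  inputs_eq : T.inputs v = {i}

namespace Unary

variable {v i : T.E}

theorem mem_inputs (h : T.Unary v i) : i ∈ T.inputs v := by
  rw [h.inputs_eq]; exact Finset.mem_singleton_self i

theorem ne_root (h : T.Unary v i) : i ≠ T.root := (OTree.mem_inputs.1 h.mem_inputs).1

theorem next_eq (h : T.Unary v i) : T.next i = v := (OTree.mem_inputs.1 h.mem_inputs).2

theorem lt (h : T.Unary v i) : v < i := h.next_eq ▸ next_lt h.ne_root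

theorem lt_iff (h : T.Unary v i) {e : T.E} : v < e ↔ i ≤ e := by
  refine ⟨fun h' => ?_, fun h' => h.lt.trans_le h'⟩
  obtain ⟨b, hb, hb', hb''⟩ := exists_child h'
  have : b ∈ T.inputs v := OTree.mem_inputs.2 ⟨hb', hb''⟩
  rw [h.inputs_eq, Finset.mem_singleton] at this
  exact this ▸ hb

theorem lt_iff' (h : T.Unary v i) {e : T.E} : e < i ↔ e ≤ v :=
  ⟨fun h' => h.next_eq ▸ le_next_of_lt h', fun h' => h'.trans_lt h.lt⟩

theorem eq_of_next (h : T.Unary v i) {b : T.E} (hb : b ≠ T.root) (hv : T.next b = v) : b = i := by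
  have : b ∈ T.inputs v := OTree.mem_inputs.2 ⟨hb, hv⟩
  rwa [h.inputs_eq, Finset.mem_singleton] at this

end Unary

theorem Unary.eq {v i j : T.E} (h : T.Unary v i) (h' : T.Unary v j) : i = j :=
  (h'.eq_of_next h.ne_root h.next_eq)

/-- The image of the vertex is an operation whose output is among its inputs, hence an identity.
This is how non-injective maps produce degeneracies. -/
theorem unary_of_map_eq (f : S ⟶ T) {b : S.E} (hb : b ≠ S.root)
    (h : onEdges f (S.next b) = onEdges f b) : S.Unary (S.next b) b := by
  refine ⟨S.next_mem b hb, ?_⟩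
  have hm : b ∈ S.inputs (S.next b) := mem_inputs.2 ⟨hb, rfl⟩
  have h1 := (f.map_vert (S.next b) (S.next_mem b hb)).eq_singleton_of_mem
    (Multiset.mem_map.2 ⟨b, hm, h.symm⟩)
  have h2 := congrArg Multiset.card h1
  rw [Multiset.card_map, Multiset.card_singleton] at h2
  obtain ⟨c, hc⟩ := Finset.card_eq_one.1 h2
  rw [hc, Finset.mem_singleton] at hm
  rw [hc, hm]

/-- Edges with the same image are comparable, and by monotonicity the whole path between them is
collapsed; its topmost step is taken. -/
theorem exists_map_next_eq (f : S ⟶ T) (hf : ¬ Function.Injective (onEdges f)) :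
    ∃ b, b ≠ S.root ∧ onEdges f (S.next b) = onEdges f b := by
  have key : ∀ a b, a < b → onEdges f a = onEdges f b →
      ∃ b, b ≠ S.root ∧ onEdges f (S.next b) = onEdges f b := fun a b hab h =>
    ⟨b, ne_root_of_lt hab, le_antisymm (map_next_le f b)
      (h ▸ onEdges_mono f (le_next_of_lt hab))⟩
  simp only [Function.Injective, not_forall] at hf
  obtain ⟨a, b, h, hne⟩ := hf
  rcases le_or_le_of_map_le f h.le with h' | h'
  · exact key a b (lt_of_le_of_ne h' hne) h
  · exact key b a (lt_of_le_of_ne h' (Ne.symm hne)) h.symm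

/-- An isomorphism of the edge posets which matches vertices is a morphism of trees. -/
def homOfOrderIso (φ : S.E ≃o T.E) (hv : ∀ x ∈ S.vert, φ x ∈ T.vert) : S ⟶ T :=
  Hom.mk φ fun v hv' => (Op.vertex (hv v hv')).map_inputs (fun _ _ _ _ h => φ.injective h)
    fun x => by
      rw [Finset.mem_val, mem_inputs_iff_covBy]
      constructor
      · rintro ⟨y, hy, rfl⟩
        exact (apply_covBy_apply_iff φ).2 (mem_inputs_iff_covBy.1 hy)
      · intro hx
        refine ⟨φ.symm x, mem_inputs_iff_covBy.2 ?_, φ.apply_symm_apply x⟩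
        rwa [← apply_covBy_apply_iff φ, φ.apply_symm_apply]

/-- An isomorphism of the edge posets which matches vertices is an isomorphism of trees. -/
def isoOfOrderIso (φ : S.E ≃o T.E) (hv : ∀ x, x ∈ S.vert ↔ φ x ∈ T.vert) : S ≅ T where
  hom := homOfOrderIso φ fun x hx => (hv x).1 hx
  inv := homOfOrderIso φ.symm fun x hx => (hv _).2 (by rwa [φ.apply_symm_apply])
  hom_inv_id := hom_ext fun x => φ.symm_apply_apply x
  inv_hom_id := hom_ext fun x => φ.apply_symm_apply x

@[simp]
theorem iso_hom_inv_apply (τ : S ≅ T) (x : S.E) : onEdges τ.inv (onEdges τ.hom x) = x := by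
  rw [← onEdges_comp, τ.hom_inv_id, onEdges_id]

@[simp]
theorem iso_inv_hom_apply (τ : S ≅ T) (x : T.E) : onEdges τ.hom (onEdges τ.inv x) = x := by
  rw [← onEdges_comp, τ.inv_hom_id, onEdges_id]

theorem iso_injective (τ : S ≅ T) : Function.Injective (onEdges τ.hom) :=
  Function.LeftInverse.injective (iso_hom_inv_apply τ)

theorem iso_bijective (τ : S ≅ T) : Function.Bijective (onEdges τ.hom) :=
  ⟨iso_injective τ, Function.RightInverse.surjective (iso_inv_hom_apply τ)⟩

/-- The order isomorphism on edges underlying an isomorphism of trees. -/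
def edgeIso (τ : S ≅ T) : S.E ≃o T.E where
  toFun := onEdges τ.hom
  invFun := onEdges τ.inv
  left_inv := iso_hom_inv_apply τ
  right_inv := iso_inv_hom_apply τ
  map_rel_iff' := map_le_iff τ.hom (iso_injective τ)

/-- A map of trees which is injective on edges sends vertices to vertices. -/
theorem map_mem_vert (f : S ⟶ T) (hf : Function.Injective (onEdges f)) {v : S.E}
    (hv : v ∈ S.vert) : onEdges f v ∈ T.vert := by
  by_contra h
  have h1 := (f.map_vert v hv).eq_singleton_of_leaf h
  have h2 : onEdges f v ∈ (S.inputs v).val.map f.toFun := by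
    rw [h1]; exact Multiset.mem_singleton_self _
  obtain ⟨b, hb, hb'⟩ := Multiset.mem_map.1 h2
  have h3 : b = v := hf hb'
  have h4 := mem_inputs.1 (Finset.mem_def.2 hb)
  rw [h3] at h4
  exact next_ne h4.1 h4.2

theorem iso_mem_vert (τ : S ≅ T) {v : S.E} : onEdges τ.hom v ∈ T.vert ↔ v ∈ S.vert := by
  refine ⟨fun h => ?_, map_mem_vert τ.hom (iso_injective τ)⟩
  have := map_mem_vert τ.inv (iso_injective τ.symm) h
  rwa [iso_hom_inv_apply] at this

theorem iso_mem_inputs (τ : S ≅ T) {v x : S.E} :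
    onEdges τ.hom x ∈ T.inputs (onEdges τ.hom v) ↔ x ∈ S.inputs v := by
  rw [mem_inputs_iff_covBy, mem_inputs_iff_covBy]
  exact apply_covBy_apply_iff (edgeIso τ)

theorem root_eq_of_forall_le {r : T.E} (h : ∀ x, r ≤ x) : r = T.root :=
  le_antisymm (h _) (root_le _)

theorem iso_root (τ : S ≅ T) : onEdges τ.hom S.root = T.root :=
  root_eq_of_forall_le fun x => by
    rw [← iso_inv_hom_apply τ x]; exact onEdges_mono _ (root_le _)

theorem iso_ne_root (τ : S ≅ T) {x : S.E} : onEdges τ.hom x ≠ T.root ↔ x ≠ S.root := by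
  rw [← iso_root τ, (iso_injective τ).ne_iff]

/-- A bijection on edges between trees with equally many vertices is an isomorphism. -/
theorem isIso_of_bijective (f : S ⟶ T) (hf : Function.Bijective (onEdges f))
    (hs : T.size ≤ S.size) : IsIso f := by
  -- Vertices go to vertices by injectivity, and the count of vertices leaves no room for others.
  have h1 : onEdges f '' S.vert = T.vert := by
    apply Set.eq_of_subset_of_ncard_le
    · rintro _ ⟨v, hv, rfl⟩
      exact map_mem_vert f hf.1 hv
    · rw [Set.ncard_image_of_injective _ hf.1]
      exact hs
    · exact Set.toFinite _
  let φ : S.E ≃o T.E :=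
    { Equiv.ofBijective _ hf with map_rel_iff' := map_le_iff f hf.1 }
  have : f = (isoOfOrderIso φ fun x => by
      refine ⟨fun hx => map_mem_vert f hf.1 hx, fun hx => ?_⟩
      rw [← h1] at hx
      obtain ⟨y, hy, hxy⟩ := hx
      exact hf.1 hxy ▸ hy).hom := rfl
  rw [this]
  infer_instance

/-- Two subtrees with the same edges and the same vertices are isomorphic. -/
theorem exists_iso_of_range_eq (f : R ⟶ T) (g : S ⟶ T) (hf : Function.Injective (onEdges f))
    (hg : Function.Injective (onEdges g)) (h : Set.range (onEdges f) = Set.range (onEdges g))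
    (hv : ∀ x y, onEdges f x = onEdges g y → (x ∈ R.vert ↔ y ∈ S.vert)) :
    ∃ φ : R ≅ S, φ.hom ≫ g = f := by
  have h1 : ∀ x, ∃ y, onEdges g y = onEdges f x := fun x => by
    have : onEdges f x ∈ Set.range (onEdges g) := h ▸ Set.mem_range_self x
    exact this
  choose k hk using h1
  have hkb : Function.Bijective k := by
    constructor
    · intro x y hxy
      exact hf (by rw [← hk, ← hk, hxy])
    · intro y
      have : onEdges g y ∈ Set.range (onEdges f) := h ▸ Set.mem_range_self y
      obtain ⟨x, hx⟩ := this
      exact ⟨x, hg (by rw [hk, hx])⟩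
  let φ : R.E ≃o S.E :=
    { Equiv.ofBijective k hkb with
      map_rel_iff' := by
        intro a b
        change k a ≤ k b ↔ a ≤ b
        rw [← map_le_iff g hg, hk, hk, map_le_iff f hf] }
  exact ⟨isoOfOrderIso φ fun x => hv x (k x) (hk x).symm, hom_ext hk⟩

end OTree

/-! ### Planar structures: restriction to subtrees, labels and signs. -/

namespace OTree

variable {R S T : OTree}

namespace Planar

variable {p p' : Planar T}

theorem LeftOf.not_le {x y : T.E} (h : p.LeftOf x y) : ¬ x ≤ y := by
  rintro hxy
  obtain ⟨a, b, hab, ha, hb⟩ := h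
  have hs := p.sib _ _ hab
  rcases comparable (ha.trans hxy) hb with h | h
  · exact p.irrefl b (hs.eq_of_le h ▸ hab)
  · exact p.irrefl a (hs.symm.eq_of_le h ▸ hab)

theorem LeftOf.not_ge {x y : T.E} (h : p.LeftOf x y) : ¬ y ≤ x := by
  rintro hxy
  obtain ⟨a, b, hab, ha, hb⟩ := h
  exact LeftOf.not_le (p := p) ⟨a, b, hab, le_rfl, hb.trans hxy⟩ ha

theorem LeftOf.asymm {x y : T.E} (h : p.LeftOf x y) : ¬ p.LeftOf y x :=
  fun h' => (h.trans h').irrefl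

theorem LeftOf.mono {x y x' y' : T.E} (h : p.LeftOf x y) (hx : x ≤ x') (hy : y ≤ y') :
    p.LeftOf x' y' := by
  obtain ⟨a, b, hab, ha, hb⟩ := h
  exact ⟨a, b, hab, ha.trans hx, hb.trans hy⟩

theorem lt_iff {a b : T.E} : p.lt a b ↔ T.Sib a b ∧ p.LeftOf a b := by
  refine ⟨fun h => ⟨p.sib _ _ h, a, b, h, le_rfl, le_rfl⟩, fun ⟨h, h'⟩ => ?_⟩
  refine (p.total a b h ?_).resolve_right fun h'' => h'.asymm ⟨b, a, h'', le_rfl, le_rfl⟩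
  rintro rfl
  exact h'.irrefl

/-- Only the forward direction needs the definition. The converse follows because the relation is
total on incomparable edges and asymmetric. -/
theorem leftOf_pullback (p : Planar T) (f : S ⟶ T) {x y : S.E} :
    (p.pullback f).LeftOf x y ↔ p.LeftOf (onEdges f x) (onEdges f y) := by
  have key : ∀ {x y}, (p.pullback f).LeftOf x y → p.LeftOf (onEdges f x) (onEdges f y) := by
    rintro x y ⟨a, b, hab, ha, hb⟩
    exact hab.2.mono (onEdges_mono f ha) (onEdges_mono f hb)
  refine ⟨key, fun h => ?_⟩
  refine (LeftOf.total (p := p.pullback f) (fun h' => h.not_le (onEdges_mono f h'))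
    fun h' => h.not_ge (onEdges_mono f h')).resolve_right fun h' => h.asymm (key h')

theorem before_pullback_of_injective (p : Planar T) (f : S ⟶ T)
    (hf : Function.Injective (onEdges f)) {x y : S.E} :
    (p.pullback f).Before x y ↔ p.Before (onEdges f x) (onEdges f y) :=
  or_congr (map_lt_iff f hf).symm (leftOf_pullback p f)

theorem pullback_comp (p : Planar T) (f : R ⟶ S) (g : S ⟶ T) :
    p.pullback (f ≫ g) = (p.pullback g).pullback f := by
  ext a b
  exact and_congr Iff.rfl (leftOf_pullback p g).symm

@[simp]
theorem pullback_id (p : Planar T) : p.pullback (𝟙 T) = p := by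
  ext a b
  exact lt_iff.symm

theorem Before.asymm {x y : T.E} (h : p.Before x y) : ¬ p.Before y x :=
  fun h' => (h.trans h').irrefl

theorem not_before_iff {x y : T.E} (h : x ≠ y) : ¬ p.Before x y ↔ p.Before y x :=
  ⟨fun h' => (Before.total h).resolve_left h', fun h' => h'.asymm⟩

open Classical in
theorem before_add_before {x y : T.E} (h : x ≠ y) :
    (if p.Before x y then 1 else 0) + (if p.Before y x then 1 else 0) = 1 := by
  by_cases h' : p.Before x y
  · simp [h', h'.asymm]
  · simp [h', (not_before_iff h).1 h']

end Planar

open Classical in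
/-- The set of vertices, as a finset. -/
noncomputable def verts (T : OTree) : Finset T.E := Finset.univ.filter (· ∈ T.vert)

@[simp]
theorem mem_verts {x : T.E} : x ∈ T.verts ↔ x ∈ T.vert := by simp [verts]

theorem card_verts (T : OTree) : T.verts.card = T.size := by
  change _ = T.vert.ncard
  rw [← Set.ncard_coe_finset]
  congr 1
  ext x
  simp

/-- `f` identifies `S` with a subtree of `T` whose vertices are those of `T` except `r`. -/
structure Removes (f : S ⟶ T) (r : T.E) : Prop where
  inj : Function.Injective (onEdges f)
  mem : r ∈ T.vert
  mem_iff : ∀ y, y ∈ S.vert ↔ onEdges f y ∈ T.vert ∧ onEdges f y ≠ r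
  exists_eq : ∀ x ∈ T.vert, x ≠ r → ∃ y, onEdges f y = x

open Classical in
theorem Removes.verts_eq {f : S ⟶ T} {r : T.E} (h : Removes f r) :
    T.verts = insert r (S.verts.image (onEdges f)) := by
  ext x
  simp only [mem_verts, Finset.mem_insert, Finset.mem_image]
  constructor
  · intro hx
    refine or_iff_not_imp_left.2 fun hr => ?_
    obtain ⟨y, rfl⟩ := h.exists_eq x hx hr
    exact ⟨y, (h.mem_iff y).2 ⟨hx, hr⟩, rfl⟩
  · rintro (rfl | ⟨y, hy, rfl⟩)
    · exact h.mem
    · exact ((h.mem_iff y).1 hy).1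

open Classical in
theorem Removes.not_mem {f : S ⟶ T} {r : T.E} (h : Removes f r) :
    r ∉ S.verts.image (onEdges f) := by
  rw [Finset.mem_image]
  rintro ⟨y, hy, hr⟩
  exact ((h.mem_iff y).1 (mem_verts.1 hy)).2 hr

theorem Removes.size_eq {f : S ⟶ T} {r : T.E} (h : Removes f r) : S.size + 1 = T.size := by
  classical
  rw [← card_verts, ← card_verts, h.verts_eq, Finset.card_insert_of_notMem h.not_mem,
    Finset.card_image_of_injective _ h.inj]

theorem Removes.prod_eq {f : S ⟶ T} {r : T.E} (h : Removes f r) (w : T.E → ℤ) :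
    ∏ x ∈ T.verts, w x = w r * ∏ y ∈ S.verts, w (onEdges f y) := by
  classical
  rw [h.verts_eq, Finset.prod_insert h.not_mem, Finset.prod_image fun _ _ _ _ h' => h.inj h']

theorem Removes.iso_comp {f : S ⟶ T} {r : T.E} (h : Removes f r) (τ : T ≅ R) :
    Removes (f ≫ τ.hom) (onEdges τ.hom r) where
  inj := (iso_injective τ).comp h.inj
  mem := (iso_mem_vert τ).2 h.mem
  mem_iff y := by rw [onEdges_comp, iso_mem_vert, (iso_injective τ).ne_iff, h.mem_iff]
  exists_eq x hx hr := by
    obtain ⟨y, hy⟩ := h.exists_eq (onEdges τ.inv x)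
      (by rw [← iso_mem_vert τ, iso_inv_hom_apply]; exact hx)
      (fun h' => hr (by rw [← h', iso_inv_hom_apply]))
    exact ⟨y, by rw [onEdges_comp, hy, iso_inv_hom_apply]⟩

namespace Planar

variable {p p' : Planar T}

open Classical in
theorem label_eq_card (p : Planar T) (v : T.E) :
    p.label v = (T.verts.filter fun u => p.Before u v).card := by
  rw [label, ← Set.ncard_image_of_injective _ Subtype.val_injective, ← Set.ncard_coe_finset]
  congr 1
  ext x
  simp only [Set.mem_image, Set.mem_ofPred_eq, Finset.coe_filter, mem_verts, Subtype.exists,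
    exists_and_left, exists_prop, exists_eq_right_right]
  exact and_comm

-- The vertices before e in T are those of the subtree, with r added if it comes before e.
-- Exchanging the order in which two vertices are removed therefore changes the parity of the total
-- label.
open Classical in
theorem label_removes {f : S ⟶ T} {r : T.E} (h : Removes f r) (p : Planar T) (e : S.E) :
    p.label (onEdges f e) =
      (p.pullback f).label e + if p.Before r (onEdges f e) then 1 else 0 := by
  rw [label_eq_card, label_eq_card, h.verts_eq, Finset.filter_insert]
  have h1 : (S.verts.image (onEdges f)).filter (fun u => p.Before u (onEdges f e)) =
      (S.verts.filter fun u => (p.pullback f).Before u e).image (onEdges f) := by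
    rw [Finset.filter_image]
    congr 1
    exact Finset.filter_congr fun x _ => (before_pullback_of_injective p f h.inj).symm
  have h2 : r ∉ (S.verts.image (onEdges f)).filter (fun u => p.Before u (onEdges f e)) :=
    fun h' => h.not_mem (Finset.mem_filter.1 h').1
  split_ifs with h'
  · rw [Finset.card_insert_of_notMem h2, h1, Finset.card_image_of_injective _ h.inj]
  · rw [h1, Finset.card_image_of_injective _ h.inj, add_zero]

open Classical in
theorem neg_one_pow_label (p : Planar T) (v : T.E) :
    (-1 : ℤ) ^ p.label v = ∏ u ∈ T.verts, if p.Before u v then -1 else 1 := by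
  rw [label_eq_card, Finset.prod_ite, Finset.prod_const, Finset.prod_const_one, mul_one]

theorem labelling_lt (p : Planar T) (u v : T.vert) :
    p.labelling u < p.labelling v ↔ p.Before u v := by
  change p.label u < p.label v ↔ _
  refine ⟨fun h => ?_, fun h => label_lt_label u.2 h⟩
  have hne : (u : T.E) ≠ v := fun h' => by rw [h'] at h; exact lt_irrefl _ h
  exact (Before.total hne).resolve_right fun h' => absurd (label_lt_label v.2 h') (by omega)

-- The sign as a product over inversions, expressed by the orders of the vertices and not by the
-- labels, so that the factors of a single vertex can be split off.
open Classical in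
theorem sgn_eq_prod (p' p : Planar T) :
    sgn p' p = ∏ v ∈ T.verts, ∏ u ∈ T.verts,
      if p'.Before u v ∧ p.Before v u then -1 else 1 := by
  rw [sgn, Equiv.Perm.sign_eq_prod_prod_Iio, Units.coe_prod]
  rw [Finset.prod_subtype T.verts (fun x => mem_verts) (f := fun v => ∏ u ∈ T.verts,
      if p'.Before u v ∧ p.Before v u then -1 else 1)]
  rw [← Equiv.prod_comp p'.labelling]
  refine Finset.prod_congr rfl fun v _ => ?_
  rw [Finset.prod_subtype T.verts (fun x => mem_verts) (f := fun u =>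
      if p'.Before u v ∧ p.Before v u then -1 else 1)]
  rw [← Equiv.prod_comp p'.labelling.symm, Units.coe_prod,
    ← Finset.prod_subset (Finset.subset_univ (Finset.Iio (p'.labelling v)))]
  · refine Finset.prod_congr rfl fun i hi => ?_
    obtain ⟨u, rfl⟩ := p'.labelling.surjective i
    have hi := (labelling_lt p' u v).1 (Finset.mem_Iio.1 hi)
    have hne : (u : T.E) ≠ v := fun h' => by rw [h'] at hi; exact hi.irrefl
    simp only [Equiv.trans_apply, Equiv.symm_apply_apply, labelling_lt, hi, true_and]
    by_cases h : p.Before u v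
    · simp [h, h.asymm]
    · simp [h, (not_before_iff hne).1 h]
  · intro i _ hi
    obtain ⟨u, rfl⟩ := p'.labelling.surjective i
    rw [Finset.mem_Iio, labelling_lt] at hi
    simp [hi]

@[simp]
theorem sgn_self (p : Planar T) : sgn p p = 1 := by
  rw [sgn, Equiv.symm_trans_self]
  simp

/-- The effect on signs of removing a vertex. -/
theorem sgn_removes {f : S ⟶ T} {r : T.E} (h : Removes f r) (p' p : Planar T) :
    sgn p' p = sgn (p'.pullback f) (p.pullback f) * ((-1) ^ p'.label r * (-1) ^ p.label r) := by
  classical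
  rw [sgn_eq_prod, sgn_eq_prod, neg_one_pow_label, neg_one_pow_label, ← Finset.prod_mul_distrib]
  rw [h.prod_eq]
  simp only [h.prod_eq]
  rw [Finset.prod_mul_distrib]
  simp only [before_pullback_of_injective _ f h.inj]
  rw [← mul_assoc, mul_comm]
  congr 1
  have h0 : ∀ q : Planar T, ¬ q.Before r r := fun q => Before.irrefl
  simp only [h0, false_and, if_false, one_mul]
  rw [← Finset.prod_mul_distrib]
  refine Finset.prod_congr rfl fun y hy => ?_
  have hne := ((h.mem_iff y).1 (mem_verts.1 hy)).2
  -- The pair formed by y and r is an inversion precisely if one of `p`, `p'` puts y before r and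
  -- the other does not. This is the parity of the contributions of y to the two labels of r.
  by_cases h1 : p.Before (onEdges f y) r <;> by_cases h2 : p'.Before (onEdges f y) r
  · simp [h1, h2, h1.asymm, h2.asymm]
  · simp [h1, h2, h1.asymm, (not_before_iff hne).1 h2]
  · simp [h1, h2, h2.asymm, (not_before_iff hne).1 h1]
  · simp [h1, h2, (not_before_iff hne).1 h1, (not_before_iff hne).1 h2]

theorem label_iso (p : Planar T) (τ : S ≅ T) (e : S.E) :
    (p.pullback τ.hom).label e = p.label (onEdges τ.hom e) := by
  classical
  rw [label_eq_card, label_eq_card, ← Finset.card_image_of_injective _ (iso_injective τ)]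
  congr 1
  ext x
  simp only [Finset.mem_image, Finset.mem_filter, mem_verts,
    before_pullback_of_injective p τ.hom (iso_injective τ)]
  constructor
  · rintro ⟨y, ⟨hy, hy'⟩, rfl⟩
    exact ⟨(iso_mem_vert τ).2 hy, hy'⟩
  · rintro ⟨hx, hx'⟩
    refine ⟨onEdges τ.inv x, ⟨(iso_mem_vert τ).1 ?_, ?_⟩, ?_⟩ <;> simp [hx, hx']

theorem label_root (p : Planar T) : p.label T.root = 0 := by
  classical
  rw [label_eq_card, Finset.card_eq_zero, Finset.filter_eq_empty_iff]
  rintro u - (h | h)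
  · exact absurd (root_le u) (not_le_of_gt h)
  · exact h.not_ge (root_le u)

theorem Before.iff_of_unary {v i : T.E} (h : T.Unary v i) {u : T.E} :
    p.Before u i ↔ u = v ∨ p.Before u v := by
  constructor
  · rintro (h' | ⟨a, b, hab, ha, hb⟩)
    · rcases (h.lt_iff'.1 h').eq_or_lt with h' | h'
      · exact Or.inl h'
      · exact Or.inr (Or.inl h')
    · rcases hb.eq_or_lt with rfl | hb
      · have hs := p.sib _ _ hab
        have := h.eq_of_next hs.1 (hs.2.2.trans h.next_eq)
        exact absurd (this ▸ hab) (p.irrefl _)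
      · exact Or.inr (Or.inr ⟨a, b, hab, ha, h.lt_iff'.1 hb⟩)
  · rintro (rfl | h')
    · exact Or.inl h.lt
    · exact h'.trans (Or.inl h.lt)

/-- Depth-first order passes from v directly to its only branch. The input may be a leaf, since
labels are defined for all edges; this accounts for the exponent k + 1 in the sign of a top face. -/
theorem label_unary {v i : T.E} (h : T.Unary v i) (p : Planar T) :
    p.label i = p.label v + 1 := by
  classical
  rw [label_eq_card, label_eq_card]
  rw [← Finset.card_insert_of_notMem (a := v) (s := T.verts.filter fun u => p.Before u v)
    fun h' => Before.irrefl (Finset.mem_filter.1 h').2]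
  congr 1
  ext u
  simp only [Finset.mem_filter, mem_verts, Finset.mem_insert, Before.iff_of_unary h]
  constructor
  · rintro ⟨h1, h2 | h2⟩
    · exact Or.inl h2
    · exact Or.inr ⟨h1, h2⟩
  · rintro (rfl | ⟨h1, h2⟩)
    · exact ⟨h.mem, Or.inl rfl⟩
    · exact ⟨h1, Or.inr h2⟩

end Planar

end OTree

/-! ### Elementary faces as subtrees which lose one vertex; transport along isomorphisms. -/

namespace OTree

variable {R S T : OTree}

namespace Face

/-- The vertex which is removed by a face map. -/
def removed : T.Face → T.E
  | inner e _ _ => e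
  | top w _ _ => w
  | bottom _ _ _ => T.root

/-- The part of the sign of a face which does not depend on the planar structure. -/
def eps : T.Face → ℤ
  | inner _ _ _ => 1
  | top _ _ _ => -1
  | bottom _ _ _ => 1

/-- A uniform formula for the three kinds of faces; bottom faces fit because the root vertex has
label 0. -/
theorem sgn_eq (p : Planar T) (a : T.Face) : a.sgn p = a.eps * (-1) ^ p.label a.removed := by
  cases a with
  | inner e he hv => exact (one_mul _).symm
  | top w hw hl =>
    simp only [sgn, eps, removed]
    rw [pow_succ, mul_comm]
  | bottom e he hl => simp [sgn, eps, removed, Planar.label_root]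

/-- The edges of a face. -/
def Mem : T.Face → T.E → Prop
  | inner e _ _, x => x ≠ e
  | top w _ _, x => x ∉ T.inputs w
  | bottom e _ _, x => e ≤ x

theorem exists_eq_iff {a : T.Face} {x : T.E} : (∃ y, onEdges a.map y = x) ↔ a.Mem x := by
  cases a with
  | inner e he hv =>
    exact ⟨by rintro ⟨y, rfl⟩; exact y.2, fun h => ⟨(⟨x, h⟩ : {x : T.E // x ≠ e}), rfl⟩⟩
  | top w hw hl =>
    exact ⟨by rintro ⟨y, rfl⟩; exact y.2, fun h => ⟨(⟨x, h⟩ : {x : T.E // x ∉ T.inputs w}), rfl⟩⟩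
  | bottom e he hl =>
    exact ⟨by rintro ⟨y, rfl⟩; exact y.2, fun h => ⟨(⟨x, h⟩ : {x : T.E // e ≤ x}), rfl⟩⟩

theorem mem_map {a : T.Face} (y : a.tree.E) : a.Mem (onEdges a.map y) := exists_eq_iff.1 ⟨y, rfl⟩

/-- Such a vertex lies above some input of the root vertex, and there is no vertex at or above an
input which is a leaf. -/
theorem bottom_le_of_mem_vert {e : T.E} (hl : ∀ e' ∈ T.inputs T.root, e' ≠ e → e' ∉ T.vert)
    {x : T.E} (hx : x ∈ T.vert) (hx' : x ≠ T.root) : e ≤ x := by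
  obtain ⟨b, hb, hb', hb''⟩ := exists_child (lt_of_le_of_ne (root_le x) (Ne.symm hx'))
  by_cases hbe : b = e
  · exact hbe ▸ hb
  · have hbl := hl b (mem_inputs.2 ⟨hb', hb''⟩) hbe
    rcases hb.eq_or_lt with rfl | h
    · exact absurd hx hbl
    · obtain ⟨c, -, hc, hc'⟩ := exists_child h
      exact absurd (hc' ▸ T.next_mem c hc) hbl

theorem removes (a : T.Face) : Removes a.map a.removed := by
  cases a with
  | inner e he hv =>
    exact ⟨Subtype.val_injective, hv, fun y => ⟨fun h => ⟨h, y.2⟩, fun h => h.1⟩,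
      fun x _ hx' => exists_eq_iff.2 hx'⟩
  | top w hw hl =>
    exact ⟨Subtype.val_injective, hw, fun y => Iff.rfl,
      fun x hx _ => exists_eq_iff.2 fun h => hl x h hx⟩
  | bottom e he hl =>
    have he' := mem_inputs.1 he
    have hr : T.root ∈ T.vert := he'.2 ▸ T.next_mem e he'.1
    refine ⟨Subtype.val_injective, hr, fun y => ⟨fun h => ⟨h, ?_⟩,
      fun h => h.1⟩, fun x hx hx' => exists_eq_iff.2 (bottom_le_of_mem_vert hl hx hx')⟩
    intro h
    have h1 : e ≤ T.root := le_of_le_of_eq y.2 h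
    exact he'.1 (le_antisymm h1 (root_le e))

theorem inj (a : T.Face) : Function.Injective (onEdges a.map) := a.removes.inj

/-- Transport of faces along an isomorphism. -/
def transport (τ : S ≅ T) : S.Face → T.Face
  | inner e he hv => inner (onEdges τ.hom e) ((iso_ne_root τ).2 he) ((iso_mem_vert τ).2 hv)
  | top w hw hl => top (onEdges τ.hom w) ((iso_mem_vert τ).2 hw) fun e he => by
      rw [← iso_inv_hom_apply τ e] at he ⊢
      rw [iso_mem_vert]
      exact hl _ ((iso_mem_inputs τ).1 he)
  | bottom e he hl => bottom (onEdges τ.hom e) (by rw [← iso_root τ, iso_mem_inputs]; exact he)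
      fun e' he' hne => by
        rw [← iso_inv_hom_apply τ e'] at he' hne ⊢
        rw [← iso_root τ, iso_mem_inputs] at he'
        rw [iso_mem_vert]
        exact hl _ he' fun h => hne (by rw [h])

theorem transport_symm (τ : S ≅ T) (a : S.Face) : transport τ.symm (transport τ a) = a := by
  cases a <;> simp [transport]

/-- An isomorphism of trees induces a bijection of faces. -/
def equiv (τ : S ≅ T) : S.Face ≃ T.Face where
  toFun := transport τ
  invFun := transport τ.symm
  left_inv := transport_symm τ
  right_inv := transport_symm τ.symm

theorem removed_transport (τ : S ≅ T) (a : S.Face) :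
    (transport τ a).removed = onEdges τ.hom a.removed := by
  cases a with
  | inner e he hv => rfl
  | top w hw hl => rfl
  | bottom e he hl => exact (iso_root τ).symm

theorem eps_transport (τ : S ≅ T) (a : S.Face) : (transport τ a).eps = a.eps := by
  cases a <;> rfl

theorem mem_transport (τ : S ≅ T) (a : S.Face) (x : S.E) :
    (transport τ a).Mem (onEdges τ.hom x) ↔ a.Mem x := by
  cases a with
  | inner e he hv => exact (iso_injective τ).ne_iff
  | top w hw hl => exact not_congr (iso_mem_inputs τ)
  | bottom e he hl => exact map_le_iff τ.hom (iso_injective τ)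

theorem exists_iso_transport (τ : S ≅ T) (a : S.Face) :
    ∃ φ : a.tree ≅ (transport τ a).tree, φ.hom ≫ (transport τ a).map = a.map ≫ τ.hom := by
  refine exists_iso_of_range_eq _ _ ((iso_injective τ).comp a.inj) (transport τ a).inj ?_ ?_
  · ext x
    obtain ⟨x, rfl⟩ := (iso_bijective τ).2 x
    have h1 : onEdges τ.hom x ∈ Set.range (onEdges (a.map ≫ τ.hom)) ↔ ∃ y, onEdges a.map y = x :=
      exists_congr fun y => (iso_injective τ).eq_iff
    rw [h1, Set.mem_range, exists_eq_iff, exists_eq_iff, mem_transport]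
  · intro x y hxy
    rw [(a.removes.iso_comp τ).mem_iff, (transport τ a).removes.mem_iff, removed_transport, hxy]

end Face

end OTree

/-! ### Classes of generators; the differential is well defined. -/

namespace DSet

open OTree

variable {X : DSet.{u}} {n m : ℕ} {R S T : OTree}

theorem res_comp (f : R ⟶ S) (g : S ⟶ T) (x : X.Dendrex T) :
    res (f ≫ g) x = res f (res g x) := by
  simp [res]

@[simp]
theorem res_id (x : X.Dendrex T) : res (𝟙 T) x = x := by
  simp [res]

/-- The class `[T, p, x]`. -/
noncomputable def cls (g : X.Gen n) : X.UnGroup n := (X.A n).mkQ (Finsupp.single g 1)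

theorem cls_iso {g g' : X.Gen n} (τ : g'.tree ≅ g.tree) (h : g'.dendrex = res τ.hom g.dendrex) :
    cls g = Planar.sgn g'.planar (g.planar.pullback τ.hom) • cls g' := by
  have h1 : Finsupp.single g 1 -
      Finsupp.single g' (OTree.Planar.sgn g'.planar (g.planar.pullback τ.hom)) ∈ X.A n :=
    Submodule.subset_span ⟨g, g', τ, h, rfl⟩
  have h2 := (Submodule.Quotient.eq _).2 h1
  rw [cls, cls, ← map_smul, Finsupp.smul_single, smul_eq_mul, mul_one]
  exact h2

theorem cls_eq_of_iso {g g' : X.Gen n} (τ : g'.tree ≅ g.tree)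
    (h : g'.dendrex = res τ.hom g.dendrex) (hp : g'.planar = g.planar.pullback τ.hom) :
    cls g = cls g' := by
  rw [cls_iso τ h, hp, Planar.sgn_self, one_smul]

/-- The restriction of a generator along a map of trees. -/
def Gen.pull (g : X.Gen m) (f : S ⟶ g.tree) (h : S.size = n) : X.Gen n where
  tree := S
  size_eq := h
  planar := g.planar.pullback f
  dendrex := res f g.dendrex

theorem cls_pull_iso (g : X.Gen m) (φ : R ≅ S) {f : S ⟶ g.tree} {f' : R ⟶ g.tree}
    (hf : φ.hom ≫ f = f') (hR : R.size = n) (hS : S.size = n) :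
    cls (g.pull f hS) = cls (g.pull f' hR) := by
  subst hf
  exact cls_eq_of_iso (g := g.pull f hS) (g' := g.pull (φ.hom ≫ f) hR) φ (res_comp _ _ _)
    (Planar.pullback_comp _ _ _)

/-- The differential on a generator. -/
noncomputable def bd (g : X.Gen (n + 1)) : X.UnGroup n :=
  ∑ a : g.tree.Face, a.sgn g.planar • cls (g.face a)

theorem mkQ_boundary (g : X.Gen (n + 1)) :
    (X.A n).mkQ (X.boundary n (Finsupp.single g 1)) = bd g := by
  rw [boundary, Finsupp.linearCombination_single, one_smul, map_sum, bd]
  refine Finset.sum_congr rfl fun a _ => ?_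
  rw [cls, ← map_smul, Finsupp.smul_single, smul_eq_mul, mul_one]

/-- An isomorphism matches the faces. For matched faces, the two labels of the lost vertex which
occur in the face signs are exactly the correction in `Planar.sgn_removes`. -/
theorem bd_iso {g g' : X.Gen (n + 1)} (τ : g'.tree ≅ g.tree)
    (h : g'.dendrex = res τ.hom g.dendrex) :
    bd g = Planar.sgn g'.planar (g.planar.pullback τ.hom) • bd g' := by
  rw [bd, bd, ← Equiv.sum_comp (Face.equiv τ), Finset.smul_sum]
  refine Finset.sum_congr rfl fun a _ => ?_
  change (Face.transport τ a).sgn g.planar • cls (g.face (Face.transport τ a)) = _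
  obtain ⟨φ, hφ⟩ := Face.exists_iso_transport τ a
  have hp : (g.face (Face.transport τ a)).planar.pullback φ.hom =
      (g.planar.pullback τ.hom).pullback a.map := by
    change (g.planar.pullback (Face.transport τ a).map).pullback φ.hom = _
    rw [← Planar.pullback_comp, ← Planar.pullback_comp, hφ]
  have key : cls (g.face (Face.transport τ a)) = Planar.sgn (g'.planar.pullback a.map)
      ((g.planar.pullback τ.hom).pullback a.map) • cls (g'.face a) := by
    refine (cls_iso (g := g.face (Face.transport τ a)) (g' := g'.face a) φ ?_).trans
      (congrArg (fun q => Planar.sgn (g'.planar.pullback a.map) q • cls (g'.face a)) hp)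
    change res a.map g'.dendrex = res φ.hom (res (Face.transport τ a).map g.dendrex)
    rw [h, ← res_comp, ← res_comp, hφ]
  rw [key, smul_smul, smul_smul]
  congr 1
  rw [Face.sgn_eq, Face.sgn_eq, Face.removed_transport, Face.eps_transport,
    ← Planar.label_iso, Planar.sgn_removes a.removes]
  have h1 : ((-1 : ℤ) ^ g'.planar.label a.removed) * (-1) ^ g'.planar.label a.removed = 1 := by
    rw [← mul_pow]; simp
  linear_combination (-1 : ℤ) * a.eps * (-1) ^ (g.planar.pullback τ.hom).label a.removed *
    Planar.sgn (g'.planar.pullback a.map) ((g.planar.pullback τ.hom).pullback a.map) * h1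

theorem boundaryDescends (X : DSet.{u}) : X.BoundaryDescends := by
  intro n
  rw [A, Submodule.span_le]
  rintro _ ⟨g, g', τ, h, rfl⟩
  rw [SetLike.mem_coe, Submodule.mem_comap, ← Submodule.ker_mkQ (X.A n), LinearMap.mem_ker,
    map_sub, map_sub, mkQ_boundary, bd_iso τ h]
  rw [show Finsupp.single g' (Planar.sgn g'.planar (g.planar.pullback τ.hom)) =
    Planar.sgn g'.planar (g.planar.pullback τ.hom) • Finsupp.single g' (1 : ℤ) by
      rw [Finsupp.smul_single, smul_eq_mul, mul_one], map_smul, map_smul, mkQ_boundary, sub_self]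

theorem d_cls (h : X.BoundaryDescends) (g : X.Gen (n + 1)) : d h n (cls g) = bd g :=
  ((X.A (n + 1)).mapQ_apply (X.A n) (X.boundary n) (h := h n) _).trans (mkQ_boundary g)

theorem hom_ext_cls {M : Type*} [AddCommGroup M] {f f' : X.UnGroup n →ₗ[ℤ] M}
    (h : ∀ g, f (cls g) = f' (cls g)) : f = f' := by
  refine Submodule.linearMap_qext _ (Finsupp.lhom_ext' fun g => LinearMap.ext_ring ?_)
  exact h g

end DSet

/-! ### Pairs of successive faces, and d² = 0. -/

namespace OTree

variable {R S T : OTree}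

namespace Face

/-- The three kinds of elementary faces. -/
inductive Kind
  | inner
  | top
  | bottom

def kind : T.Face → Kind
  | inner _ _ _ => .inner
  | top _ _ _ => .top
  | bottom _ _ _ => .bottom

def edge : T.Face → T.E
  | inner e _ _ => e
  | top w _ _ => w
  | bottom e _ _ => e

def Kind.eps : Kind → ℤ
  | .inner => 1
  | .top => -1
  | .bottom => 1

theorem eps_kind (a : T.Face) : a.eps = a.kind.eps := by cases a <;> rfl

theorem ext_kind {a b : T.Face} (h : a.kind = b.kind) (h' : a.edge = b.edge) : a = b := by
  cases a <;> cases b <;> simp_all [kind, edge]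

/-- The edge of `T` which is the root of a face. -/
def rootEdge : T.Face → T.E
  | inner _ _ _ => T.root
  | top _ _ _ => T.root
  | bottom e _ _ => e

theorem map_root (a : T.Face) : onEdges a.map a.tree.root = a.rootEdge := by cases a <;> rfl

/-- `x` is an input of `v` in a face, in terms of the edges of `T`. -/
def Inp : T.Face → T.E → T.E → Prop
  | inner e _ _, v, x => x ∈ T.inputs v ∨ (T.next e = v ∧ x ∈ T.inputs e)
  | top _ _ _, v, x => x ∈ T.inputs v
  | bottom _ _ _, v, x => x ∈ T.inputs v

theorem mem_inputs_tree (a : T.Face) (v x : a.tree.E) :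
    x ∈ a.tree.inputs v ↔ a.Inp (onEdges a.map v) (onEdges a.map x) := by
  cases a with
  | inner e he hv => exact innerFace_mem_inputs he
  | top w hw hl => exact topFace_mem_inputs hl
  | bottom e he hl => exact bottomFace_mem_inputs

/-- The edge `f` of `T` defines a face of the face `a`, of the given kind. -/
def Valid (a : T.Face) : Kind → T.E → Prop
  | .inner, f => a.Mem f ∧ f ≠ a.rootEdge ∧ f ∈ T.vert ∧ f ≠ a.removed
  | .top, w => a.Mem w ∧ w ∈ T.vert ∧ w ≠ a.removed ∧
      ∀ x, a.Mem x → a.Inp w x → x ∈ T.vert → x = a.removed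
  | .bottom, f => a.Mem f ∧ a.Inp a.rootEdge f ∧
      ∀ x, a.Mem x → a.Inp a.rootEdge x → x ≠ f → x ∈ T.vert → x = a.removed

/-- The edges of `T` which belong to a face of the face `a`. -/
def Mem₂ (a : T.Face) : Kind → T.E → T.E → Prop
  | .inner, f, x => a.Mem x ∧ x ≠ f
  | .top, w, x => a.Mem x ∧ ¬ a.Inp w x
  | .bottom, f, x => a.Mem x ∧ f ≤ x

/-- The vertex of `T` removed by a face of the face `a`. -/
def removed₂ (a : T.Face) : Kind → T.E → T.E
  | .inner, f => f
  | .top, w => w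
  | .bottom, _ => a.rootEdge

/-- Together with `exists_face_of_valid` this replaces the faces of a face, which live in a type
depending on `a`, by a kind and an edge of T, so that the cases can be settled in the poset of edges
of T. -/
theorem valid_of_face (a : T.Face) (b : a.tree.Face) : a.Valid b.kind (onEdges a.map b.edge) := by
  cases b with
  | inner f hf hv =>
    exact ⟨mem_map f, fun h => hf (a.inj (h.trans a.map_root.symm)), (a.removes.mem_iff f).1 hv⟩
  | top w hw hl =>
    refine ⟨mem_map w, ((a.removes.mem_iff w).1 hw).1, ((a.removes.mem_iff w).1 hw).2, ?_⟩
    intro x hx hx' hv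
    obtain ⟨y, rfl⟩ := exists_eq_iff.2 hx
    by_contra hne
    exact hl y ((a.mem_inputs_tree _ _).2 hx') ((a.removes.mem_iff y).2 ⟨hv, hne⟩)
  | bottom f hf hl =>
    refine ⟨mem_map f, a.map_root ▸ (a.mem_inputs_tree _ _).1 hf, ?_⟩
    intro x hx hx' hxf hv
    obtain ⟨y, rfl⟩ := exists_eq_iff.2 hx
    by_contra hne
    refine hl y ((a.mem_inputs_tree _ _).2 (by rw [map_root]; exact hx')) (fun h => hxf (by rw [h]; rfl))
      ((a.removes.mem_iff y).2 ⟨hv, hne⟩)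

theorem exists_face_of_valid {a : T.Face} {k : Kind} {f : T.E} (h : a.Valid k f) :
    ∃ b : a.tree.Face, b.kind = k ∧ onEdges a.map b.edge = f := by
  cases k with
  | inner =>
    obtain ⟨h1, h2, h3⟩ := h
    obtain ⟨y, rfl⟩ := exists_eq_iff.2 h1
    exact ⟨inner y (fun h => h2 (by rw [h, map_root])) ((a.removes.mem_iff y).2 h3), rfl, rfl⟩
  | top =>
    obtain ⟨h1, h2, h3, h4⟩ := h
    obtain ⟨y, rfl⟩ := exists_eq_iff.2 h1
    refine ⟨top y ((a.removes.mem_iff y).2 ⟨h2, h3⟩) fun e he hv => ?_, rfl, rfl⟩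
    exact ((a.removes.mem_iff e).1 hv).2
      (h4 _ (mem_map e) ((a.mem_inputs_tree _ _).1 he) ((a.removes.mem_iff e).1 hv).1)
  | bottom =>
    obtain ⟨h1, h2, h3⟩ := h
    obtain ⟨y, rfl⟩ := exists_eq_iff.2 h1
    refine ⟨bottom y ((a.mem_inputs_tree _ _).2 (by rw [map_root]; exact h2))
      fun e he hne hv => ?_, rfl, rfl⟩
    exact ((a.removes.mem_iff e).1 hv).2 (h3 _ (mem_map e)
      (by rw [← map_root]; exact (a.mem_inputs_tree _ _).1 he) (a.inj.ne hne)
      ((a.removes.mem_iff e).1 hv).1)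

theorem exists_eq_iff₂ (a : T.Face) (b : a.tree.Face) (x : T.E) :
    (∃ z, onEdges (b.map ≫ a.map) z = x) ↔ a.Mem₂ b.kind (onEdges a.map b.edge) x := by
  have h1 : (∃ z, onEdges (b.map ≫ a.map) z = x) ↔ ∃ y, b.Mem y ∧ onEdges a.map y = x := by
    constructor
    · rintro ⟨z, rfl⟩
      exact ⟨_, mem_map z, rfl⟩
    · rintro ⟨y, hy, rfl⟩
      obtain ⟨z, rfl⟩ := exists_eq_iff.2 hy
      exact ⟨z, rfl⟩
  rw [h1]
  have h2 : ∀ P : T.E → Prop, (∀ y, b.Mem y ↔ P (onEdges a.map y)) →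
      ((∃ y, b.Mem y ∧ onEdges a.map y = x) ↔ a.Mem x ∧ P x) := by
    intro P hP
    constructor
    · rintro ⟨y, hy, rfl⟩
      exact ⟨mem_map y, (hP y).1 hy⟩
    · rintro ⟨hx, hx'⟩
      obtain ⟨y, rfl⟩ := exists_eq_iff.2 hx
      exact ⟨y, (hP y).2 hx', rfl⟩
  cases b with
  | inner f hf hv => exact h2 (fun x => x ≠ onEdges a.map f) fun y => a.inj.ne_iff.symm
  | top w hw hl =>
    exact h2 (fun x => ¬ a.Inp (onEdges a.map w) x) fun y => not_congr (a.mem_inputs_tree _ _)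
  | bottom f hf hl => exact h2 (fun x => onEdges a.map f ≤ x) fun y => (map_le_iff _ a.inj).symm

theorem map_removed (a : T.Face) (b : a.tree.Face) :
    onEdges a.map b.removed = a.removed₂ b.kind (onEdges a.map b.edge) := by
  cases b with
  | inner f hf hv => rfl
  | top w hw hl => rfl
  | bottom f hf hl => exact a.map_root

/-- Two pairs of successive faces which lead to the same subtree and have opposite signs. -/
def Opposite (a : T.Face) (k : Kind) (f : T.E) (a' : T.Face) (k' : Kind) (f' : T.E) : Prop :=
  (∀ x, a.Mem₂ k f x ↔ a'.Mem₂ k' f' x) ∧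
    ((a.removed = a'.removed₂ k' f' ∧ a.removed₂ k f = a'.removed ∧
        a.eps * k.eps = a'.eps * k'.eps) ∨
      (a.removed = a'.removed ∧ a.removed₂ k f = a'.removed₂ k' f' ∧
        a.eps * k.eps = -(a'.eps * k'.eps)))

open Classical in
/-- The involution on pairs of successive faces which matches the two ways of removing two vertices. -/
noncomputable def partner (T : OTree) : Kind × T.E × Kind × T.E → Kind × T.E × Kind × T.E
  | (.inner, e, .inner, f) => (.inner, f, .inner, e)
  | (.inner, e, .top, w) => if w = T.next e then (.top, e, .top, w) else (.top, w, .inner, e)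
  | (.inner, e, .bottom, f) =>
      if T.next e = T.root then
        if T.next f = e then (.bottom, e, .bottom, f) else (.top, e, .bottom, f)
      else (.bottom, f, .inner, e)
  | (.top, w, .inner, e) => (.inner, e, .top, w)
  | (.top, w, .top, u) => if u = T.next w then (.inner, w, .top, u) else (.top, u, .top, w)
  | (.top, w, .bottom, f) =>
      if w ≠ f ∧ T.next w = T.root then (.inner, w, .bottom, f) else (.bottom, f, .top, w)
  | (.bottom, e, .inner, f) => (.inner, f, .bottom, e)
  | (.bottom, e, .top, w) => (.top, w, .bottom, e)
  | (.bottom, e, .bottom, f) => (.inner, e, .bottom, f)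

/-- Makes pairs of successive faces comparable although their second members lie in different types.
-/
def code (a : T.Face) (k : Kind) (f : T.E) : Kind × T.E × Kind × T.E := (a.kind, a.edge, k, f)

/-- The two equations for `partner` make the matching of pairs an involution, the inequality
excludes fixed points, and `Opposite` gives the cancellation. -/
def HasPartner (a : T.Face) (k : Kind) (f : T.E) : Prop :=
  ∃ (a' : T.Face) (k' : Kind) (f' : T.E), a'.Valid k' f' ∧ code a' k' f' = partner T (code a k f) ∧
    code a k f = partner T (code a' k' f') ∧ code a' k' f' ≠ code a k f ∧ Opposite a k f a' k' f'

theorem mem_vert_of_lt {a b : T.E} (h : a < b) : a ∈ T.vert := by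
  obtain ⟨c, -, hc, hc'⟩ := exists_child h
  exact hc' ▸ T.next_mem c hc

theorem hasPartner_inner_inner {e he hv f} (h : (inner e he hv : T.Face).Valid .inner f) :
    HasPartner (inner e he hv) .inner f := by
  obtain ⟨h1, h2, h3, h4⟩ := h
  refine ⟨inner f h2 h3, .inner, e, ⟨h1.symm, he, hv, h1.symm⟩, rfl, rfl, ?_, fun x => and_comm,
    Or.inl ⟨rfl, rfl, rfl⟩⟩
  simp only [code, edge, kind, ne_eq, Prod.mk.injEq, true_and, not_and]
  exact fun h => absurd h h1

/-- If e is an input of w, chopping off the vertex obtained by contracting e amounts to chopping off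
e and then w: same order of removal, opposite ε. Otherwise the two operations commute. -/
theorem hasPartner_inner_top {e he hv w} (h : (inner e he hv : T.Face).Valid .top w) :
    HasPartner (inner e he hv) .top w := by
  obtain ⟨h1, h2, h3, h4⟩ := h
  simp only [Mem, Inp, removed, mem_inputs] at h1 h4 h3
  by_cases hw : w = T.next e
  · refine ⟨top e hv fun x hx hxv => ?_, .top, w, ?_, ?_, ?_, ?_, ?_, ?_⟩
    · have hx := mem_inputs.1 hx
      have h5 : x ≠ e := by rintro rfl; exact next_ne he hx.2
      exact h5 (h4 x h5 (Or.inr ⟨hw.symm, hx⟩) hxv)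
    · simp only [Valid, Mem, Inp, removed, mem_inputs]
      grind
    · simp [code, partner, kind, edge, hw]
    · simp [code, partner, kind, edge, hw]
    · simp [code, kind]
    · intro x
      simp only [Mem₂, Mem, Inp, mem_inputs]
      grind
    · exact Or.inr ⟨rfl, rfl, rfl⟩
  · refine ⟨top w h2 fun x hx hxv => ?_, .inner, e, ?_, ?_, ?_, ?_, ?_, ?_⟩
    · have hx := mem_inputs.1 hx
      have h5 : x ≠ e := fun h => hw (by rw [← h, hx.2])
      exact h5 (h4 x h5 (Or.inl hx) hxv)
    · simp only [Valid, Mem, removed, rootEdge, mem_inputs]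
      grind
    · simp [code, partner, kind, edge, hw]
    · simp [code, partner, kind, edge]
    · simp [code, kind]
    · intro x
      simp only [Mem₂, Mem, Inp, mem_inputs]
      grind
    · exact Or.inl ⟨rfl, rfl, rfl⟩

theorem hasPartner_top_inner {w hw hl e} (h : (top w hw hl : T.Face).Valid .inner e) :
    HasPartner (top w hw hl) .inner e := by
  obtain ⟨h1, h2, h3, h4⟩ := h
  simp only [Mem, rootEdge, removed] at h1 h2 h4
  have h5 : w ≠ T.next e := fun h => h1 (mem_inputs.2 ⟨h2, h.symm⟩)
  refine ⟨inner e h2 h3, .top, w, ?_, ?_, ?_, ?_, ?_, ?_⟩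
  · simp only [Valid, Mem, Inp, removed]
    grind
  · simp [code, partner, kind, edge]
  · simp [code, partner, kind, edge, h5]
  · simp [code, kind]
  · intro x
    simp only [Mem₂, Mem, Inp]
    grind
  · exact Or.inl ⟨rfl, rfl, rfl⟩

/-- If w sits directly on u, chopping off w and then u has the same result as contracting w and then
chopping off u, with opposite ε. Otherwise the inputs of u were leaves from the start, and the
operations commute. -/
theorem hasPartner_top_top {w hw hl u} (h : (top w hw hl : T.Face).Valid .top u) :
    HasPartner (top w hw hl) .top u := by
  obtain ⟨h1, h2, h3, h4⟩ := h
  simp only [Mem, Inp, removed] at h1 h3 h4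
  -- A root vertex whose inputs are all leaves is the only vertex, but u is a second one.
  have hwr : w ≠ T.root := by
    rintro rfl
    obtain ⟨b, hb, hb', hb''⟩ := exists_child (lt_of_le_of_ne (root_le u) (Ne.symm h3))
    refine hl b (mem_inputs.2 ⟨hb', hb''⟩) ?_
    rcases hb.eq_or_lt with rfl | hb
    · exact h2
    · exact mem_vert_of_lt hb
  by_cases hu : u = T.next w
  · refine ⟨inner w hwr hw, .top, u, ?_, ?_, ?_, ?_, ?_, ?_⟩
    · simp only [Valid, Mem, Inp, removed]
      refine ⟨h3, h2, h3, ?_⟩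
      rintro x hx (hx' | ⟨-, hx'⟩) hv
      · exact h4 x (fun h => hl x h hv) hx' hv
      · exact absurd hv (hl x hx')
    · simp [code, partner, kind, edge, hu]
    · simp [code, partner, kind, edge, hu]
    · simp [code, kind]
    · intro x
      simp only [Mem₂, Mem, Inp, mem_inputs]
      grind
    · exact Or.inr ⟨rfl, rfl, rfl⟩
  · have hl' : ∀ x ∈ T.inputs u, x ∉ T.vert := fun x hx hv => by
      have := h4 x (fun h => hl x h hv) hx hv
      subst this
      exact hu (mem_inputs.1 hx).2.symm
    refine ⟨top u h2 hl', .top, w, ?_, ?_, ?_, ?_, ?_, ?_⟩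
    · simp only [Valid, Mem, Inp, removed]
      grind
    · simp [code, partner, kind, edge, hu]
    · have : w ≠ T.next u := by
        rintro rfl
        have hur : u ≠ T.root := by
          rintro rfl
          exact h3 T.next_root.symm
        exact hl u (mem_inputs.2 ⟨hur, rfl⟩) h2
      simp [code, partner, kind, edge, this]
    · simp [code, kind, edge, h3]
    · intro x
      simp only [Mem₂, Mem, Inp]
      exact and_comm
    · exact Or.inl ⟨rfl, rfl, rfl⟩

/-- Let e be an input of the root vertex. If f sits on e, contracting e and cutting below f amounts
to cutting below e and then below f, with the two vertices removed in the other order. If f is a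
sibling of e, the cut discards e, which might as well have been chopped off as a top vertex; here ε
changes. If e is not an input of the root vertex, the operations commute. -/
theorem hasPartner_inner_bottom {e he hv f} (h : (inner e he hv : T.Face).Valid .bottom f) :
    HasPartner (inner e he hv) .bottom f := by
  obtain ⟨h1, h2, h3⟩ := h
  simp only [Mem, Inp, removed, rootEdge] at h1 h2 h3
  by_cases hr : T.next e = T.root
  · by_cases hf : T.next f = e
    · have hfr : f ≠ T.root := by
        rintro rfl
        exact he (hf ▸ T.next_root)
      refine ⟨bottom e (mem_inputs.2 ⟨he, hr⟩) fun x hx hxe hxv => ?_, .bottom, f,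
        ?_, ?_, ?_, ?_, ?_, ?_⟩
      · have hxf : x ≠ f := by
          rintro rfl
          exact he (hf.symm.trans (mem_inputs.1 hx).2)
        exact hxe (h3 x hxe (Or.inl hx) hxf hxv)
      · simp only [Valid, Mem, Inp, removed, rootEdge]
        refine ⟨hf ▸ next_le f, mem_inputs.2 ⟨hfr, hf⟩, fun x hx hx' hxf hv => ?_⟩
        have hxe : x ≠ e := by
          rintro rfl
          exact next_ne he (mem_inputs.1 hx').2
        exact absurd (h3 x hxe (Or.inr ⟨hr, hx'⟩) hxf hv) hxe
      · simp [code, partner, kind, edge, hr, hf]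
      · simp [code, partner, kind, edge]
      · simp [code, kind]
      · intro x
        simp only [Mem₂, Mem]
        refine and_congr_left fun hx => ⟨fun _ => (hf ▸ next_le f).trans hx, fun _ hxe => ?_⟩
        subst hxe
        subst hf
        exact next_ne hfr (le_antisymm (next_le f) hx)
      · exact Or.inl ⟨rfl, rfl, rfl⟩
    · have hfi : f ∈ T.inputs T.root := by
        refine h2.resolve_right fun h => hf (mem_inputs.1 h.2).2
      refine ⟨top e hv fun x hx hxv => ?_, .bottom, f, ?_, ?_, ?_, ?_, ?_, ?_⟩
      · have hxe : x ≠ e := by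
          rintro rfl
          exact next_ne he (mem_inputs.1 hx).2
        have hxf : x ≠ f := by
          rintro rfl
          exact hf (mem_inputs.1 hx).2
        exact hxe (h3 x hxe (Or.inr ⟨hr, hx⟩) hxf hxv)
      · simp only [Valid, Mem, Inp, removed, rootEdge]
        refine ⟨fun h => hf (mem_inputs.1 h).2, hfi, fun x hx hx' hxf hv => ?_⟩
        by_contra hxe
        exact hxe (h3 x hxe (Or.inl hx') hxf hv)
      · simp [code, partner, kind, edge, hr, hf]
      · simp [code, partner, kind, edge, hr, Ne.symm h1]
      · simp [code, kind]
      · intro x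
        simp only [Mem₂, Mem]
        refine and_congr_left fun hx => ⟨fun _ hxi => ?_, fun _ hxe => ?_⟩
        · have hxi := mem_inputs.1 hxi
          have h5 : f ≤ e := by
            rcases hx.eq_or_lt with h | h
            · exact absurd (h ▸ hxi.2) hf
            · exact hxi.2 ▸ le_next_of_lt h
          have hs : T.Sib f e := ⟨(mem_inputs.1 hfi).1, he, (mem_inputs.1 hfi).2.trans hr.symm⟩
          exact h1 (hs.eq_of_le h5)
        · subst hxe
          have hs : T.Sib f x := ⟨(mem_inputs.1 hfi).1, he, (mem_inputs.1 hfi).2.trans hr.symm⟩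
          exact h1 (hs.eq_of_le hx)
      · exact Or.inr ⟨rfl, rfl, rfl⟩
  · have hfi : f ∈ T.inputs T.root := h2.resolve_right fun h => hr h.1
    have hl : ∀ x ∈ T.inputs T.root, x ≠ f → x ∉ T.vert := fun x hx hxf hxv => by
      have hxe : x ≠ e := by
        rintro rfl
        exact hr (mem_inputs.1 hx).2
      exact hxe (h3 x hxe (Or.inl hx) hxf hxv)
    refine ⟨bottom f hfi hl, .inner, e, ?_, ?_, ?_, ?_, ?_, ?_⟩
    · simp only [Valid, Mem, removed, rootEdge]
      exact ⟨bottom_le_of_mem_vert hl hv he, h1.symm, hv, he⟩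
    · simp [code, partner, kind, edge, hr]
    · simp [code, partner, kind, edge]
    · simp [code, kind]
    · intro x
      simp only [Mem₂, Mem]
      exact and_comm
    · exact Or.inl ⟨rfl, rfl, rfl⟩

/-- If w is an input of the root vertex other than f, the cut below f discards w in any case, so w
may be contracted instead of chopped off, with opposite ε. Otherwise the operations commute. -/
theorem hasPartner_top_bottom {w hw hl f} (h : (top w hw hl : T.Face).Valid .bottom f) :
    HasPartner (top w hw hl) .bottom f := by
  obtain ⟨h1, h2, h3⟩ := h
  simp only [Mem, Inp, removed, rootEdge] at h1 h2 h3
  have hwr : w ≠ T.root := by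
    rintro rfl
    exact h1 h2
  by_cases hc : w ≠ f ∧ T.next w = T.root
  · have hfw : T.next f ≠ w := fun h => h1 (mem_inputs.2 ⟨(mem_inputs.1 h2).1, h⟩)
    refine ⟨inner w hwr hw, .bottom, f, ?_, ?_, ?_, ?_, ?_, ?_⟩
    · simp only [Valid, Mem, Inp, removed, rootEdge]
      refine ⟨hc.1.symm, Or.inl h2, ?_⟩
      rintro x hx (hx' | ⟨-, hx'⟩) hxf hv
      · exact h3 x (fun h => hl x h hv) hx' hxf hv
      · exact absurd hv (hl x hx')
    · simp [code, partner, kind, edge, hc]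
    · simp [code, partner, kind, edge, hc.2, hfw]
    · simp [code, kind]
    · intro x
      simp only [Mem₂, Mem]
      have hs : T.Sib f w :=
        ⟨(mem_inputs.1 h2).1, hwr, (mem_inputs.1 h2).2.trans hc.2.symm⟩
      refine and_congr_left fun hx => ⟨fun _ hxe => ?_, fun _ hxi => ?_⟩
      · subst hxe
        exact hc.1 (hs.eq_of_le hx).symm
      · have hxi := mem_inputs.1 hxi
        have h5 : f ≤ w := by
          rcases hx.eq_or_lt with h | h
          · exact absurd (h ▸ hxi.2) hfw
          · exact hxi.2 ▸ le_next_of_lt h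
        exact hc.1 (hs.eq_of_le h5).symm
    · exact Or.inr ⟨rfl, rfl, rfl⟩
  · have hl' : ∀ x ∈ T.inputs T.root, x ≠ f → x ∉ T.vert := fun x hx hxf hxv => by
      have := h3 x (fun h => hl x h hxv) hx hxf hxv
      subst this
      exact hc ⟨hxf, (mem_inputs.1 hx).2⟩
    refine ⟨bottom f h2 hl', .top, w, ?_, ?_, ?_, ?_, ?_, ?_⟩
    · simp only [Valid, Mem, Inp, removed]
      exact ⟨bottom_le_of_mem_vert hl' hw hwr, hw, hwr, fun x _ hx hv => absurd hv (hl x hx)⟩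
    · simp only [code, partner, kind, edge]
      rw [if_neg hc]
    · simp [code, partner, kind, edge]
    · simp [code, kind]
    · intro x
      simp only [Mem₂, Mem, Inp]
      exact and_comm
    · exact Or.inl ⟨rfl, rfl, rfl⟩

theorem hasPartner_bottom_inner {e he hl f} (h : (bottom e he hl : T.Face).Valid .inner f) :
    HasPartner (bottom e he hl) .inner f := by
  obtain ⟨h1, h2, h3, h4⟩ := h
  simp only [Mem, rootEdge, removed] at h1 h2 h4
  have hef : e < f := lt_of_le_of_ne h1 h2.symm
  have hr : T.next f ≠ T.root := fun h => (mem_inputs.1 he).1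
    (le_antisymm (h ▸ le_next_of_lt hef) (root_le e))
  refine ⟨inner f h4 h3, .bottom, e, ?_, ?_, ?_, ?_, ?_, ?_⟩
  · simp only [Valid, Mem, Inp, removed, rootEdge]
    refine ⟨h2.symm, Or.inl he, ?_⟩
    rintro x hx (hx' | ⟨hx', -⟩) hxe hv
    · exact absurd hv (hl x hx' hxe)
    · exact absurd hx' hr
  · simp [code, partner, kind, edge]
  · simp [code, partner, kind, edge, hr]
  · simp [code, kind]
  · intro x
    simp only [Mem₂, Mem]
    exact and_comm
  · exact Or.inl ⟨rfl, rfl, rfl⟩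

theorem hasPartner_bottom_top {e he hl w} (h : (bottom e he hl : T.Face).Valid .top w) :
    HasPartner (bottom e he hl) .top w := by
  obtain ⟨h1, h2, h3, h4⟩ := h
  simp only [Mem, Inp, removed] at h1 h3 h4
  have hlw : ∀ x ∈ T.inputs w, x ∉ T.vert := fun x hx hv =>
    (mem_inputs.1 hx).1 (h4 x (h1.trans ((mem_inputs.1 hx).2 ▸ next_le x)) hx hv)
  refine ⟨top w h2 hlw, .bottom, e, ?_, ?_, ?_, ?_, ?_, ?_⟩
  · simp only [Valid, Mem, Inp, removed, rootEdge]
    refine ⟨fun h => h3 (le_antisymm ?_ (root_le w)), he,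
      fun x _ hx hxe hv => absurd hv (hl x hx hxe)⟩
    rw [← (mem_inputs.1 he).2, (mem_inputs.1 h).2]
  · simp [code, partner, kind, edge]
  · have hc : ¬ (w ≠ e ∧ T.next w = T.root) := by
      rintro ⟨hwe, hr⟩
      exact (mem_inputs.1 he).1 (le_antisymm
        (hr ▸ le_next_of_lt (lt_of_le_of_ne h1 (Ne.symm hwe))) (root_le e))
    simp only [code, partner, kind, edge]
    rw [if_neg hc]
  · simp [code, kind]
  · intro x
    simp only [Mem₂, Mem, Inp]
    exact and_comm
  · exact Or.inl ⟨rfl, rfl, rfl⟩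

/-- Cutting off two root vertices in succession equals merging them along e and cutting once; the
root vertex and the vertex e are removed in the other order. -/
theorem hasPartner_bottom_bottom {e he hl f} (h : (bottom e he hl : T.Face).Valid .bottom f) :
    HasPartner (bottom e he hl) .bottom f := by
  obtain ⟨h1, h2, h3⟩ := h
  simp only [Mem, Inp, removed, rootEdge] at h1 h2 h3
  have he' := mem_inputs.1 he
  have hf := mem_inputs.1 h2
  have hfe : e < f := hf.2 ▸ next_lt hf.1
  refine ⟨inner e he'.1 (hf.2 ▸ T.next_mem f hf.1), .bottom, f, ?_, ?_, ?_, ?_, ?_, ?_⟩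
  · simp only [Valid, Mem, Inp, removed, rootEdge]
    refine ⟨hfe.ne', Or.inr ⟨he'.2, h2⟩, ?_⟩
    rintro x hx (hx' | ⟨-, hx'⟩) hxf hv
    · exact absurd hv (hl x hx' hx)
    · exact absurd (h3 x ((mem_inputs.1 hx').2 ▸ next_le x) hx' hxf hv) (mem_inputs.1 hx').1
  · simp [code, partner, kind, edge]
  · simp [code, partner, kind, edge, he'.2, hf.2]
  · simp [code, kind]
  · intro x
    simp only [Mem₂, Mem]
    exact and_congr_left fun hx => ⟨fun _ => (hfe.trans_le hx).ne', fun _ => hfe.le.trans hx⟩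
  · exact Or.inl ⟨rfl, rfl, rfl⟩

theorem hasPartner {a : T.Face} {k : Kind} {f : T.E} (h : a.Valid k f) : HasPartner a k f := by
  cases a <;> cases k
  exacts [hasPartner_inner_inner h, hasPartner_inner_top h, hasPartner_inner_bottom h,
    hasPartner_top_inner h, hasPartner_top_top h, hasPartner_top_bottom h,
    hasPartner_bottom_inner h, hasPartner_bottom_top h, hasPartner_bottom_bottom h]

end Face

end OTree

/-- The hypothesis that g returns from y to x makes the choice of y an involution, so g itself need
not be one outside the image of c. -/
theorem Finset.sum_eq_zero_of_partner {ι κ M : Type*} [Fintype ι] [AddCommMonoid M] (F : ι → M)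
    (c : ι → κ) (hc : Function.Injective c) (g : κ → κ)
    (H : ∀ x, ∃ y, c y = g (c x) ∧ c x = g (c y) ∧ c y ≠ c x ∧ F x + F y = 0) :
    ∑ x, F x = 0 := by
  choose k h1 h2 h3 h4 using H
  refine Finset.sum_involution (fun x _ => k x) (fun x _ => h4 x)
    (fun x _ _ h => h3 x (by rw [h])) (fun x _ => Finset.mem_univ _) fun x _ => hc ?_
  rw [h1 (k x), ← h2 x]

namespace DSet

open OTree

variable {X : DSet.{u}} {n m : ℕ} {R S T : OTree}

-- The last factor comes from the shift of the label of the second vertex when the first is removed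
-- before it. It alone depends on the order in which the two vertices are removed.
open Classical in
theorem sgn_mul_sgn (p : Planar T) (a : T.Face) (b : a.tree.Face) :
    a.sgn p * b.sgn (p.pullback a.map) = (a.eps * b.kind.eps) *
      ((-1) ^ p.label a.removed * (-1) ^ p.label (onEdges a.map b.removed)) *
        (if p.Before a.removed (onEdges a.map b.removed) then -1 else 1) := by
  rw [Face.sgn_eq, Face.sgn_eq, Planar.label_removes a.removes, Face.eps_kind b]
  split_ifs
  · ring
  · ring

/-- Both double faces are subtrees with the same edges and the same vertices, hence isomorphic over
T and of the same class. The signs are opposite either by asymmetry of `Before` or by the factors ε.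
-/
theorem cls_face_face (g : X.Gen (n + 1 + 1)) (a a' : g.tree.Face) (b : a.tree.Face)
    (b' : a'.tree.Face) (h : Face.Opposite a b.kind (onEdges a.map b.edge) a' b'.kind
      (onEdges a'.map b'.edge)) :
    (a.sgn g.planar * b.sgn (g.planar.pullback a.map)) • cls ((g.face a).face b) +
      (a'.sgn g.planar * b'.sgn (g.planar.pullback a'.map)) • cls ((g.face a').face b') = 0 := by
  classical
  obtain ⟨hm, hr⟩ := h
  rw [← Face.map_removed, ← Face.map_removed] at hr
  have hne := ((a.removes.mem_iff _).1 b.removes.mem).2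
  have hne' := ((a'.removes.mem_iff _).1 b'.removes.mem).2
  have hv : ∀ (a : g.tree.Face) (b : a.tree.Face) (x : b.tree.E), x ∈ b.tree.vert ↔
      onEdges (b.map ≫ a.map) x ∈ g.tree.vert ∧ onEdges (b.map ≫ a.map) x ≠ a.removed ∧
        onEdges (b.map ≫ a.map) x ≠ onEdges a.map b.removed := by
    intro a b x
    rw [b.removes.mem_iff, a.removes.mem_iff, onEdges_comp, a.inj.ne_iff, and_assoc]
  obtain ⟨φ, hφ⟩ : ∃ φ : b.tree ≅ b'.tree, φ.hom ≫ (b'.map ≫ a'.map) = b.map ≫ a.map := by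
    refine exists_iso_of_range_eq _ _ (a.inj.comp b.inj) (a'.inj.comp b'.inj) ?_ ?_
    · ext x
      rw [Set.mem_range, Set.mem_range, Face.exists_eq_iff₂, Face.exists_eq_iff₂, hm]
    · intro x y hxy
      rw [hv, hv, hxy]
      rcases hr with hr | hr
      · rw [hr.1, hr.2.1, and_comm (a := _ ≠ _)]
      · rw [hr.1, hr.2.1]
  have hcls : cls ((g.face a').face b') = cls ((g.face a).face b) := by
    refine cls_eq_of_iso (g := (g.face a').face b') (g' := (g.face a).face b) φ ?_ ?_
    · change res b.map (res a.map g.dendrex) = res φ.hom (res b'.map (res a'.map g.dendrex))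
      rw [← res_comp, ← res_comp, ← res_comp, ← hφ, Category.assoc]
    · change (g.planar.pullback a.map).pullback b.map =
        ((g.planar.pullback a'.map).pullback b'.map).pullback φ.hom
      rw [← Planar.pullback_comp, ← Planar.pullback_comp, ← Planar.pullback_comp, ← hφ,
        Category.assoc]
  rw [hcls, ← add_smul, sgn_mul_sgn, sgn_mul_sgn]
  convert zero_smul ℤ _
  rw [← Face.eps_kind, ← Face.eps_kind] at hr ⊢
  rcases hr with ⟨h1, h2, h3⟩ | ⟨h1, h2, h3⟩
  · rw [← h1, ← h2, h3]
    by_cases hb : g.planar.Before a.removed (onEdges a.map b.removed)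
    · rw [if_pos hb, if_neg hb.asymm]
      ring
    · rw [if_neg hb, if_pos ((Planar.not_before_iff hne.symm).1 hb)]
      ring
  · rw [← h1, ← h2, h3]
    ring

theorem d_bd (h : X.BoundaryDescends) (g : X.Gen (n + 1 + 1)) : d h n (bd g) = 0 := by
  rw [bd, map_sum]
  simp only [map_smul, d_cls, bd, Finset.smul_sum, smul_smul]
  rw [Finset.sum_sigma']
  refine Finset.sum_eq_zero_of_partner
    (fun x : (Σ a : g.tree.Face, a.tree.Face) =>
      (x.1.sgn g.planar * x.2.sgn (g.planar.pullback x.1.map)) • cls ((g.face x.1).face x.2))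
    (fun x => Face.code x.1 x.2.kind (onEdges x.1.map x.2.edge)) ?_ (Face.partner g.tree) ?_
  · rintro ⟨a, b⟩ ⟨a', b'⟩ hab
    simp only [Face.code, Prod.mk.injEq] at hab
    obtain ⟨h1, h2, h3, h4⟩ := hab
    obtain rfl := Face.ext_kind h1 h2
    obtain rfl := Face.ext_kind h3 (a.inj h4)
    rfl
  · rintro ⟨a, b⟩
    obtain ⟨a', k', f', hv, h1, h2, h3, h4⟩ := Face.hasPartner (a.valid_of_face b)
    obtain ⟨b', rfl, rfl⟩ := Face.exists_face_of_valid hv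
    exact ⟨⟨a', b'⟩, h1, h2, h3, cls_face_face g a a' b b' h4⟩

theorem d_comp_d (h : X.BoundaryDescends) (n : ℕ) : d h n ∘ₗ d h (n + 1) = 0 :=
  hom_ext_cls fun g => by rw [LinearMap.comp_apply, d_cls, d_bd, LinearMap.zero_apply]

end DSet

/-! ### Collapsing a unary vertex. -/

namespace OTree

variable {R S T S' T' : OTree}

theorem Unary.iso {v i : S.E} (h : S.Unary v i) (τ : S ≅ T) :
    T.Unary (onEdges τ.hom v) (onEdges τ.hom i) := by
  refine ⟨(iso_mem_vert τ).2 h.mem, ?_⟩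
  ext x
  rw [← iso_inv_hom_apply τ x, iso_mem_inputs, h.inputs_eq, Finset.mem_singleton,
    Finset.mem_singleton, (iso_injective τ).eq_iff]

namespace Face

/-- A face missing only e is inner if e is an inner edge, top if e is a leaf on a unary vertex, and
bottom if e is the root; these cases exclude each other. -/
theorem eq_of_mem_iff {a b : T.Face} {e : T.E} (ha : ∀ x, a.Mem x ↔ x ≠ e)
    (hb : ∀ x, b.Mem x ↔ x ≠ e) : a = b := by
  have hbot : ∀ {f he hl}, (∀ x, (bottom f he hl : T.Face).Mem x ↔ x ≠ e) → e = T.root := by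
    intro f he hl h
    by_contra hne
    exact (mem_inputs.1 he).1 (le_antisymm ((h T.root).2 (Ne.symm hne)) (root_le f))
  have htop : ∀ {w hw hl}, (∀ x, (top w hw hl : T.Face).Mem x ↔ x ≠ e) → T.Unary w e := by
    intro w hw hl h
    refine ⟨hw, ?_⟩
    ext x
    rw [Finset.mem_singleton]
    exact not_iff_not.1 (h x)
  cases a with
  | inner f hf hv =>
    obtain rfl : f = e := by_contra fun hne => (ha f).2 hne rfl
    cases b with
    | inner f' hf' hv' =>
      obtain rfl : f' = f := by_contra fun hne => (hb f').2 hne rfl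
      rfl
    | top w hw hl => exact absurd hv (hl _ (htop hb).mem_inputs)
    | bottom f' hf' hl => exact absurd (hbot hb) hf
  | top w hw hl =>
    have h1 := htop ha
    cases b with
    | inner f' hf' hv' =>
      obtain rfl : f' = e := by_contra fun hne => (hb f').2 hne rfl
      exact absurd hv' (hl _ h1.mem_inputs)
    | top w' hw' hl' =>
      obtain rfl : w = w' := h1.next_eq.symm.trans (htop hb).next_eq
      rfl
    | bottom f' hf' hl => exact absurd (hbot hb) h1.ne_root
  | bottom f he hl =>
    have h1 := hbot ha
    cases b with
    | inner f' hf' hv' =>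
      obtain rfl : f' = e := by_contra fun hne => (hb f').2 hne rfl
      exact absurd h1 hf'
    | top w' hw' hl' => exact absurd h1 (htop hb).ne_root
    | bottom f' he' hl' =>
      obtain rfl : f = f' := le_antisymm
        ((ha f').2 (h1 ▸ (mem_inputs.1 he').1)) ((hb f).2 (h1 ▸ (mem_inputs.1 he).1))
      rfl

/-- The face missing the output of v is a bottom face if v is the root and an inner face otherwise;
as the root has label 0, both cases have the same sign formula. -/
theorem exists_down {v i : T.E} (h : T.Unary v i) : ∃ a : T.Face, (∀ x, a.Mem x ↔ x ≠ v) ∧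
    a.removed = v ∧ (∀ p : Planar T, a.sgn p = (-1) ^ p.label v) ∧
      ∀ u x, a.Inp u x ↔ x ∈ T.inputs u ∨ (v ∈ T.inputs u ∧ x = i) := by
  by_cases hv : v = T.root
  · subst hv
    have hl : ∀ e' ∈ T.inputs T.root, e' ≠ i → e' ∉ T.vert := fun e he hne => by
      rw [h.inputs_eq, Finset.mem_singleton] at he
      exact absurd he hne
    refine ⟨bottom i h.mem_inputs hl, fun x => ?_, rfl, fun p => ?_, fun u x => ?_⟩
    · rw [← (root_le x).lt_iff_ne', h.lt_iff]
      rfl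
    · rw [Planar.label_root]
      rfl
    · have : T.root ∉ T.inputs u := fun h' => (mem_inputs.1 h').1 rfl
      simp [Inp, this]
  · refine ⟨inner v hv h.mem, fun x => Iff.rfl, rfl, fun p => rfl, fun u x => ?_⟩
    simp only [Inp, h.inputs_eq, Finset.mem_singleton]
    simp [mem_inputs, hv]

/-- The face missing the input of v is inner if a vertex sits on i, and otherwise the top face at v,
whose exponent is the label of i by `Planar.label_unary`. -/
theorem exists_up {v i : T.E} (h : T.Unary v i) : ∃ a : T.Face, (∀ x, a.Mem x ↔ x ≠ i) ∧
    (∀ p : Planar T, a.sgn p = (-1) ^ p.label i) := by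
  by_cases hi : i ∈ T.vert
  · exact ⟨inner i h.ne_root hi, fun x => Iff.rfl, fun p => rfl⟩
  · refine ⟨top v h.mem fun e he => ?_, fun x => ?_, fun p => ?_⟩
    · rw [h.inputs_eq, Finset.mem_singleton] at he
      exact he ▸ hi
    · simp [Mem, h.inputs_eq]
    · rw [Planar.label_unary h]
      rfl

/-- A face which misses neither the output nor the input of a unary vertex contains this vertex. -/
theorem exists_unary {v i : T.E} (h : T.Unary v i) (a : T.Face) :
    (∀ x, a.Mem x ↔ x ≠ v) ∨ (∀ x, a.Mem x ↔ x ≠ i) ∨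
      ∃ v' i', a.tree.Unary v' i' ∧ onEdges a.map v' = v ∧ onEdges a.map i' = i := by
  have key : a.Mem v → a.Mem i → v ≠ a.removed → (∀ x, a.Mem x → (a.Inp v x ↔ x = i)) →
      ∃ v' i', a.tree.Unary v' i' ∧ onEdges a.map v' = v ∧ onEdges a.map i' = i := by
    intro hv hi hr hin
    obtain ⟨v', hv'⟩ := exists_eq_iff.2 hv
    obtain ⟨i', hi'⟩ := exists_eq_iff.2 hi
    refine ⟨v', i', ⟨(a.removes.mem_iff v').2 ⟨hv' ▸ h.mem, hv' ▸ hr⟩, ?_⟩, hv', hi'⟩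
    ext x
    rw [Finset.mem_singleton, mem_inputs_tree, hv', hin _ (mem_map x), ← hi', a.inj.eq_iff]
  cases a with
  | inner e he hv =>
    by_cases h1 : e = v
    · subst h1
      exact Or.inl fun x => Iff.rfl
    by_cases h2 : e = i
    · subst h2
      exact Or.inr (Or.inl fun x => Iff.rfl)
    refine Or.inr (Or.inr (key (Ne.symm h1) (Ne.symm h2) (Ne.symm h1) fun x hx => ?_))
    simp only [Inp, h.inputs_eq, Finset.mem_singleton]
    refine or_iff_left ?_
    rintro ⟨h3, -⟩
    exact h2 (h.eq_of_next he h3)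
  | top w hw hl =>
    by_cases h1 : w = v
    · subst h1
      refine Or.inr (Or.inl fun x => ?_)
      simp [Mem, h.inputs_eq]
    refine Or.inr (Or.inr (key (fun h' => hl v h' h.mem) (fun h' => ?_) (Ne.symm h1) fun x hx => ?_))
    · exact h1 ((mem_inputs.1 h').2.symm.trans h.next_eq)
    · simp [Inp, h.inputs_eq]
  | bottom e he hl =>
    by_cases h1 : v = T.root
    · subst h1
      left
      intro x
      have : e = i := by simpa [h.inputs_eq] using he
      rw [← (root_le x).lt_iff_ne', h.lt_iff, ← this]
      rfl
    have h2 := bottom_le_of_mem_vert hl h.mem h1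
    refine Or.inr (Or.inr (key h2 (h2.trans h.lt.le) h1 fun x hx => ?_))
    simp [Inp, h.inputs_eq]

end Face

/-- `π` collapses the unary vertex `v` with input `i`, and `s` is its section which avoids `v`. -/
structure Split (T S : OTree) (v i : T.E) where
  unary : T.Unary v i
  π : T ⟶ S
  s : S ⟶ T
  s_π : s ≫ π = 𝟙 S
  π_s_apply : ∀ e, e ≠ v → onEdges s (onEdges π e) = e
  π_s_self : onEdges s (onEdges π v) = i

/-- The base is the face which misses v, the section is the face map, and the projection moves v to
i and fixes every other edge. -/
theorem exists_split {v i : T.E} (h : T.Unary v i) : ∃ S, Nonempty (Split T S v i) := by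
  classical
  obtain ⟨a, hm, hr, -, hI⟩ := Face.exists_down h
  have hc : ∀ e, (if e = v then i else e) ≠ v := by
    intro e
    split_ifs with he
    · exact h.lt.ne'
    · exact he
  have hk := fun e => Face.exists_eq_iff.2 ((hm _).2 (hc e))
  choose k hk using hk
  have hkv : onEdges a.map (k v) = i := by rw [hk, if_pos rfl]
  have hke : ∀ e, e ≠ v → onEdges a.map (k e) = e := fun e he => by rw [hk, if_neg he]
  have hki : k v = k i := a.inj (by rw [hkv, hke i h.lt.ne'])
  refine ⟨a.tree, ⟨⟨h, Hom.mk k fun u hu => ?_, a.map, ?_, hke, hkv⟩⟩⟩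
  · by_cases huv : u = v
    · subst huv
      rw [h.inputs_eq, Finset.singleton_val, Multiset.map_singleton, hki]
      exact Op.id _
    · have hu' : k u ∈ a.tree.vert := (a.removes.mem_iff _).2 (by
        rw [hke u huv, hr]
        exact ⟨hu, huv⟩)
      refine (Op.vertex hu').map_inputs ?_ fun x => ?_
      · intro x hx y hy hxy
        have h1 : (if x = v then i else x) = if y = v then i else y := by rw [← hk, ← hk, hxy]
        -- Merging v with i repeats no input of u, since i is an input of v only.
        have h2 : ¬ (v ∈ T.inputs u ∧ i ∈ T.inputs u) := fun h' =>
          huv ((mem_inputs.1 h'.2).2.symm.trans h.next_eq)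
        split_ifs at h1 with h3 h4 h4
        · rw [h3, h4]
        · subst h3; subst h1
          exact absurd ⟨hx, hy⟩ h2
        · subst h4; subst h1
          exact absurd ⟨hy, hx⟩ h2
        · exact h1
      · rw [Finset.mem_val, Face.mem_inputs_tree, hke u huv, hI]
        constructor
        · rintro ⟨y, hy, rfl⟩
          by_cases hyv : y = v
          · subst hyv
            exact Or.inr ⟨hy, hkv⟩
          · rw [hke y hyv]
            exact Or.inl hy
        · rintro (hx | ⟨hv, hx⟩)
          · exact ⟨_, hx, a.inj (hke _ ((hm _).1 (Face.mem_map x)))⟩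
          · exact ⟨v, hv, a.inj (hkv.trans hx.symm)⟩
  · exact hom_ext fun y => a.inj (hke _ ((hm _).1 (Face.mem_map y)))

namespace Split

variable {v i : T.E} (σ : Split T S v i)

theorem s_π_apply (y : S.E) : onEdges σ.π (onEdges σ.s y) = y := by
  rw [← onEdges_comp, σ.s_π, onEdges_id]

theorem s_injective : Function.Injective (onEdges σ.s) :=
  Function.LeftInverse.injective σ.s_π_apply

theorem π_s_of_eq {e : T.E} (h : e = v) : onEdges σ.s (onEdges σ.π e) = i := by
  subst h
  exact σ.π_s_self

theorem s_ne (y : S.E) : onEdges σ.s y ≠ v := fun h => σ.unary.lt.ne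
  (h.symm.trans ((congrArg (onEdges σ.s) (σ.s_π_apply y)).symm.trans (σ.π_s_of_eq h)))

theorem π_eq : onEdges σ.π v = onEdges σ.π i :=
  σ.s_injective (by rw [σ.π_s_self, σ.π_s_apply i σ.unary.lt.ne'])

theorem exists_s_eq {e : T.E} : (∃ y, onEdges σ.s y = e) ↔ e ≠ v :=
  ⟨by rintro ⟨y, rfl⟩; exact σ.s_ne y, fun h => ⟨_, σ.π_s_apply e h⟩⟩

theorem le_π_s (e : T.E) : e ≤ onEdges (σ.π ≫ σ.s) e := by
  by_cases he : e = v
  · rw [he, onEdges_comp, σ.π_s_self]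
    exact σ.unary.lt.le
  · exact (σ.π_s_apply e he).ge

theorem π_s_comp {θ : T ⟶ R} (h : onEdges θ v = onEdges θ i) : (σ.π ≫ σ.s) ≫ θ = θ := by
  ext e
  by_cases he : e = v
  · rw [he, onEdges_comp, onEdges_comp, σ.π_s_self, h]
  · rw [onEdges_comp, onEdges_comp, σ.π_s_apply e he]

theorem π_s_unique (σ' : Split T S' v i) : σ.π ≫ σ.s = σ'.π ≫ σ'.s := by
  ext e
  by_cases he : e = v
  · rw [he, onEdges_comp, onEdges_comp, σ.π_s_self, σ'.π_s_self]
  · rw [onEdges_comp, onEdges_comp, σ.π_s_apply e he, σ'.π_s_apply e he]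

theorem removes : Removes σ.s v := by
  refine ⟨σ.s_injective, σ.unary.mem, fun y => ⟨fun hy => ⟨map_mem_vert _ σ.s_injective hy,
    σ.s_ne y⟩, fun hy => ?_⟩, fun x _ hx => σ.exists_s_eq.2 hx⟩
  -- If y were a leaf, π would send the vertex s y to an identity, so some input of s y would be
  -- merged with s y itself. The only edges merged are v and i, and i is not below v.
  by_contra h
  have h0 := σ.π.map_vert _ hy.1
  have h1 : (T.inputs (onEdges σ.s y)).val.map (onEdges σ.π) = {y} := by
    have h2 : S.Op ((T.inputs (onEdges σ.s y)).val.map (onEdges σ.π))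
        (onEdges σ.π (onEdges σ.s y)) := h0
    rw [σ.s_π_apply] at h2
    exact h2.eq_singleton_of_leaf h
  have h2 : y ∈ (T.inputs (onEdges σ.s y)).val.map (onEdges σ.π) := by
    rw [h1]; exact Multiset.mem_singleton_self y
  obtain ⟨b, hb, hb'⟩ := Multiset.mem_map.1 h2
  have hb := mem_inputs.1 (Finset.mem_def.2 hb)
  by_cases hbv : b = v
  · have h3 := σ.π_s_of_eq hbv
    rw [hb'] at h3
    have h4 := σ.unary.next_eq
    rw [← h3] at h4
    have h5 := next_lt hb.1
    rw [hb.2] at h5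
    have h6 := le_of_eq_of_le (hbv.trans h4.symm) (next_le (onEdges σ.s y))
    exact absurd h6 (not_le_of_gt h5)
  · have h3 := σ.π_s_apply b hbv
    rw [hb'] at h3
    rw [h3] at hb
    exact next_ne hb.1 hb.2

theorem size_eq (σ : Split T S v i) : S.size + 1 = T.size := σ.removes.size_eq

/-- The relation i ≤ v is the only one which appears under π without holding in T. Thus the order of
T can be read off from S and the marked edge. -/
theorem le_iff {a b : T.E} :
    a ≤ b ↔ onEdges σ.π a ≤ onEdges σ.π b ∧
      (b = v → a ≠ v → onEdges σ.π a ≠ onEdges σ.π v) := by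
  have hs : ∀ x y, onEdges σ.s x ≤ onEdges σ.s y ↔ x ≤ y := fun x y => map_le_iff _ σ.s_injective
  by_cases ha : a = v <;> by_cases hb : b = v
  · simp [ha, hb]
  · subst ha
    rw [← hs, σ.π_s_self, σ.π_s_apply b hb, ← σ.unary.lt_iff]
    simp only [hb, false_imp_iff, and_true]
    exact ⟨fun h => lt_of_le_of_ne h (Ne.symm hb), le_of_lt⟩
  · subst hb
    rw [← hs, σ.π_s_self, σ.π_s_apply a ha, ← σ.unary.lt_iff', lt_iff_le_and_ne]
    simp only [ha, ne_eq, not_false_eq_true, true_imp_iff]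
    rw [σ.π_eq, ← σ.s_injective.eq_iff, σ.π_s_apply a ha, σ.π_s_apply i σ.unary.lt.ne']
  · rw [← hs, σ.π_s_apply a ha, σ.π_s_apply b hb]
    simp [hb]

theorem mem_vert_iff {e : T.E} : e ∈ T.vert ↔ e = v ∨ onEdges σ.π e ∈ S.vert := by
  by_cases he : e = v
  · simp [he, σ.unary.mem]
  · rw [σ.removes.mem_iff, σ.π_s_apply e he]
    simp [he]

theorem eq_of_π_eq {a b : T.E} (ha : a ≠ v) (hb : b ≠ v)
    (h : onEdges σ.π a = onEdges σ.π b) : a = b := by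
  rw [← σ.π_s_apply a ha, h, σ.π_s_apply b hb]

/-- As π merges just v with i, it is bijective on any subtree which misses exactly one of the two.
-/
theorem bijective_comp {f : R ⟶ T} (hf : Function.Injective (onEdges f))
    (hr : (∀ e, (∃ y, onEdges f y = e) ↔ e ≠ v) ∨ (∀ e, (∃ y, onEdges f y = e) ↔ e ≠ i)) :
    Function.Bijective (onEdges (f ≫ σ.π)) := by
  constructor
  · intro x y hxy
    by_cases hx : onEdges f x = v <;> by_cases hy : onEdges f y = v
    · exact hf (hx.trans hy.symm)
    · rw [onEdges_comp, onEdges_comp, hx, σ.π_eq] at hxy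
      have := σ.eq_of_π_eq σ.unary.lt.ne' hy hxy
      rcases hr with hr | hr
      · exact absurd hx ((hr _).1 ⟨x, rfl⟩)
      · exact absurd this.symm ((hr _).1 ⟨y, rfl⟩)
    · rw [onEdges_comp, onEdges_comp, hy, σ.π_eq] at hxy
      have := σ.eq_of_π_eq hx σ.unary.lt.ne' hxy
      rcases hr with hr | hr
      · exact absurd hy ((hr _).1 ⟨y, rfl⟩)
      · exact absurd this ((hr _).1 ⟨x, rfl⟩)
    · exact hf (σ.eq_of_π_eq hx hy hxy)
  · intro y
    by_cases hi : onEdges σ.s y = i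
    · rcases hr with hr | hr
      · obtain ⟨x, hx⟩ := (hr i).2 σ.unary.lt.ne'
        exact ⟨x, by rw [onEdges_comp, hx, ← σ.s_π_apply y, hi]⟩
      · obtain ⟨x, hx⟩ := (hr v).2 σ.unary.lt.ne
        exact ⟨x, by rw [onEdges_comp, hx, σ.π_eq, ← σ.s_π_apply y, hi]⟩
    · obtain ⟨x, hx⟩ : ∃ x, onEdges f x = onEdges σ.s y := by
        rcases hr with hr | hr
        · exact (hr _).2 (σ.s_ne y)
        · exact (hr _).2 hi
      exact ⟨x, by rw [onEdges_comp, hx, σ.s_π_apply]⟩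

/-- A tree is determined by the tree obtained by collapsing a unary vertex, with its marked edge. -/
theorem exists_iso {v' i' : T'.E} (σ' : Split T' S' v' i') (φ : S ≅ S')
    (h : onEdges φ.hom (onEdges σ.π v) = onEdges σ'.π v') :
    ∃ ψ : T ≅ T', ψ.hom ≫ σ'.π = σ.π ≫ φ.hom ∧ onEdges ψ.hom v = v' ∧
      σ.s ≫ ψ.hom = φ.hom ≫ σ'.s := by
  classical
  let k : T.E → T'.E := fun e => if e = v then v' else onEdges σ'.s (onEdges φ.hom (onEdges σ.π e))
  have hkv : k v = v' := if_pos rfl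
  have hke : ∀ e, e ≠ v → k e = onEdges σ'.s (onEdges φ.hom (onEdges σ.π e)) :=
    fun e he => if_neg he
  have hkv' : ∀ e, k e = v' ↔ e = v := by
    intro e
    refine ⟨fun h' => ?_, fun h' => h' ▸ hkv⟩
    by_contra he
    rw [hke e he] at h'
    exact σ'.s_ne _ h'
  have hkπ : ∀ e, onEdges σ'.π (k e) = onEdges φ.hom (onEdges σ.π e) := by
    intro e
    by_cases he : e = v
    · rw [he, hkv, h]
    · rw [hke e he, σ'.s_π_apply]
  have hle : ∀ a b, k a ≤ k b ↔ a ≤ b := by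
    intro a b
    rw [σ.le_iff, σ'.le_iff, hkπ, hkπ, map_le_iff _ (iso_injective φ), hkv', ne_eq, hkv', ← h,
      ne_eq, (iso_injective φ).eq_iff]
  have hb : Function.Bijective k := by
    constructor
    · intro a b hab
      exact le_antisymm ((hle _ _).1 hab.le) ((hle _ _).1 hab.ge)
    · intro e
      by_cases he : e = v'
      · exact ⟨v, by rw [hkv, he]⟩
      · refine ⟨onEdges σ.s (onEdges φ.inv (onEdges σ'.π e)), ?_⟩
        rw [hke _ (σ.s_ne _), σ.s_π_apply, iso_inv_hom_apply, σ'.π_s_apply e he]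
  let K : T.E ≃o T'.E := { Equiv.ofBijective k hb with map_rel_iff' := fun {a b} => hle a b }
  refine ⟨isoOfOrderIso K fun x => ?_, hom_ext hkπ, hkv, hom_ext fun y => ?_⟩
  · change _ ↔ k x ∈ T'.vert
    rw [σ.mem_vert_iff, σ'.mem_vert_iff, hkv', hkπ, iso_mem_vert]
  · change k (onEdges σ.s y) = onEdges σ'.s (onEdges φ.hom y)
    rw [hke _ (σ.s_ne y), σ.s_π_apply]

/-- The map π ≫ s only moves edges upwards, and being to the left is inherited by edges further up;
the converse is asymmetry. -/
theorem pullback_π_s (p : Planar T) : p.pullback (σ.π ≫ σ.s) = p := by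
  ext a b
  rw [Planar.lt_iff (p := p)]
  refine and_congr_right fun hs => ⟨fun h => ?_, fun h => h.mono (σ.le_π_s a) (σ.le_π_s b)⟩
  have hne : a ≠ b := by
    rintro rfl
    exact h.irrefl
  refine (Planar.LeftOf.total (p := p) (fun h' => hne (hs.eq_of_le h'))
    fun h' => hne (hs.symm.eq_of_le h').symm).resolve_right fun h' => ?_
  exact h.asymm (h'.mono (σ.le_π_s b) (σ.le_π_s a))

/-- A split can be transported along an isomorphism of the base. -/
def trans (φ : S ≅ R) : Split T R v i where
  unary := σ.unary
  π := σ.π ≫ φ.hom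
  s := φ.inv ≫ σ.s
  s_π := by rw [Category.assoc, ← Category.assoc σ.s, σ.s_π, Category.id_comp, φ.inv_hom_id]
  π_s_apply e he := by simp [σ.π_s_apply e he]
  π_s_self := by simp [σ.π_s_self]

end Split

theorem degen_unary (T : OTree) (e : T.E) :
    (T.degen e).Unary (some e : Option T.E) (none : Option T.E) := by
  refine ⟨Or.inr rfl, ?_⟩
  ext x
  refine (degen_mem_inputs_some (v := e)).trans (Iff.trans ?_ Finset.mem_singleton.symm)
  simp only [ne_eq, true_and, not_true_eq_false, false_and, or_false]
  exact Iff.rfl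

/-- Both an abstract collapse of the new vertex and `degenMap` merge the same two edges. Hence the
section followed by `degenMap` is bijective on edges, an isomorphism by counting vertices, and the
base can be changed along it. -/
theorem exists_degenSplit (T : OTree) (e : T.E) :
    ∃ σ : Split (T.degen e) T (some e : Option T.E) (none : Option T.E), σ.π = T.degenMap e := by
  obtain ⟨S, ⟨σ⟩⟩ := exists_split (degen_unary T e)
  have hd : onEdges (T.degenMap e) (some e : Option T.E) =
    onEdges (T.degenMap e) (none : Option T.E) := rfl
  have hinj : ∀ x y : (T.degen e).E, x ≠ (some e : Option T.E) → y ≠ (some e : Option T.E) →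
      onEdges (T.degenMap e) x = onEdges (T.degenMap e) y → x = y := by
    rintro (_ | x) (_ | y) hx hy h
    · rfl
    · exact absurd (congrArg some h).symm hy
    · exact absurd (congrArg some h) hx
    · exact congrArg some h
  have hb : Function.Bijective (onEdges (σ.s ≫ T.degenMap e)) := by
    constructor
    · intro x y h
      exact σ.s_injective (hinj _ _ (σ.s_ne x) (σ.s_ne y) h)
    · intro x
      by_cases hx : x = e
      · refine ⟨onEdges σ.π (none : Option T.E), ?_⟩
        rw [onEdges_comp, σ.π_s_apply _ (Option.some_ne_none e).symm, hx]
        rfl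
      · refine ⟨onEdges σ.π (some x : Option T.E), ?_⟩
        rw [onEdges_comp, σ.π_s_apply _ fun h => hx (Option.some_injective _ h)]
        rfl
  have := isIso_of_bijective (σ.s ≫ T.degenMap e) hb
    (by have h1 := σ.size_eq; have h2 := T.size_degen e; omega)
  refine ⟨σ.trans (asIso (σ.s ≫ T.degenMap e)), ?_⟩
  change σ.π ≫ σ.s ≫ T.degenMap e = T.degenMap e
  rw [← Category.assoc, σ.π_s_comp hd]

end OTree

/-! ### Degenerate dendrices span a subcomplex. -/

namespace DSet

open OTree

variable {X : DSet.{u}} {n m : ℕ} {R S T S' T' : OTree}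

/-- `x` is degenerate at the unary vertex `v`. -/
def DegAt (x : X.Dendrex T) (v : T.E) : Prop :=
  ∃ (i : T.E) (S : OTree) (σ : Split T S v i), res (σ.π ≫ σ.s) x = x

theorem DegAt.mem_vert {x : X.Dendrex T} {v : T.E} (h : DegAt x v) : v ∈ T.vert := by
  obtain ⟨i, S, σ, -⟩ := h
  exact σ.unary.mem

theorem DegAt.res_eq {x : X.Dendrex T} {v i : T.E} (h : DegAt x v) (σ : Split T S v i) :
    res (σ.π ≫ σ.s) x = x := by
  obtain ⟨j, S', σ', h'⟩ := h
  obtain rfl := σ.unary.eq σ'.unary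
  rw [σ.π_s_unique σ', h']

/-- A map which merges v with i is unchanged by first applying π ≫ s. -/
theorem degAt_of_eq {x : X.Dendrex T} {y : X.Dendrex R} (θ : T ⟶ R) (h : x = res θ y)
    {v i : T.E} (hu : T.Unary v i) (hθ : onEdges θ v = onEdges θ i) : DegAt x v := by
  obtain ⟨S, ⟨σ⟩⟩ := exists_split hu
  exact ⟨i, S, σ, by rw [h, ← res_comp, σ.π_s_comp hθ]⟩

theorem DegAt.of_unary {x : X.Dendrex T} {v i : T.E} (h : DegAt x v) (hu : T.Unary v i)
    (f : R ⟶ T) {v' i' : R.E} (hu' : R.Unary v' i') (hv : onEdges f v' = v)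
    (hi : onEdges f i' = i) : DegAt (res f x) v' := by
  obtain ⟨S, ⟨σ⟩⟩ := exists_split hu
  refine degAt_of_eq (f ≫ σ.π) (y := res σ.s x) ?_ hu' ?_
  · rw [← res_comp, Category.assoc, res_comp f, h.res_eq σ]
  · rw [onEdges_comp, onEdges_comp, hv, hi, σ.π_eq]

/-- For the converse, T is identified with a tree `degen` by `Split.exists_iso`, since both collapse
to S with the same marked edge. -/
theorem isDegenerate_iff {x : X.Dendrex T} : IsDegenerate x ↔ ∃ v, DegAt x v := by
  constructor
  · rintro ⟨S, e, φ, y, rfl⟩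
    refine ⟨onEdges φ.inv (some e : Option S.E), degAt_of_eq (φ.hom ≫ S.degenMap e)
      (res_comp _ _ _).symm ((degen_unary S e).iso φ.symm) ?_⟩
    exact (congrArg (onEdges (S.degenMap e)) (iso_inv_hom_apply φ (some e : Option S.E))).trans
      (congrArg (onEdges (S.degenMap e)) (iso_inv_hom_apply φ (none : Option S.E))).symm
  · rintro ⟨v, i, S, σ, h⟩
    obtain ⟨σ', hσ'⟩ := exists_degenSplit S (onEdges σ.π v)
    obtain ⟨ψ, hψ, -, -⟩ := σ.exists_iso σ' (Iso.refl S) (by rw [hσ']; rfl)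
    refine ⟨S, onEdges σ.π v, ψ, res σ.s x, ?_⟩
    rw [← hσ', ← res_comp, hψ, ← res_comp, Iso.refl_hom, Category.comp_id, h]

/-- The subtree maps isomorphically onto S by π, and both the dendrex and the planar structure are
invariant under π ≫ s. -/
theorem cls_pull_split {g : X.Gen (n + 1)} {v i : g.tree.E} (h : DegAt g.dendrex v)
    (σ : Split g.tree S v i) (hS : S.size = n) (f : R ⟶ g.tree) (hR : R.size = n)
    (hf : Function.Injective (onEdges f))
    (hr : (∀ e, (∃ y, onEdges f y = e) ↔ e ≠ v) ∨ (∀ e, (∃ y, onEdges f y = e) ↔ e ≠ i)) :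
    cls (g.pull f hR) = cls (g.pull σ.s hS) := by
  have := isIso_of_bijective (f ≫ σ.π) (σ.bijective_comp hf hr) (by omega)
  let φ : R ≅ S := asIso (f ≫ σ.π)
  refine (cls_eq_of_iso (g := g.pull σ.s hS) (g' := g.pull f hR) φ ?_ ?_).symm
  · change res f g.dendrex = res (f ≫ σ.π) (res σ.s g.dendrex)
    rw [← res_comp, Category.assoc, res_comp, h.res_eq σ]
  · change g.planar.pullback f = (g.planar.pullback σ.s).pullback (f ≫ σ.π)
    rw [← Planar.pullback_comp, Category.assoc, Planar.pullback_comp, σ.pullback_π_s]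

theorem cls_face_split {g : X.Gen (n + 1)} {v i : g.tree.E} (h : DegAt g.dendrex v)
    (σ : Split g.tree S v i) (hS : S.size = n) (a : g.tree.Face)
    (hr : (∀ e, a.Mem e ↔ e ≠ v) ∨ (∀ e, a.Mem e ↔ e ≠ i)) :
    cls (g.face a) = cls (g.pull σ.s hS) := by
  refine cls_pull_split h σ hS a.map (g.face a).size_eq a.inj ?_
  simpa only [Face.exists_eq_iff] using hr

theorem cls_mem_D {g : X.Gen n} (h : ∃ v, DegAt g.dendrex v) : cls g ∈ X.D n :=
  Submodule.subset_span ⟨g, isDegenerate_iff.2 h, rfl⟩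

/-- The faces which miss v and its input i cancel, the labels of v and i being consecutive. Any
other face still contains the unary vertex v, and so is degenerate there. -/
theorem bd_mem_D {g : X.Gen (n + 1)} (h : ∃ v, DegAt g.dendrex v) : bd g ∈ X.D n := by
  classical
  obtain ⟨v, hv⟩ := h
  obtain ⟨i, S, σ, -⟩ := id hv
  have hS : S.size = n := by have h1 := σ.size_eq; have h2 := g.size_eq; omega
  obtain ⟨a, ha, -, has, -⟩ := Face.exists_down σ.unary
  obtain ⟨b, hb, hbs⟩ := Face.exists_up σ.unary
  have hab : b ≠ a := by
    rintro rfl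
    exact (ha v).1 ((hb v).2 σ.unary.lt.ne) rfl
  rw [bd, ← Finset.add_sum_erase _ _ (Finset.mem_univ a),
    ← Finset.add_sum_erase _ _ (Finset.mem_erase.2 ⟨hab, Finset.mem_univ b⟩), ← add_assoc,
    has, hbs, cls_face_split hv σ hS a (Or.inl ha), cls_face_split hv σ hS b (Or.inr hb),
    Planar.label_unary σ.unary, pow_succ, mul_neg_one, neg_smul, add_neg_cancel, zero_add]
  refine Submodule.sum_mem _ fun c hc => Submodule.smul_mem _ _ (cls_mem_D ?_)
  rw [Finset.mem_erase, Finset.mem_erase] at hc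
  rcases Face.exists_unary σ.unary c with h1 | h1 | ⟨v', i', hu, hv', hi'⟩
  · exact absurd (Face.eq_of_mem_iff h1 ha) hc.2.1
  · exact absurd (Face.eq_of_mem_iff h1 hb) hc.1
  · exact ⟨v', hv.of_unary σ.unary c.map hu hv' hi'⟩

theorem D_le_comap (h : X.BoundaryDescends) (n : ℕ) : X.D (n + 1) ≤ (X.D n).comap (d h n) := by
  rw [D, Submodule.span_le]
  rintro _ ⟨g, hg, rfl⟩
  rw [SetLike.mem_coe, Submodule.mem_comap]
  change d h n (cls g) ∈ _
  rw [d_cls]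
  exact bd_mem_D (isDegenerate_iff.1 hg)

end DSet

/-! ### Nondegenerate cores (the Eilenberg–Zilber lemma) and colours of edges. -/

namespace OTree

variable {R S T S' T' : OTree}

/-- Every edge lies in the image of a section of `π`. -/
def EdgeSplit (π : T ⟶ S) : Prop :=
  ∀ e, ∃ s : S ⟶ T, s ≫ π = 𝟙 S ∧ onEdges s (onEdges π e) = e

theorem EdgeSplit.comp {π : T ⟶ S} {ρ : S ⟶ R} (h : EdgeSplit π) (h' : EdgeSplit ρ) :
    EdgeSplit (π ≫ ρ) := by
  intro e
  obtain ⟨s, hs, hs'⟩ := h e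
  obtain ⟨t, ht, ht'⟩ := h' (onEdges π e)
  refine ⟨t ≫ s, ?_, ?_⟩
  · rw [Category.assoc, ← Category.assoc s, hs, Category.id_comp, ht]
  · rw [onEdges_comp, onEdges_comp, ht', hs']

theorem EdgeSplit.iso (τ : T ≅ S) : EdgeSplit τ.hom := fun e =>
  ⟨τ.inv, τ.inv_hom_id, iso_hom_inv_apply τ e⟩

theorem EdgeSplit.id (T : OTree) : EdgeSplit (𝟙 T) := EdgeSplit.iso (Iso.refl T)

theorem Split.edgeSplit {v i : T.E} (σ : Split T S v i) : EdgeSplit σ.π := by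
  intro e
  by_cases he : e = v
  -- The section of the split avoids v. The face which misses i contains v and is also mapped
  -- isomorphically onto S, which gives a second section.
  · obtain ⟨a, ha, -⟩ := Face.exists_up σ.unary
    have := isIso_of_bijective (a.map ≫ σ.π)
      (σ.bijective_comp a.inj (Or.inr fun e => Face.exists_eq_iff.trans (ha e)))
      (by have h1 := σ.size_eq; have h2 := a.size_add_one; omega)
    let φ := asIso (a.map ≫ σ.π)
    refine ⟨φ.inv ≫ a.map, ?_, ?_⟩
    · rw [Category.assoc]
      exact φ.inv_hom_id
    · obtain ⟨y, hy⟩ := Face.exists_eq_iff.2 ((ha e).2 (he ▸ σ.unary.lt.ne))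
      rw [← hy]
      exact congrArg (onEdges a.map) (iso_hom_inv_apply φ y)
  · exact ⟨σ.s, σ.s_π, σ.π_s_apply e he⟩

end OTree

namespace DSet

open OTree

variable {X : DSet.{u}} {n m : ℕ} {R S T S' T' : OTree}

/-- A presentation of `x` as the degeneracy of a nondegenerate dendrex. -/
structure Core (x : X.Dendrex T) where
  tree : OTree
  π : T ⟶ tree
  dendrex : X.Dendrex tree
  edgeSplit : EdgeSplit π
  eq : x = res π dendrex
  nondeg : ∀ v, ¬ DegAt dendrex v

/-- Degenerate vertices are collapsed one at a time; the number of vertices decreases. -/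
theorem nonempty_core (x : X.Dendrex T) : Nonempty (Core x) := by
  induction hk : T.size generalizing T with
  | zero =>
    refine ⟨⟨T, 𝟙 T, x, EdgeSplit.id T, (res_id x).symm, ?_⟩⟩
    rintro v ⟨i, S, σ, -⟩
    have := σ.size_eq
    omega
  | succ k ih =>
    by_cases h : ∃ v, DegAt x v
    · obtain ⟨v, i, S, σ, h⟩ := h
      obtain ⟨c⟩ := ih (res σ.s x) (by have := σ.size_eq; omega)
      refine ⟨⟨c.tree, σ.π ≫ c.π, c.dendrex, σ.edgeSplit.comp c.edgeSplit, ?_, c.nondeg⟩⟩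
      rw [res_comp, ← c.eq, ← res_comp, h]
    · exact ⟨⟨T, 𝟙 T, x, EdgeSplit.id T, (res_id x).symm, not_exists.1 h⟩⟩

/-- The chosen core of a dendrex. -/
noncomputable def core (x : X.Dendrex T) : Core x := Classical.choice (nonempty_core x)

/-- A non-injective θ would make y degenerate at a merged pair of edges. So θ is an automorphism,
and this is the place where freeness of the action is applied. -/
theorem eq_id_of_res_eq (hX : X.IsNormal) {y : X.Dendrex S} (hy : ∀ v, ¬ DegAt y v) {θ : S ⟶ S}
    (h : res θ y = y) : θ = 𝟙 S := by
  have hinj : Function.Injective (onEdges θ) := by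
    by_contra hi
    obtain ⟨b, hb, hb'⟩ := exists_map_next_eq θ hi
    exact hy _ (degAt_of_eq θ h.symm (unary_of_map_eq θ hb hb') hb')
  have := isIso_of_bijective θ (Finite.injective_iff_bijective.1 hinj) le_rfl
  exact congrArg Iso.hom (hX S (asIso θ) y h)

theorem Core.res_section {x : X.Dendrex T} (c : Core x) {s : c.tree ⟶ T} (hs : s ≫ c.π = 𝟙 _) :
    res s x = c.dendrex :=
  (congrArg (res s) c.eq).trans (by rw [← res_comp, hs, res_id])

/-- The core of a dendrex is unique up to isomorphism. -/
theorem Core.exists_iso (hX : X.IsNormal) {x : X.Dendrex T} (c c' : Core x) :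
    ∃ φ : c.tree ≅ c'.tree, c.π ≫ φ.hom = c'.π ∧ res φ.hom c'.dendrex = c.dendrex := by
  have key : ∀ (c c' : Core x) (s : c.tree ⟶ T), s ≫ c.π = 𝟙 _ →
      res (s ≫ c'.π) c'.dendrex = c.dendrex := by
    intro c c' s hs
    rw [res_comp, ← c'.eq, c.res_section hs]
  obtain ⟨s, hs, -⟩ := c.edgeSplit T.root
  obtain ⟨s', hs', -⟩ := c'.edgeSplit T.root
  have h1 : res (s ≫ c'.π) c'.dendrex = c.dendrex := key c c' s hs
  have h2 : res (s' ≫ c.π) c.dendrex = c'.dendrex := key c' c s' hs'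
  refine ⟨⟨s ≫ c'.π, s' ≫ c.π, ?_, ?_⟩, ?_, h1⟩
  · exact eq_id_of_res_eq hX c.nondeg (by rw [res_comp, h2, h1])
  · exact eq_id_of_res_eq hX c'.nondeg (by rw [res_comp, h1, h2])
  -- A single section gives the isomorphism of the cores, but its compatibility with the projections
  -- is tested on each edge e by a section whose image contains e; this is the purpose of
  -- `EdgeSplit`.
  · ext e
    obtain ⟨t, ht, ht'⟩ := c'.edgeSplit e
    have h3 : t ≫ c.π ≫ s ≫ c'.π = 𝟙 _ := eq_id_of_res_eq hX c'.nondeg (by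
      rw [res_comp, res_comp, h1, ← c.eq, c'.res_section ht])
    conv_lhs => rw [← ht']
    exact congrArg (fun f => onEdges f (onEdges c'.π e)) h3

variable (X) in
/-- Dendrices with a marked edge. -/
structure Marked where
  tree : OTree
  dendrex : X.Dendrex tree
  edge : tree.E

instance : Setoid X.Marked where
  r a b := ∃ φ : a.tree ≅ b.tree, res φ.hom b.dendrex = a.dendrex ∧
    onEdges φ.hom a.edge = b.edge
  iseqv := by
    refine ⟨fun a => ⟨Iso.refl _, res_id _, rfl⟩, ?_, ?_⟩
    · rintro a b ⟨φ, h1, h2⟩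
      refine ⟨φ.symm, ?_, ?_⟩
      · rw [← h1, ← res_comp, Iso.symm_hom, φ.inv_hom_id, res_id]
      · rw [← h2, Iso.symm_hom, iso_hom_inv_apply]
    · rintro a b c ⟨φ, h1, h2⟩ ⟨ψ, h3, h4⟩
      refine ⟨φ ≪≫ ψ, ?_, ?_⟩
      · rw [Iso.trans_hom, res_comp, h3, h1]
      · rw [Iso.trans_hom, onEdges_comp, h2, h4]

variable (X) in
/-- Isomorphism classes of dendrices with a marked edge. -/
abbrev Color := Quotient (inferInstance : Setoid X.Marked)

/-- The colour of an edge is its image in the core. -/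
noncomputable def color (x : X.Dendrex T) (e : T.E) : X.Color :=
  Quotient.mk _ ⟨(core x).tree, (core x).dendrex, onEdges (core x).π e⟩

variable {x : X.Dendrex T}

theorem color_eq_core (hX : X.IsNormal) (c : Core x) (e : T.E) :
    color x e = Quotient.mk _ ⟨c.tree, c.dendrex, onEdges c.π e⟩ := by
  obtain ⟨φ, h1, h2⟩ := Core.exists_iso hX (core x) c
  exact Quotient.sound ⟨φ, h2, by rw [← h1]; rfl⟩

/-- Composing ρ with a core of x yields a core of the restriction, and cores are unique. -/
theorem color_res (hX : X.IsNormal) (x : X.Dendrex T) {ρ : R ⟶ T} (h : EdgeSplit ρ) (e : R.E) :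
    color (res ρ x) e = color x (onEdges ρ e) :=
  color_eq_core hX (x := res ρ x) ⟨(core x).tree, ρ ≫ (core x).π, (core x).dendrex,
    h.comp (core x).edgeSplit, by rw [res_comp, ← (core x).eq], (core x).nondeg⟩ e

/-- Equal colours give an automorphism of the core which fixes its dendrex and carries one image to
the other; by normality it is the identity. -/
theorem color_eq_iff (hX : X.IsNormal) {a b : T.E} :
    color x a = color x b ↔ onEdges (core x).π a = onEdges (core x).π b := by
  constructor
  · intro h
    obtain ⟨φ, h1, h2⟩ := Quotient.exact h
    have h3 : φ.hom = 𝟙 _ := eq_id_of_res_eq hX (core x).nondeg h1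
    exact (congrArg (fun f => onEdges f (onEdges (core x).π a)) h3).symm.trans h2
  · intro h
    rw [color, h]
    rfl

theorem le_or_le_of_color_eq (hX : X.IsNormal) {a b : T.E} (h : color x a = color x b) :
    a ≤ b ∨ b ≤ a :=
  le_or_le_of_map_le _ ((color_eq_iff hX).1 h).le

theorem color_eq_of_between (hX : X.IsNormal) {a b c : T.E} (h : color x a = color x c)
    (hab : a ≤ b) (hbc : b ≤ c) : color x b = color x a := by
  rw [color_eq_iff hX] at h ⊢
  exact le_antisymm (h ▸ onEdges_mono _ hbc) (onEdges_mono _ hab)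

theorem DegAt.color_eq (hX : X.IsNormal) {v i : T.E} (h : DegAt x v) (hu : T.Unary v i) :
    color x i = color x v := by
  obtain ⟨S, ⟨σ⟩⟩ := exists_split hu
  have h1 : x = res σ.π (res σ.s x) := by rw [← res_comp, h.res_eq σ]
  rw [h1, color_res hX _ σ.edgeSplit, color_res hX _ σ.edgeSplit, σ.π_eq]

theorem unary_of_color_eq (hX : X.IsNormal) {b : T.E} (hb : b ≠ T.root)
    (h : color x (T.next b) = color x b) : T.Unary (T.next b) b ∧ DegAt x (T.next b) := by
  have h1 := (color_eq_iff hX).1 h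
  have h2 := unary_of_map_eq (core x).π hb h1
  exact ⟨h2, degAt_of_eq _ (core x).eq h2 h1⟩

/-- Colours are constant along the path between two edges of the same colour, so v and its input on
the way to b are merged in the core. -/
theorem degAt_iff (hX : X.IsNormal) {v : T.E} :
    DegAt x v ↔ ∃ b, v < b ∧ color x b = color x v := by
  constructor
  · intro h
    obtain ⟨i, S, σ, -⟩ := id h
    exact ⟨i, σ.unary.lt, h.color_eq hX σ.unary⟩
  · rintro ⟨b, hb, h⟩
    obtain ⟨c, hc, hc', rfl⟩ := exists_child hb
    exact (unary_of_color_eq hX hc' (color_eq_of_between hX h.symm (next_le c) hc).symm).2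

/-- The section s need not be edge-split; instead `color_res` is applied to π, along which x is the
pullback of its restriction to S. -/
theorem color_split (hX : X.IsNormal) {v i : T.E} (h : DegAt x v) (σ : Split T S v i) (y : S.E) :
    color (res σ.s x) y = color x (onEdges σ.s y) := by
  have h1 : x = res σ.π (res σ.s x) := by rw [← res_comp, h.res_eq σ]
  have h2 := color_res hX (res σ.s x) σ.edgeSplit (onEdges σ.s y)
  rw [σ.s_π_apply, ← h1] at h2
  exact h2.symm

theorem degAt_split_iff (hX : X.IsNormal) {v i : T.E} (h : DegAt x v) (σ : Split T S v i)
    (y : S.E) : DegAt (res σ.s x) y ↔ DegAt x (onEdges σ.s y) := by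
  rw [degAt_iff hX, degAt_iff hX]
  simp only [color_split hX h]
  constructor
  · rintro ⟨b, hb, hb'⟩
    exact ⟨_, (map_lt_iff _ σ.s_injective).2 hb, hb'⟩
  · rintro ⟨b, hb, hb'⟩
    by_cases hbv : b = v
    -- The witness is the collapsed edge itself; its input i has the same colour and lies higher, so
    -- it serves as well.
    · subst hbv
      obtain ⟨y', hy'⟩ := σ.exists_s_eq.2 σ.unary.lt.ne'
      refine ⟨y', (map_lt_iff _ σ.s_injective).1 ?_, ?_⟩
      · rw [hy']
        exact hb.trans σ.unary.lt
      · rw [hy', h.color_eq hX σ.unary, hb']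
    · obtain ⟨y', rfl⟩ := σ.exists_s_eq.2 hbv
      exact ⟨y', (map_lt_iff _ σ.s_injective).1 hb, hb'⟩

theorem degAt_iso_iff (hX : X.IsNormal) (τ : S ≅ T) (y : S.E) :
    DegAt (res τ.hom x) y ↔ DegAt x (onEdges τ.hom y) := by
  rw [degAt_iff hX, degAt_iff hX]
  simp only [color_res hX x (EdgeSplit.iso τ)]
  constructor
  · rintro ⟨b, hb, hb'⟩
    exact ⟨_, (map_lt_iff _ (iso_injective τ)).2 hb, hb'⟩
  · rintro ⟨b, hb, hb'⟩
    obtain ⟨b, rfl⟩ := (iso_bijective τ).2 b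
    exact ⟨b, (map_lt_iff _ (iso_injective τ)).1 hb, hb'⟩

end DSet

/-- On a chain the exponents are 0, 1, 2, …, so the sum is 1 - 1 + 1 - ⋯. -/
theorem Finset.sum_neg_one_pow_card_lt {α : Type*} [PartialOrder α] [DecidableLT α]
    (A : Finset α) (hA : ∀ a ∈ A, ∀ b ∈ A, a ≤ b ∨ b ≤ a) :
    ∑ e ∈ A, (-1 : ℤ) ^ (A.filter (· < e)).card = if Odd A.card then 1 else 0 := by
  classical
  induction hk : A.card generalizing A with
  | zero => simp [Finset.card_eq_zero.1 hk]
  | succ k ih =>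
    obtain ⟨t, ht⟩ := A.exists_maximal (Finset.card_pos.1 (by omega))
    have hle : ∀ a ∈ A, a ≤ t := fun a ha =>
      (hA a ha t ht.1).elim _root_.id fun h => ht.2 ha h
    have h1 : A.filter (· < t) = A.erase t := by
      ext a
      simp only [Finset.mem_filter, Finset.mem_erase]
      exact ⟨fun h => ⟨h.2.ne, h.1⟩, fun h => ⟨h.2, lt_of_le_of_ne (hle a h.2) h.1⟩⟩
    have h2 : ∀ e ∈ A.erase t, A.filter (· < e) = (A.erase t).filter (· < e) := by
      intro e he
      ext a
      simp only [Finset.mem_filter, Finset.mem_erase]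
      refine ⟨fun h => ⟨⟨fun hat => ?_, h.1⟩, h.2⟩, fun h => ⟨h.1.2, h.2⟩⟩
      exact absurd (hle e (Finset.mem_of_mem_erase he)) (not_le_of_gt (hat ▸ h.2))
    have h3 : (A.erase t).card = k := by rw [Finset.card_erase_of_mem ht.1, hk]; rfl
    rw [← Finset.add_sum_erase _ _ ht.1, h1, h3, Finset.sum_congr rfl fun e he => by rw [h2 e he],
      ih _ (fun a ha b hb => hA a (Finset.mem_of_mem_erase ha) b (Finset.mem_of_mem_erase hb)) h3]
    rcases Nat.even_or_odd k with h | h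
    · rw [if_neg (Nat.not_odd_iff_even.2 h), if_pos h.add_one, h.neg_one_pow, add_zero]
    · rw [if_pos h, if_neg (Nat.not_odd_iff_even.2 h.add_one), h.neg_one_pow]
      rfl

/-! ### The rank filtration and the leading term of the differential. -/

namespace DSet

open OTree

variable {X : DSet.{u}} {n m : ℕ} {R S T S' T' : OTree} {x : X.Dendrex T}

open Classical in
/-- The degenerate vertices of a dendrex. -/
noncomputable def degs (x : X.Dendrex T) : Finset T.E := Finset.univ.filter (DegAt x)

@[simp]
theorem mem_degs {v : T.E} : v ∈ degs x ↔ DegAt x v := by simp [degs]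

theorem card_degs_le (x : X.Dendrex T) : (degs x).card ≤ T.size := by
  rw [← card_verts]
  exact Finset.card_le_card fun v hv => mem_verts.2 (mem_degs.1 hv).mem_vert

/-- The number of nondegenerate vertices. -/
noncomputable def rank (x : X.Dendrex T) : ℕ := T.size - (degs x).card

theorem rank_split (hX : X.IsNormal) {v i : T.E} (h : DegAt x v) (σ : Split T S v i) :
    rank (res σ.s x) = rank x := by
  classical
  have h1 : degs x = insert v ((degs (res σ.s x)).image (onEdges σ.s)) := by
    ext e
    simp only [mem_degs, Finset.mem_insert, Finset.mem_image, degAt_split_iff hX h]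
    constructor
    · intro he
      refine or_iff_not_imp_left.2 fun hv => ?_
      obtain ⟨y, rfl⟩ := σ.exists_s_eq.2 hv
      exact ⟨y, he, rfl⟩
    · rintro (rfl | ⟨y, hy, rfl⟩)
      · exact h
      · exact hy
  have h2 : v ∉ (degs (res σ.s x)).image (onEdges σ.s) := by
    rw [Finset.mem_image]
    rintro ⟨y, -, hy⟩
    exact σ.s_ne y hy
  rw [rank, rank, h1, Finset.card_insert_of_notMem h2,
    Finset.card_image_of_injective _ σ.s_injective]
  have := σ.size_eq
  omega

/-- One vertex is lost but no degenerate one, so the number of nondegenerate vertices drops. -/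
theorem rank_face_lt (f : S ⟶ T) (hf : S.size + 1 = T.size)
    (h : ∀ v, DegAt x v → ∃ v', DegAt (res f x) v' ∧ onEdges f v' = v) :
    rank (res f x) < rank x := by
  classical
  have h1 : degs x ⊆ (degs (res f x)).image (onEdges f) := by
    intro v hv
    obtain ⟨v', h1, h2⟩ := h v (mem_degs.1 hv)
    exact Finset.mem_image.2 ⟨v', mem_degs.2 h1, h2⟩
  have h2 := (Finset.card_le_card h1).trans Finset.card_image_le
  have h3 := card_degs_le (res f x)
  rw [rank, rank]
  omega

variable (X) in
/-- The span of the degenerate generators with less than `k` nondegenerate vertices. -/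
noncomputable def F (k n : ℕ) : Submodule ℤ (X.UnGroup n) :=
  Submodule.span ℤ {c | ∃ g : X.Gen n, (∃ v, DegAt g.dendrex v) ∧ rank g.dendrex < k ∧ c = cls g}

theorem cls_mem_F {g : X.Gen n} {k : ℕ} (h : ∃ v, DegAt g.dendrex v) (h' : rank g.dendrex < k) :
    cls g ∈ X.F k n :=
  Submodule.subset_span ⟨g, h, h', rfl⟩

theorem F_le_D (k n : ℕ) : X.F k n ≤ X.D n := by
  rw [F, Submodule.span_le]
  rintro _ ⟨g, hg, -, rfl⟩
  exact cls_mem_D hg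

/-- The rank is at most the number of vertices, so in each degree the filtration is exhausted after
finitely many steps. -/
theorem D_le_F (n : ℕ) : X.D n ≤ X.F (n + 1) n := by
  rw [D, Submodule.span_le]
  rintro _ ⟨g, hg, rfl⟩
  refine cls_mem_F (isDegenerate_iff.1 hg) ?_
  have := g.size_eq
  rw [rank]
  omega

theorem F_zero (n : ℕ) : X.F 0 n = ⊥ := by
  rw [F, Submodule.span_eq_bot]
  rintro _ ⟨g, -, h, -⟩
  exact absurd h (Nat.not_lt_zero _)

open Classical in
/-- The edges with the same colour as `v`. -/
noncomputable def fiber (x : X.Dendrex T) (v : T.E) : Finset T.E :=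
  Finset.univ.filter fun e => color x e = color x v

@[simp]
theorem mem_fiber {v e : T.E} : e ∈ fiber x v ↔ color x e = color x v := by simp [fiber]

/-- `v` is the lowest of a chain of degenerate vertices. -/
def IsBot (x : X.Dendrex T) (v : T.E) : Prop :=
  DegAt x v ∧ ∀ b, b < v → color x b ≠ color x v

theorem IsBot.le (hX : X.IsNormal) {v e : T.E} (h : IsBot x v) (he : color x e = color x v) :
    v ≤ e := by
  rcases le_or_le_of_color_eq hX he with h' | h'
  · rcases h'.eq_or_lt with h' | h'
    · exact h'.ge
    · exact absurd he (h.2 e h')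
  · exact h'

theorem IsBot.eq (hX : X.IsNormal) {v w : T.E} (h : IsBot x v) (h' : IsBot x w)
    (he : color x v = color x w) : v = w :=
  le_antisymm (h.le hX he.symm) (h'.le hX he)

/-- The edges of one colour form a chain, and its minimum is degenerate because a second edge of
this colour lies above it. -/
theorem exists_isBot (hX : X.IsNormal) {a b : T.E} (hab : a ≠ b) (h : color x a = color x b) :
    ∃ v, IsBot x v ∧ color x v = color x a := by
  obtain ⟨v, hv⟩ := (fiber x a).exists_minimal ⟨a, by simp⟩
  have hc := mem_fiber.1 hv.1
  have hmin : ∀ e, color x e = color x a → v ≤ e := fun e he =>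
    (le_or_le_of_color_eq hX (hc.trans he.symm)).elim _root_.id
      fun h => hv.2 (mem_fiber.2 he) h
  refine ⟨v, ⟨(degAt_iff hX).2 ?_, fun b hb hb' => ?_⟩, hc⟩
  · by_cases hva : v = a
    · exact ⟨b, lt_of_le_of_ne (hmin b h.symm) (hva ▸ hab), h.symm.trans hc.symm⟩
    · exact ⟨a, lt_of_le_of_ne (hmin a rfl) hva, hc.symm⟩
  · exact absurd (hmin b (hb'.trans hc)) (not_le_of_gt hb)

/-- The step from an edge of a chain to the one below it. -/
theorem IsBot.step (hX : X.IsNormal) {v e : T.E} (h : IsBot x v) (he : color x e = color x v)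
    (hne : e ≠ v) : T.Unary (T.next e) e ∧ DegAt x (T.next e) ∧
      color x (T.next e) = color x v ∧ T.height (T.next e) < T.height e := by
  have h1 : v < e := lt_of_le_of_ne (h.le hX he) hne.symm
  have h2 : e ≠ T.root := ne_root_of_lt h1
  have h3 : color x (T.next e) = color x v :=
    color_eq_of_between hX he.symm (le_next_of_lt h1) (next_le e)
  obtain ⟨h4, h5⟩ := unary_of_color_eq hX h2 (h3.trans he.symm)
  exact ⟨h4, h5, h3, by rw [T.height_next e h2]; omega⟩

-- Along a chain of unary vertices the labels are consecutive.
open Classical in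
theorem IsBot.label_eq (hX : X.IsNormal) (p : Planar T) {v : T.E} (h : IsBot x v) {e : T.E}
    (he : color x e = color x v) :
    p.label e = p.label v + ((fiber x v).filter (· < e)).card := by
  induction hk : T.height e using Nat.strong_induction_on generalizing e with
  | _ k ih =>
    by_cases hne : e = v
    · subst hne
      have : (fiber x e).filter (· < e) = ∅ := by
        rw [Finset.filter_eq_empty_iff]
        exact fun b hb hb' => h.2 b hb' (mem_fiber.1 hb)
      rw [this, Finset.card_empty, add_zero]
    · obtain ⟨hu, -, hc, hh⟩ := h.step hX he hne
      rw [Planar.label_unary hu, ih _ (hk ▸ hh) hc rfl, add_assoc]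
      congr 1
      rw [← Finset.card_insert_of_notMem (a := T.next e)
        (s := (fiber x v).filter (· < T.next e)) (by simp)]
      congr 1
      ext b
      simp only [Finset.mem_insert, Finset.mem_filter, mem_fiber, hu.lt_iff']
      constructor
      · rintro (rfl | ⟨h1, h2⟩)
        · exact ⟨hc, le_rfl⟩
        · exact ⟨h1, h2.le⟩
      · rintro ⟨h1, h2⟩
        rcases h2.eq_or_lt with h2 | h2
        · exact Or.inl h2
        · exact Or.inr ⟨h1, h2⟩

open Classical in
theorem IsBot.sum_label (hX : X.IsNormal) (p : Planar T) {v : T.E} (h : IsBot x v) :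
    ∑ e ∈ fiber x v, (-1 : ℤ) ^ p.label e =
      if Odd (fiber x v).card then (-1) ^ p.label v else 0 := by
  rw [Finset.sum_congr rfl fun e he => by rw [h.label_eq hX p (mem_fiber.1 he), pow_add],
    ← Finset.mul_sum, Finset.sum_neg_one_pow_card_lt _ fun a ha b hb =>
      le_or_le_of_color_eq hX ((mem_fiber.1 ha).trans (mem_fiber.1 hb).symm)]
  split_ifs <;> simp

open Classical in
/-- The class obtained by collapsing a degenerate vertex. -/
noncomputable def collapse (g : X.Gen (n + 1)) (v : g.tree.E) : X.UnGroup n :=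
  -- By `collapse_eq` the choice of the split is immaterial at a degenerate v; the value 0 is a
  -- filler for edges which are not unary vertices.
  if h : ∃ i S, ∃ _ : Split g.tree S v i, S.size = n then
    cls (g.pull h.choose_spec.choose_spec.choose.s h.choose_spec.choose_spec.choose_spec)
  else 0

theorem Gen.size_split (g : X.Gen (n + 1)) {v i : g.tree.E} (σ : Split g.tree S v i) :
    S.size = n := by
  have h1 := σ.size_eq
  have h2 := g.size_eq
  omega

theorem collapse_eq {g : X.Gen (n + 1)} {v i : g.tree.E} (h : DegAt g.dendrex v)
    (σ : Split g.tree S v i) (hS : S.size = n) : collapse g v = cls (g.pull σ.s hS) := by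
  have h' : ∃ i S, ∃ _ : Split g.tree S v i, S.size = n := ⟨i, S, σ, hS⟩
  rw [collapse, dif_pos h']
  obtain ⟨i', hi'⟩ : ∃ i', i' = h'.choose := ⟨_, rfl⟩
  exact cls_pull_split h σ hS _ h'.choose_spec.choose_spec.choose_spec
    h'.choose_spec.choose_spec.choose.s_injective
    (Or.inl fun e => h'.choose_spec.choose_spec.choose.exists_s_eq)

theorem cls_face_eq_collapse {g : X.Gen (n + 1)} {v i : g.tree.E} (h : DegAt g.dendrex v)
    (hu : g.tree.Unary v i) (a : g.tree.Face)
    (hr : (∀ e, a.Mem e ↔ e ≠ v) ∨ (∀ e, a.Mem e ↔ e ≠ i)) :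
    cls (g.face a) = collapse g v := by
  obtain ⟨S, ⟨σ⟩⟩ := exists_split hu
  rw [cls_face_split h σ (g.size_split σ) a hr, collapse_eq h σ (g.size_split σ)]

theorem DegAt.exists_unary {v : T.E} (h : DegAt x v) : ∃ i, T.Unary v i := by
  obtain ⟨i, S, σ, -⟩ := h
  exact ⟨i, σ.unary⟩

/-- All faces which miss an edge of the chain above `v` agree. -/
theorem cls_face_chain (hX : X.IsNormal) {g : X.Gen (n + 1)} {v : g.tree.E}
    (h : IsBot g.dendrex v) {e : g.tree.E} (he : color g.dendrex e = color g.dendrex v) :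
    ∃ a : g.tree.Face, (∀ x, a.Mem x ↔ x ≠ e) ∧ a.sgn g.planar = (-1) ^ g.planar.label e ∧
      cls (g.face a) = collapse g v := by
  induction hk : g.tree.height e using Nat.strong_induction_on generalizing e with
  | _ k ih =>
    by_cases hne : e = v
    · subst hne
      obtain ⟨i, hu⟩ := h.1.exists_unary
      obtain ⟨a, ha, -, hs, -⟩ := Face.exists_down hu
      exact ⟨a, ha, hs _, cls_face_eq_collapse h.1 hu a (Or.inl ha)⟩
    · obtain ⟨hu, hd, hc, hh⟩ := h.step hX he hne
      obtain ⟨a, ha, hs⟩ := Face.exists_up hu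
      obtain ⟨b, hb, -, hb'⟩ := ih _ (hk ▸ hh) hc rfl
      refine ⟨a, ha, hs _, ?_⟩
      -- The faces missing e and the edge below it both represent the collapse of the vertex between
      -- them, which lets the induction descend to v.
      rw [cls_face_eq_collapse hd hu a (Or.inr ha), ← hb',
        cls_face_eq_collapse hd hu b (Or.inl hb)]

open Classical in
/-- The lowest vertices of the chains of degenerate vertices of even length. -/
noncomputable def evenBots (x : X.Dendrex T) : Finset T.E :=
  Finset.univ.filter fun v => IsBot x v ∧ Odd (fiber x v).card

@[simp]
theorem mem_evenBots {v : T.E} : v ∈ evenBots x ↔ IsBot x v ∧ Odd (fiber x v).card := by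
  simp [evenBots]

/-- The differential of a degenerate generator, up to generators of lower rank. -/
theorem bd_sub_mem_F (hX : X.IsNormal) (g : X.Gen (n + 1)) (hg : ∃ v, DegAt g.dendrex v) :
    bd g - ∑ v ∈ evenBots g.dendrex, (-1 : ℤ) ^ g.planar.label v • collapse g v ∈
      X.F (rank g.dendrex) n := by
  classical
  set B : Finset g.tree.E := Finset.univ.filter (IsBot g.dendrex) with hB
  have h0 : ∀ v ∈ B, ∀ e ∈ fiber g.dendrex v, ∃ a : g.tree.Face, (∀ x, a.Mem x ↔ x ≠ e) ∧
      a.sgn g.planar = (-1) ^ g.planar.label e ∧ cls (g.face a) = collapse g v :=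
    fun v hv e he => cls_face_chain hX (Finset.mem_filter.1 hv).2 (mem_fiber.1 he)
  -- The alternating sum over all edges of a chain is its lowest sign if the number of edges is odd,
  -- and 0 otherwise. Spreading the sum over all edges prepares the comparison with faces.
  have h1 : ∑ v ∈ evenBots g.dendrex, (-1 : ℤ) ^ g.planar.label v • collapse g v =
      ∑ x ∈ B.sigma (fiber g.dendrex), (-1 : ℤ) ^ g.planar.label x.2 • collapse g x.1 := by
    rw [Finset.sum_sigma]
    have h2 : evenBots g.dendrex = B.filter fun v => Odd (fiber g.dendrex v).card := by
      ext v
      simp [hB]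
    rw [h2, Finset.sum_filter]
    refine Finset.sum_congr rfl fun v hv => ?_
    dsimp only
    rw [← Finset.sum_smul, (Finset.mem_filter.1 hv).2.sum_label hX]
    split_ifs <;> simp
  -- The faces which miss just one edge, lying on a chain; they correspond to the pairs of a chain
  -- and one of its edges.
  set A : Finset g.tree.Face := Finset.univ.filter fun a =>
    ∃ v, IsBot g.dendrex v ∧ ∃ e, color g.dendrex e = color g.dendrex v ∧
      ∀ x, a.Mem x ↔ x ≠ e with hA
  have h2 : ∑ x ∈ B.sigma (fiber g.dendrex), (-1 : ℤ) ^ g.planar.label x.2 • collapse g x.1 =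
      ∑ a ∈ A, a.sgn g.planar • cls (g.face a) := by
    have h3 : ∀ x ∈ B.sigma (fiber g.dendrex), ∃ a : g.tree.Face, (∀ y, a.Mem y ↔ y ≠ x.2) ∧
        a.sgn g.planar = (-1) ^ g.planar.label x.2 ∧ cls (g.face a) = collapse g x.1 :=
      fun x hx => h0 _ (Finset.mem_sigma.1 hx).1 _ (Finset.mem_sigma.1 hx).2
    refine Finset.sum_bij (fun x hx => (h3 x hx).choose) ?_ ?_ ?_ ?_
    · intro x hx
      have hx' := Finset.mem_sigma.1 hx
      exact Finset.mem_filter.2 ⟨Finset.mem_univ _, x.1, (Finset.mem_filter.1 hx'.1).2, x.2,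
        mem_fiber.1 hx'.2, (h3 x hx).choose_spec.1⟩
    · rintro ⟨v, e⟩ hx ⟨v', e'⟩ hx' h
      have he := (h3 _ hx).choose_spec.1
      have he' := (h3 _ hx').choose_spec.1
      rw [h] at he
      have hee : e = e' := by
        by_contra hne
        exact (he e).1 ((he' e).2 hne) rfl
      subst hee
      have hx := Finset.mem_sigma.1 hx
      have hx' := Finset.mem_sigma.1 hx'
      obtain rfl : v = v' := (Finset.mem_filter.1 hx.1).2.eq hX (Finset.mem_filter.1 hx'.1).2
        ((mem_fiber.1 hx.2).symm.trans (mem_fiber.1 hx'.2))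
      rfl
    · intro a ha
      obtain ⟨-, v, hv, e, he, hm⟩ := Finset.mem_filter.1 ha
      have hx : (⟨v, e⟩ : Σ _ : g.tree.E, g.tree.E) ∈ B.sigma (fiber g.dendrex) :=
        Finset.mem_sigma.2 ⟨Finset.mem_filter.2 ⟨Finset.mem_univ _, hv⟩, mem_fiber.2 he⟩
      exact ⟨_, hx, Face.eq_of_mem_iff (h3 _ hx).choose_spec.1 hm⟩
    · intro x hx
      rw [(h3 x hx).choose_spec.2.1, (h3 x hx).choose_spec.2.2]
  rw [h1, h2, bd, ← Finset.sum_sdiff (Finset.subset_univ A), add_sub_cancel_right]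
  refine Submodule.sum_mem _ fun a ha => Submodule.smul_mem _ _ ?_
  have ha : a ∉ A := (Finset.mem_sdiff.1 ha).2
  -- Every other face contains the output and input of each degenerate vertex, hence keeps it
  -- degenerate: it is a degenerate generator of smaller rank.
  have h3 : ∀ v, DegAt g.dendrex v → ∃ v', DegAt (res a.map g.dendrex) v' ∧
      onEdges a.map v' = v := by
    intro v hv
    obtain ⟨i, hu⟩ := hv.exists_unary
    obtain ⟨b, hb, hb'⟩ := exists_isBot hX hu.lt.ne' (hv.color_eq hX hu)
    rcases Face.exists_unary hu a with h | h | ⟨v', i', hu', hv', hi'⟩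
    · exact absurd (Finset.mem_filter.2 ⟨Finset.mem_univ _, b, hb, v,
        (hv.color_eq hX hu).symm.trans hb'.symm, h⟩) ha
    · exact absurd (Finset.mem_filter.2 ⟨Finset.mem_univ _, b, hb, i, hb'.symm, h⟩) ha
    · exact ⟨v', hv.of_unary hu a.map hu' hv' hi', hv'⟩
  refine cls_mem_F ?_ (rank_face_lt a.map a.size_add_one h3)
  obtain ⟨v, hv⟩ := hg
  obtain ⟨v', hv', -⟩ := h3 v hv
  exact ⟨v', hv'⟩

end DSet

/-! ### An invariant choice of a chain, and the contracting homotopy. -/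

namespace DSet

open OTree

variable {X : DSet.{u}} {n m : ℕ} {R S T S' T' : OTree} {x : X.Dendrex T}

/-- The elements of a choice of an element in every nonempty set of colours. -/
def IsPicked (s : Set X.Color) (c : X.Color) : Prop := ∃ h : s.Nonempty, c = h.some

/-- The colours of the degenerate vertices. -/
def degColors (x : X.Dendrex T) : Set X.Color := {c | ∃ v, DegAt x v ∧ color x v = c}

/-- `v` is the lowest vertex of a certain chain of degenerate vertices, the choice of which only
depends on the set of chains. -/
def IsChosen (x : X.Dendrex T) (v : T.E) : Prop := IsBot x v ∧ IsPicked (degColors x) (color x v)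

theorem IsChosen.eq (hX : X.IsNormal) {v w : T.E} (h : IsChosen x v) (h' : IsChosen x w) : v = w := by
  obtain ⟨h1, h2, h3⟩ := h
  obtain ⟨h1', h2', h3'⟩ := h'
  exact h1.eq hX h1' (h3.trans h3'.symm)

theorem exists_isChosen (hX : X.IsNormal) (h : ∃ v, DegAt x v) : ∃ v, IsChosen x v := by
  have h1 : (degColors x).Nonempty := h.elim fun v hv => ⟨_, v, hv, rfl⟩
  obtain ⟨v, hv, hc⟩ := h1.some_mem
  obtain ⟨b, hb, hb'⟩ := (degAt_iff hX).1 hv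
  obtain ⟨w, hw, hw'⟩ := exists_isBot hX hb.ne hb'.symm
  exact ⟨w, hw, h1, hw'.trans hc⟩

theorem degColors_iso (hX : X.IsNormal) (τ : S ≅ T) : degColors (res τ.hom x) = degColors x := by
  ext c
  constructor
  · rintro ⟨v, hv, hc⟩
    exact ⟨_, (degAt_iso_iff hX τ v).1 hv, (color_res hX x (EdgeSplit.iso τ) v).symm.trans hc⟩
  · rintro ⟨v, hv, hc⟩
    obtain ⟨y, rfl⟩ := (iso_bijective τ).2 v
    exact ⟨y, (degAt_iso_iff hX τ y).2 hv, (color_res hX x (EdgeSplit.iso τ) y).trans hc⟩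

theorem IsChosen.iso (hX : X.IsNormal) (τ : S ≅ T) {v : S.E} (h : IsChosen (res τ.hom x) v) :
    IsChosen x (onEdges τ.hom v) := by
  obtain ⟨⟨h1, h2⟩, h3⟩ := h
  rw [degColors_iso hX, color_res hX x (EdgeSplit.iso τ)] at h3
  refine ⟨⟨(degAt_iso_iff hX τ v).1 h1, fun b hb hb' => ?_⟩, h3⟩
  obtain ⟨y, rfl⟩ := (iso_bijective τ).2 b
  refine h2 y ((map_lt_iff _ (iso_injective τ)).1 hb) ?_
  rw [color_res hX x (EdgeSplit.iso τ), color_res hX x (EdgeSplit.iso τ), hb']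

/-- If the input i is degenerate too, the chain survives the loss of v, and i represents its colour.
-/
theorem degColors_split (hX : X.IsNormal) {v i : T.E} (h : DegAt x v) (hi : DegAt x i)
    (σ : Split T S v i) : degColors (res σ.s x) = degColors x := by
  ext c
  constructor
  · rintro ⟨y, hy, hc⟩
    exact ⟨_, (degAt_split_iff hX h σ y).1 hy, (color_split hX h σ y).symm.trans hc⟩
  · rintro ⟨e, he, hc⟩
    obtain ⟨e', he', hc', hne⟩ : ∃ e', DegAt x e' ∧ color x e' = c ∧ e' ≠ v := by
      by_cases hev : e = v
      · subst hev
        exact ⟨i, hi, (h.color_eq hX σ.unary).trans hc, σ.unary.lt.ne'⟩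
      · exact ⟨e, he, hc, hev⟩
    obtain ⟨y, rfl⟩ := σ.exists_s_eq.2 hne
    exact ⟨y, (degAt_split_iff hX h σ y).2 he', (color_split hX h σ y).trans hc'⟩

theorem color_π (hX : X.IsNormal) {v i : T.E} (h : DegAt x v) (σ : Split T S v i) (e : T.E) :
    color (res σ.s x) (onEdges σ.π e) = color x e := by
  rw [color_split hX h]
  by_cases he : e = v
  · rw [he, σ.π_s_self, h.color_eq hX σ.unary]
  · rw [σ.π_s_apply e he]

theorem s_lt_iff {v i : T.E} (σ : Split T S v i) {a b : S.E} :
    onEdges σ.s a < onEdges σ.s b ↔ a < b :=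
  map_lt_iff _ σ.s_injective

theorem IsChosen.split (hX : X.IsNormal) {v i c : T.E} (hc : IsChosen x c) (h : DegAt x v)
    (hi : DegAt x i) (σ : Split T S v i) : IsChosen (res σ.s x) (onEdges σ.π c) := by
  refine ⟨⟨(degAt_split_iff hX h σ _).2 ?_, fun b hb hb' => ?_⟩, ?_⟩
  · by_cases hcv : c = v
    · rwa [hcv, σ.π_s_self]
    · rw [σ.π_s_apply c hcv]
      exact hc.1.1
  · rw [color_π hX h, color_split hX h] at hb'
    have h1 := hc.1.le hX hb'
    rw [← s_lt_iff σ] at hb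
    by_cases hcv : c = v
    · subst hcv
      rw [σ.π_s_self, σ.unary.lt_iff'] at hb
      exact σ.s_ne b (le_antisymm hb h1)
    · rw [σ.π_s_apply c hcv] at hb
      exact absurd hb (not_lt_of_ge h1)
  · rw [degColors_split hX h hi, color_π hX h]
    exact hc.2

/-- The merged edge of S corresponds to i under the section, so i is degenerate, and no colour of a
chain is lost by the collapse. -/
theorem IsChosen.of_split (hX : X.IsNormal) {v i : T.E} (h : DegAt x v) (σ : Split T S v i)
    (hc : IsChosen (res σ.s x) (onEdges σ.π v)) : IsChosen x v ∧ DegAt x i := by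
  have hi : DegAt x i := by
    have := (degAt_split_iff hX h σ _).1 hc.1.1
    rwa [σ.π_s_self] at this
  refine ⟨⟨⟨h, fun b hb hb' => ?_⟩, ?_⟩, hi⟩
  · obtain ⟨y, rfl⟩ := σ.exists_s_eq.2 hb.ne
    refine hc.1.2 y ?_ ?_
    · rw [← s_lt_iff σ, σ.π_s_self]
      exact hb.trans σ.unary.lt
    · rw [color_π hX h, color_split hX h, hb']
  · rw [← degColors_split hX h hi σ, ← color_π hX h σ]
    exact hc.2

/-- `k` is obtained from `g` by lengthening the chosen chain of degenerate vertices by `c`. -/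
def IsExt (k : X.Gen (n + 1)) (c : k.tree.E) (g : X.Gen n) : Prop :=
  ∃ (i : k.tree.E) (σ : Split k.tree g.tree c i), DegAt k.dendrex c ∧
    g.dendrex = res σ.s k.dendrex ∧ g.planar = k.planar.pullback σ.s ∧
    IsChosen g.dendrex (onEdges σ.π c)

/-- The chosen vertex is unique, hence preserved by τ, so τ lifts to the extended trees by
`Split.exists_iso`. The factor (-1)^(label of c) absorbs the change of sign in `Planar.sgn_removes`;
this makes the homotopy well defined on classes. -/
theorem IsExt.eq (hX : X.IsNormal) {k k' : X.Gen (n + 1)} {c : k.tree.E} {c' : k'.tree.E}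
    {g g' : X.Gen n} (h : IsExt k c g) (h' : IsExt k' c' g') (τ : g'.tree ≅ g.tree)
    (hτ : g'.dendrex = res τ.hom g.dendrex) :
    (-1 : ℤ) ^ k.planar.label c • cls k = Planar.sgn g'.planar (g.planar.pullback τ.hom) •
      (-1 : ℤ) ^ k'.planar.label c' • cls k' := by
  obtain ⟨i, σ, h1, h2, h3, h4⟩ := h
  obtain ⟨i', σ', h1', h2', h3', h4'⟩ := h'
  rw [hτ] at h4'
  obtain ⟨ψ, hπ, hc, hs⟩ := σ'.exists_iso σ τ ((h4'.iso hX).eq hX h4)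
  have hk : k'.dendrex = res ψ.hom k.dendrex := by
    have h5 : (σ'.π ≫ τ.hom) ≫ σ.s = ψ.hom ≫ σ.π ≫ σ.s := by rw [← hπ, Category.assoc]
    rw [← h1'.res_eq σ', res_comp, ← h2', hτ, h2, ← res_comp, ← res_comp, h5, res_comp,
      h1.res_eq σ]
  rw [cls_iso ψ hk, Planar.sgn_removes σ'.removes, Planar.label_iso, hc, ← h3',
    ← Planar.pullback_comp, hs, Planar.pullback_comp, ← h3, smul_smul, smul_smul]
  congr 1
  have h5 : ((-1 : ℤ) ^ k.planar.label c) * (-1) ^ k.planar.label c = 1 := by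
    rw [← mul_pow]; simp
  linear_combination Planar.sgn g'.planar (g.planar.pullback τ.hom) *
    (-1 : ℤ) ^ k'.planar.label c' * h5

theorem isExt_pull (hX : X.IsNormal) {k : X.Gen (n + 1)} {c i : k.tree.E} (hc : IsChosen k.dendrex c)
    (hi : DegAt k.dendrex i) (σ : Split k.tree S c i) (hS : S.size = n) :
    IsExt k c (k.pull σ.s hS) :=
  ⟨i, σ, hc.1.1, rfl, rfl, hc.split hX hc.1.1 hi σ⟩

/-- The extension is the elementary degeneracy at the chosen vertex; the new unary vertex is `some
v`, with the copy `none` as its input. -/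
theorem exists_isExt (hX : X.IsNormal) {g : X.Gen n} (h : ∃ v, DegAt g.dendrex v) :
    ∃ (k : X.Gen (n + 1)) (c : k.tree.E), IsExt k c g := by
  obtain ⟨v, hv⟩ := exists_isChosen hX h
  obtain ⟨σ, hσ⟩ := exists_degenSplit g.tree v
  refine ⟨⟨g.tree.degen v, (size_degen _ _).trans (congrArg (· + 1) g.size_eq),
    g.planar.pullback σ.π, res σ.π g.dendrex⟩, (some v : Option g.tree.E), none, σ,
    degAt_of_eq σ.π rfl σ.unary σ.π_eq, ?_, ?_, ?_⟩
  · rw [← res_comp, σ.s_π, res_id]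
  · rw [← Planar.pullback_comp, σ.s_π, Planar.pullback_id]
  · rw [hσ]
    exact hv

theorem IsExt.degAt {k : X.Gen (n + 1)} {c : k.tree.E} {g : X.Gen n} (h : IsExt k c g) :
    ∃ v, DegAt g.dendrex v := by
  obtain ⟨i, σ, -, -, -, h⟩ := h
  exact ⟨_, h.1.1⟩

open Classical in
/-- The contracting homotopy on generators. -/
noncomputable def homotopyGen (g : X.Gen n) : X.UnGroup (n + 1) :=
  -- An extension exists precisely for degenerate generators; the homotopy vanishes on the others.
  if h : ∃ (k : X.Gen (n + 1)) (c : k.tree.E), IsExt k c g then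
    (-1 : ℤ) ^ h.choose.planar.label h.choose_spec.choose • cls h.choose
  else 0

theorem homotopyGen_iso (hX : X.IsNormal) {g g' : X.Gen n} (τ : g'.tree ≅ g.tree)
    (hτ : g'.dendrex = res τ.hom g.dendrex) :
    homotopyGen g = Planar.sgn g'.planar (g.planar.pullback τ.hom) • homotopyGen g' := by
  have h1 : (∃ v, DegAt g.dendrex v) ↔ ∃ v, DegAt g'.dendrex v := by
    rw [hτ]
    constructor
    · rintro ⟨v, hv⟩
      obtain ⟨y, rfl⟩ := (iso_bijective τ).2 v
      exact ⟨y, (degAt_iso_iff hX τ y).2 hv⟩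
    · rintro ⟨v, hv⟩
      exact ⟨_, (degAt_iso_iff hX τ v).1 hv⟩
  by_cases h : ∃ (k : X.Gen (n + 1)) (c : k.tree.E), IsExt k c g
  · have h' : ∃ (k : X.Gen (n + 1)) (c : k.tree.E), IsExt k c g' :=
      exists_isExt hX (h1.1 h.choose_spec.choose_spec.degAt)
    rw [homotopyGen, homotopyGen, dif_pos h, dif_pos h']
    exact h.choose_spec.choose_spec.eq hX h'.choose_spec.choose_spec τ hτ
  · have h' : ¬ ∃ (k : X.Gen (n + 1)) (c : k.tree.E), IsExt k c g' := fun h' =>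
      h (exists_isExt hX (h1.2 h'.choose_spec.choose_spec.degAt))
    rw [homotopyGen, homotopyGen, dif_neg h, dif_neg h', smul_zero]

/-- The contracting homotopy. -/
noncomputable def homotopy (hX : X.IsNormal) (n : ℕ) : X.UnGroup n →ₗ[ℤ] X.UnGroup (n + 1) :=
  (X.A n).liftQ (Finsupp.linearCombination ℤ homotopyGen) <| by
    rw [A, Submodule.span_le]
    rintro _ ⟨g, g', τ, h, rfl⟩
    rw [SetLike.mem_coe, LinearMap.mem_ker, map_sub, Finsupp.linearCombination_single,
      Finsupp.linearCombination_single, one_smul, homotopyGen_iso hX τ h, sub_self]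

theorem homotopy_cls (hX : X.IsNormal) {k : X.Gen (n + 1)} {c : k.tree.E} {g : X.Gen n}
    (h : IsExt k c g) : homotopy hX n (cls g) = (-1 : ℤ) ^ k.planar.label c • cls k := by
  have h1 : homotopy hX n (cls g) = homotopyGen g := by
    refine ((X.A n).liftQ_apply _ _).trans ?_
    rw [Finsupp.linearCombination_single, one_smul]
  have h' : ∃ (k : X.Gen (n + 1)) (c : k.tree.E), IsExt k c g := ⟨k, c, h⟩
  rw [h1, homotopyGen, dif_pos h',
    h'.choose_spec.choose_spec.eq hX h (Iso.refl _) (res_id _).symm]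
  rw [show (Iso.refl g.tree).hom = 𝟙 _ from rfl, Planar.pullback_id, Planar.sgn_self, one_smul]

end DSet

/-! ### The homotopy identity on leading terms, and acyclicity of the degenerate part. -/

theorem neg_one_pow_mul_eq_neg {a b c d s t : ℕ} (h1 : d = a + s) (h2 : c = b + t)
    (h3 : s + t = 1) : (-1 : ℤ) ^ a * (-1) ^ b = -((-1) ^ c * (-1) ^ d) := by
  have h4 : c + d = a + b + 1 := by omega
  rw [← pow_add, ← pow_add, h4, pow_succ]
  simp

namespace OTree

namespace Split

variable {R S T S' R' : OTree} {v i v' i' : T.E}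

theorem mem_vert_s (σ : Split T S v i) (y : S.E) : y ∈ S.vert ↔ onEdges σ.s y ∈ T.vert := by
  rw [σ.removes.mem_iff]
  exact and_iff_left (σ.s_ne y)

theorem range_comp (σ : Split T S v i) {w j : S.E} (τ : Split S R w j) :
    Set.range (onEdges (τ.s ≫ σ.s)) = {e | e ≠ v ∧ e ≠ onEdges σ.s w} := by
  ext e
  constructor
  · rintro ⟨y, rfl⟩
    exact ⟨σ.s_ne _, fun h => τ.s_ne y (σ.s_injective h)⟩
  · rintro ⟨h1, h2⟩
    obtain ⟨y, rfl⟩ := σ.exists_s_eq.2 h1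
    obtain ⟨z, rfl⟩ := τ.exists_s_eq.2 fun h => h2 (congrArg _ h)
    exact ⟨z, rfl⟩

/-- Collapsing two vertices in either order leaves the subtree which misses just these two edges. -/
theorem exists_iso_of_comm (σ : Split T S v i) {w j : S.E} (τ : Split S R w j)
    (σ' : Split T S' v' i') {w' j' : S'.E} (τ' : Split S' R' w' j')
    (h : onEdges σ.s w = v') (h' : onEdges σ'.s w' = v) :
    ∃ φ : R ≅ R', φ.hom ≫ τ'.s ≫ σ'.s = τ.s ≫ σ.s := by
  refine exists_iso_of_range_eq _ _ (σ.s_injective.comp τ.s_injective)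
    (σ'.s_injective.comp τ'.s_injective) ?_ fun x y hxy => ?_
  · rw [range_comp, range_comp, h, h']
    ext e
    exact and_comm
  · rw [τ.mem_vert_s, σ.mem_vert_s, τ'.mem_vert_s, σ'.mem_vert_s, ← onEdges_comp, hxy, onEdges_comp]

end Split

end OTree

namespace DSet

open OTree

variable {X : DSet.{u}} {n m : ℕ} {R S T S' T' : OTree} {x : X.Dendrex T}

theorem Gen.pull_pull (g : X.Gen m) {n' : ℕ} (f : S ⟶ g.tree) (h : S.size = n) (f' : R ⟶ S)
    (h' : R.size = n') : (g.pull f h).pull f' h' = g.pull (f' ≫ f) h' := by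
  simp only [Gen.pull, res_comp, Planar.pullback_comp]

theorem fiber_card_split (hX : X.IsNormal) {c i : T.E} (h : DegAt x c) (σ : Split T S c i) {w : S.E}
    (hw : color x (onEdges σ.s w) ≠ color x c) :
    (fiber (res σ.s x) w).card = (fiber x (onEdges σ.s w)).card := by
  classical
  rw [← Finset.card_image_of_injective _ σ.s_injective]
  congr 1
  ext e
  simp only [Finset.mem_image, mem_fiber, color_split hX h]
  constructor
  · rintro ⟨y, hy, rfl⟩
    exact hy
  · intro he
    obtain ⟨y, rfl⟩ := (σ.exists_s_eq (e := e)).2 (by rintro rfl; exact hw he.symm)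
    exact ⟨y, he, rfl⟩

theorem fiber_card_π (hX : X.IsNormal) {c i : T.E} (h : DegAt x c) (σ : Split T S c i) :
    (fiber x c).card = (fiber (res σ.s x) (onEdges σ.π c)).card + 1 := by
  classical
  rw [← Finset.card_image_of_injective _ σ.s_injective,
    ← Finset.card_insert_of_notMem (a := c) (by
      rw [Finset.mem_image]
      rintro ⟨y, -, hy⟩
      exact σ.s_ne y hy)]
  congr 1
  ext e
  simp only [Finset.mem_insert, Finset.mem_image, mem_fiber, color_split hX h, σ.π_s_self,
    h.color_eq hX σ.unary]
  constructor
  · intro he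
    refine or_iff_not_imp_left.2 fun hv => ?_
    obtain ⟨y, rfl⟩ := σ.exists_s_eq.2 hv
    exact ⟨y, he, rfl⟩
  · rintro (rfl | ⟨y, hy, rfl⟩)
    · rfl
    · exact hy

theorem isBot_split_iff (hX : X.IsNormal) {c i : T.E} (h : DegAt x c) (σ : Split T S c i) {w : S.E}
    (hw : color x (onEdges σ.s w) ≠ color x c) :
    IsBot (res σ.s x) w ↔ IsBot x (onEdges σ.s w) := by
  refine and_congr (degAt_split_iff hX h σ w) ⟨fun h1 b hb hb' => ?_, fun h1 b hb hb' => ?_⟩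
  · obtain ⟨y, rfl⟩ := (σ.exists_s_eq (e := b)).2 (by rintro rfl; exact hw hb'.symm)
    refine h1 y ((s_lt_iff σ).1 hb) ?_
    rw [color_split hX h, color_split hX h, hb']
  · refine h1 _ ((s_lt_iff σ).2 hb) ?_
    rw [← color_split hX h, ← color_split hX h, hb']

/-- A chain of m degenerate vertices has m + 1 edges, so the second edge is again a degenerate
vertex once there is a third. -/
theorem IsBot.degAt_iff_card (hX : X.IsNormal) {v i : T.E} (h : IsBot x v) (hu : T.Unary v i) :
    DegAt x i ↔ 3 ≤ (fiber x v).card := by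
  classical
  have hi := h.1.color_eq hX hu
  rw [degAt_iff hX, hi]
  constructor
  · rintro ⟨b, hb, hb'⟩
    rw [← Finset.card_eq_three.2 ⟨v, i, b, hu.lt.ne, (hu.lt.trans hb).ne, hb.ne, rfl⟩]
    refine Finset.card_le_card fun e he => ?_
    simp only [Finset.mem_insert, Finset.mem_singleton] at he
    rcases he with rfl | rfl | rfl <;> simp [*]
  · intro hc
    obtain ⟨e, he, he'⟩ := Finset.exists_mem_notMem_of_card_lt_card
      (s := {v, i}) (t := fiber x v) (Finset.card_le_two.trans_lt hc)
    simp only [Finset.mem_insert, Finset.mem_singleton, not_or] at he'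
    have h1 := mem_fiber.1 he
    exact ⟨e, lt_of_le_of_ne
      (hu.lt_iff.1 (lt_of_le_of_ne (h.le hX h1) (Ne.symm he'.1))) (Ne.symm he'.2), h1⟩

theorem degAt_of_mem_evenBots (hX : X.IsNormal) {v i : T.E} (h : v ∈ evenBots x)
    (hu : T.Unary v i) : DegAt x i := by
  classical
  obtain ⟨h1, h2⟩ := mem_evenBots.1 h
  rw [h1.degAt_iff_card hX hu]
  have h3 : ({v, i} : Finset T.E).card ≤ (fiber x v).card := by
    refine Finset.card_le_card fun e he => ?_
    simp only [Finset.mem_insert, Finset.mem_singleton] at he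
    rcases he with rfl | rfl
    · simp
    · simpa using h1.1.color_eq hX hu
  rw [Finset.card_pair hu.lt.ne] at h3
  obtain ⟨r, hr⟩ := h2
  omega

theorem evenBots_split (hX : X.IsNormal) [DecidableEq S.E] [DecidableEq T.E] {c i : T.E}
    (h : IsBot x c) (hi : DegAt x i) (σ : Split T S c i) :
    ((evenBots (res σ.s x)).erase (onEdges σ.π c)).image (onEdges σ.s) = (evenBots x).erase c := by
  have hb : IsBot (res σ.s x) (onEdges σ.π c) := by
    refine ⟨(degAt_split_iff hX h.1 σ _).2 (by rwa [σ.π_s_self]), fun b hb hb' => ?_⟩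
    rw [color_π hX h.1, color_split hX h.1] at hb'
    rw [← s_lt_iff σ, σ.π_s_self, σ.unary.lt_iff'] at hb
    exact σ.s_ne b (le_antisymm hb (h.le hX hb'))
  ext e
  simp only [Finset.mem_image, Finset.mem_erase, mem_evenBots]
  constructor
  · rintro ⟨w, ⟨h1, h2, h3⟩, rfl⟩
    have hw : color x (onEdges σ.s w) ≠ color x c := by
      intro hw
      refine h1 (h2.eq hX hb ?_)
      rw [color_π hX h.1, color_split hX h.1, hw]
    refine ⟨σ.s_ne w, (isBot_split_iff hX h.1 σ hw).1 h2, ?_⟩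
    rwa [← fiber_card_split hX h.1 σ hw]
  · rintro ⟨h1, h2, h3⟩
    have hw : color x e ≠ color x c := fun hw => h1 (h2.eq hX h hw)
    obtain ⟨w, rfl⟩ := σ.exists_s_eq.2 h1
    refine ⟨w, ⟨?_, (isBot_split_iff hX h.1 σ hw).2 h2, ?_⟩, rfl⟩
    · rintro rfl
      rw [σ.π_s_self] at hw
      exact hw (h.1.color_eq hX σ.unary)
    · rwa [fiber_card_split hX h.1 σ hw]

/-- Lengthening the chosen chain and shortening another one commute up to sign: of the vertices c
and v just one comes before the other, so the order of removal changes the total label by one. -/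
theorem homotopy_collapse (hX : X.IsNormal) {k : X.Gen (n + 1 + 1)} {c i : k.tree.E}
    (hc : IsChosen k.dendrex c) (hi : DegAt k.dendrex i) (σ : Split k.tree S c i)
    (hS : S.size = n + 1) {w : S.E} (hw : onEdges σ.s w ∈ evenBots k.dendrex) :
    (-1 : ℤ) ^ (k.planar.pullback σ.s).label w •
      homotopy hX n (collapse (k.pull σ.s hS) w) =
      - ((-1 : ℤ) ^ k.planar.label c • (-1 : ℤ) ^ k.planar.label (onEdges σ.s w) •
        collapse k (onEdges σ.s w)) := by
  obtain ⟨v, hv⟩ : ∃ v, v = onEdges σ.s w := ⟨_, rfl⟩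
  have hcv : c ≠ v := fun h => σ.s_ne w (h.trans hv).symm
  rw [← hv] at hw
  obtain ⟨hb, ho⟩ := mem_evenBots.1 hw
  have hcol : color k.dendrex c ≠ color k.dendrex v := fun h => hcv (hc.1.eq hX hb h)
  obtain ⟨i', S', σ', -⟩ := id hb.1
  have hi' : DegAt k.dendrex i' := degAt_of_mem_evenBots hX hw σ'.unary
  have hS' := k.size_split σ'
  have hc' : IsChosen (res σ'.s k.dendrex) (onEdges σ'.π c) := hc.split hX hb.1 hi' σ'
  have hsc : onEdges σ'.s (onEdges σ'.π c) = c := σ'.π_s_apply c hcv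
  obtain ⟨j, R, τ, -⟩ := id hc'.1.1
  -- Shortening the other chain keeps the length of the chosen one. Hence the twice collapsed
  -- generator still has this chain, and the once collapsed one is its extension.
  have hj : DegAt (res σ'.s k.dendrex) j := by
    rw [hc'.1.degAt_iff_card hX τ.unary]
    refine ((hc.1.degAt_iff_card hX σ.unary).1 hi).trans_eq ?_
    refine ((fiber_card_split hX hb.1 σ' ?_).trans ?_).symm
    · rwa [hsc]
    · rw [hsc]
  have hR : R.size = n := (k.pull σ'.s hS').size_split τ
  have hdw : DegAt (res σ.s k.dendrex) w := (degAt_split_iff hX hc.1.1 σ w).2 (hv ▸ hb.1)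
  obtain ⟨j', R', τ', -⟩ := id hdw
  have hR' : R'.size = n := (k.pull σ.s hS).size_split τ'
  obtain ⟨φ, hφ⟩ := σ.exists_iso_of_comm τ' σ' τ hv.symm hsc
  have key : collapse (k.pull σ.s hS) w = cls ((k.pull σ'.s hS').pull τ.s hR) := by
    refine (collapse_eq (g := k.pull σ.s hS) hdw τ' hR').trans ?_
    refine (congrArg cls (k.pull_pull σ.s hS τ'.s hR')).trans ?_
    refine Eq.trans ?_ (congrArg cls (k.pull_pull σ'.s hS' τ.s hR)).symm
    exact (cls_pull_iso k φ hφ hR' hR).symm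
  have h1 := Planar.label_removes σ.removes k.planar w
  have h2 := Planar.label_removes σ'.removes k.planar (onEdges σ'.π c)
  have h3 := Planar.before_add_before (p := k.planar) hcv
  rw [hsc] at h2
  rw [← hv] at h1
  have h4 := homotopy_cls hX (isExt_pull (k := k.pull σ'.s hS') hX hc' hj τ hR)
  rw [key, h4, ← hv, collapse_eq hb.1 σ' hS', smul_smul, smul_smul, ← neg_smul]
  congr 1
  exact neg_one_pow_mul_eq_neg h1 h2 h3

/-- The extended chain is the only one whose parity differs between g and k, so it occurs in exactly
one of the two sums and gives the class of g there; the terms of the other chains cancel. -/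
theorem homotopy_sum (hX : X.IsNormal) {k : X.Gen (n + 1 + 1)} {c : k.tree.E} {g : X.Gen (n + 1)}
    (h : IsExt k c g) :
    homotopy hX n (∑ w ∈ evenBots g.dendrex, (-1 : ℤ) ^ g.planar.label w • collapse g w) +
      (-1 : ℤ) ^ k.planar.label c •
        ∑ w ∈ evenBots k.dendrex, (-1 : ℤ) ^ k.planar.label w • collapse k w = cls g := by
  classical
  obtain ⟨T, hT, p, x⟩ := g
  obtain ⟨i, σ, h1, h2, h3, h4⟩ := h
  dsimp only at σ h2 h3 h4 ⊢
  subst h2 h3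
  obtain ⟨hc, hi⟩ := h4.of_split hX h1 σ
  change homotopy hX n (∑ w ∈ evenBots (res σ.s k.dendrex),
    (-1 : ℤ) ^ (k.planar.pullback σ.s).label w • collapse (k.pull σ.s hT) w) + _ =
    cls (k.pull σ.s hT)
  have hcard := fiber_card_π hX h1 σ
  have key : ∑ w ∈ (evenBots (res σ.s k.dendrex)).erase (onEdges σ.π c),
      (-1 : ℤ) ^ (k.planar.pullback σ.s).label w • homotopy hX n (collapse (k.pull σ.s hT) w) +
      ∑ w ∈ (evenBots k.dendrex).erase c,
        (-1 : ℤ) ^ k.planar.label c • (-1 : ℤ) ^ k.planar.label w • collapse k w = 0 := by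
    rw [← evenBots_split hX hc.1 hi σ, Finset.sum_image fun _ _ _ _ h => σ.s_injective h,
      ← Finset.sum_add_distrib]
    refine Finset.sum_eq_zero fun w hw => ?_
    rw [homotopy_collapse hX hc hi σ hT, neg_add_cancel]
    have := Finset.mem_image_of_mem (onEdges σ.s) hw
    rw [evenBots_split hX hc.1 hi σ] at this
    exact Finset.mem_of_mem_erase this
  rw [map_sum, Finset.smul_sum]
  simp only [map_smul]
  -- If the extended chain has even length, d of the extension collapses c again. If it has odd
  -- length, the chain in g is even, and the homotopy restores what d has shortened.
  by_cases ho : Odd (fiber k.dendrex c).card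
  · have h2 : onEdges σ.π c ∉ evenBots (res σ.s k.dendrex) := fun h => by
      have := (mem_evenBots.1 h).2
      rw [hcard] at ho
      exact Nat.not_odd_iff_even.2 this.add_one ho
    have h3 : c ∈ evenBots k.dendrex := mem_evenBots.2 ⟨hc.1, ho⟩
    rw [Finset.erase_eq_of_notMem h2] at key
    rw [← Finset.add_sum_erase _ _ h3, add_left_comm, key, add_zero, smul_smul, ← mul_pow,
      collapse_eq h1 σ hT]
    simp
  · have h2 : onEdges σ.π c ∈ evenBots (res σ.s k.dendrex) := by
      refine mem_evenBots.2 ⟨h4.1, ?_⟩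
      rw [hcard, Nat.not_odd_iff_even] at ho
      exact (Nat.even_add_one.1 ho) |> Nat.not_even_iff_odd.1
    have h3 : c ∉ evenBots k.dendrex := fun h => ho (mem_evenBots.1 h).2
    rw [Finset.erase_eq_of_notMem h3] at key
    obtain ⟨j, R, τ, -⟩ := id h4.1.1
    have hj := degAt_of_mem_evenBots hX h2 τ.unary
    have hR := (k.pull σ.s hT).size_split τ
    rw [← Finset.add_sum_erase _ _ h2, add_assoc, key, add_zero,
      collapse_eq (g := k.pull σ.s hT) h4.1.1 τ hR,
      homotopy_cls hX (isExt_pull (k := k.pull σ.s hT) hX h4 hj τ hR), smul_smul]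
    change ((-1 : ℤ) ^ (k.planar.pullback σ.s).label _ *
      (-1 : ℤ) ^ (k.planar.pullback σ.s).label _) • _ = _
    rw [← mul_pow]
    simp

theorem IsExt.rank_eq (hX : X.IsNormal) {k : X.Gen (n + 1)} {c : k.tree.E} {g : X.Gen n}
    (h : IsExt k c g) : rank g.dendrex = rank k.dendrex := by
  obtain ⟨i, σ, h1, h2, -⟩ := h
  rw [h2, rank_split hX h1]

theorem IsExt.degAt_ext {k : X.Gen (n + 1)} {c : k.tree.E} {g : X.Gen n} (h : IsExt k c g) :
    ∃ v, DegAt k.dendrex v := by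
  obtain ⟨i, σ, h1, -⟩ := h
  exact ⟨c, h1⟩

theorem F_mono {a b : ℕ} (hab : a ≤ b) (n : ℕ) : X.F a n ≤ X.F b n := by
  rw [F, Submodule.span_le]
  rintro _ ⟨g, h, h', rfl⟩
  exact cls_mem_F h (h'.trans_le hab)

theorem homotopy_mem_F (hX : X.IsNormal) {k : ℕ} {z : X.UnGroup n} (hz : z ∈ X.F k n) :
    homotopy hX n z ∈ X.F k (n + 1) := by
  suffices X.F k n ≤ (X.F k (n + 1)).comap (homotopy hX n) from this hz
  rw [F, Submodule.span_le]
  rintro _ ⟨g, h, h', rfl⟩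
  rw [SetLike.mem_coe, Submodule.mem_comap]
  obtain ⟨l, c, hl⟩ := exists_isExt hX h
  rw [homotopy_cls hX hl]
  exact Submodule.smul_mem _ _ (cls_mem_F hl.degAt_ext (by rwa [← hl.rank_eq hX]))

/-- The homotopy contracts the filtration quotients of the subcomplex of degenerate dendrices. -/
theorem homotopy_sub_mem_F (hX : X.IsNormal) (h : X.BoundaryDescends) {k : ℕ}
    {z : X.UnGroup (n + 1)} (hz : z ∈ X.F (k + 1) (n + 1)) :
    homotopy hX n (d h n z) + d h (n + 1) (homotopy hX (n + 1) z) - z ∈ X.F k (n + 1) := by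
  suffices X.F (k + 1) (n + 1) ≤ (X.F k (n + 1)).comap
      (homotopy hX n ∘ₗ d h n + d h (n + 1) ∘ₗ homotopy hX (n + 1) - LinearMap.id) from this hz
  rw [F, Submodule.span_le]
  rintro _ ⟨g, hg, hr, rfl⟩
  change homotopy hX n (d h n (cls g)) + d h (n + 1) (homotopy hX (n + 1) (cls g)) - cls g ∈
    X.F k (n + 1)
  obtain ⟨l, c, hl⟩ := exists_isExt hX hg
  rw [homotopy_cls hX hl, map_smul, d_cls, d_cls]
  -- The homotopy preserves the rank, so the errors of both leading terms remain in lower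
  -- filtration.
  have h1 := homotopy_mem_F hX (bd_sub_mem_F hX g hg)
  have h2 := Submodule.smul_mem _ ((-1 : ℤ) ^ l.planar.label c)
    (bd_sub_mem_F hX l hl.degAt_ext)
  rw [← hl.rank_eq hX] at h2
  have h3 := F_mono (Nat.le_of_lt_succ hr) _ ((X.F _ _).add_mem h1 h2)
  convert h3 using 1
  rw [← homotopy_sum hX hl, map_sub, smul_sub]
  abel

/-- For a cycle z the homotopy h gives d h z - z of lower rank, and this is again a cycle; if it is
d w, then z = d (h z - w). -/
theorem exists_of_mem_F (hX : X.IsNormal) (h : X.BoundaryDescends) {k : ℕ}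
    {z : X.UnGroup (n + 1)} (hz : z ∈ X.F k (n + 1)) (hd : d h n z = 0) :
    ∃ w ∈ X.D (n + 1 + 1), d h (n + 1) w = z := by
  induction k generalizing z with
  | zero =>
    rw [F_zero, Submodule.mem_bot] at hz
    exact ⟨0, zero_mem _, by rw [map_zero, hz]⟩
  | succ k ih =>
    have h1 := homotopy_sub_mem_F hX h hz
    rw [hd, map_zero, zero_add] at h1
    obtain ⟨w, hw, hw'⟩ := ih h1 (by
      rw [map_sub, hd, sub_zero]
      exact LinearMap.congr_fun (d_comp_d h n) _)
    refine ⟨homotopy hX (n + 1) z - w, (X.D _).sub_mem (F_le_D _ _ (homotopy_mem_F hX hz)) hw, ?_⟩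
    rw [map_sub, hw', sub_sub_cancel]

/-- The subcomplex of degenerate dendrices is acyclic. -/
theorem exists_of_mem_D (hX : X.IsNormal) (h : X.BoundaryDescends) {z : X.UnGroup (n + 1)}
    (hz : z ∈ X.D (n + 1)) (hd : d h n z = 0) : ∃ w ∈ X.D (n + 1 + 1), d h (n + 1) w = z :=
  exists_of_mem_F hX h (D_le_F _ hz) hd

theorem D_zero : X.D 0 = ⊥ := by
  rw [D, Submodule.span_eq_bot]
  rintro _ ⟨g, hg, -⟩
  obtain ⟨v, hv⟩ := isDegenerate_iff.1 hg
  obtain ⟨i, S, σ, -⟩ := hv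
  have h1 := σ.size_eq
  have h2 := g.size_eq
  omega

end DSet

/-! ### From acyclicity of the kernel to the quasi-isomorphism. -/

/-- A surjection of short complexes of modules is a quasi-isomorphism if its kernel is exact in the
middle and on the right. -/
theorem CategoryTheory.ShortComplex.quasiIso_of_surjective {A : Type*} [Ring A]
    {S₁ S₂ : ShortComplex (ModuleCat A)} (φ : S₁ ⟶ S₂) (h1 : Function.Surjective φ.τ₁)
    (h2 : Function.Surjective φ.τ₂)
    (hf : ∀ x : S₁.X₂, φ.τ₂ x = 0 → S₁.g x = 0 → ∃ w, S₁.f w = x)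
    (hg : ∀ x : S₁.X₂, φ.τ₃ (S₁.g x) = 0 → ∃ w, φ.τ₂ w = 0 ∧ S₁.g w = S₁.g x) :
    ShortComplex.QuasiIso φ := by
  let γ : ShortComplex.LeftHomologyMapData φ S₁.moduleCatLeftHomologyData
    S₂.moduleCatLeftHomologyData := default
  have c12 : ∀ x, S₂.f (φ.τ₁ x) = φ.τ₂ (S₁.f x) := fun x => congr($(φ.comm₁₂) x)
  have c23 : ∀ x, S₂.g (φ.τ₂ x) = φ.τ₃ (S₁.g x) := fun x => congr($(φ.comm₂₃) x)
  have ci : ∀ x : LinearMap.ker S₁.g.hom, (γ.φK x : LinearMap.ker S₂.g.hom).1 = φ.τ₂ x.1 :=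
    fun x => congr($(γ.commi) x)
  have cπ : ∀ x : LinearMap.ker S₁.g.hom,
      γ.φH ((LinearMap.range S₁.moduleCatToCycles).mkQ x) =
        (LinearMap.range S₂.moduleCatToCycles).mkQ (γ.φK x) := fun x => congr($(γ.commπ) x)
  rw [γ.quasiIso_iff, ConcreteCategory.isIso_iff_bijective]
  constructor
  · rw [injective_iff_map_eq_zero]
    intro z hz
    obtain ⟨x, rfl⟩ := (LinearMap.range S₁.moduleCatToCycles).mkQ_surjective z
    rw [cπ] at hz
    obtain ⟨y, hy⟩ := (Submodule.Quotient.mk_eq_zero _).1 hz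
    obtain ⟨y, rfl⟩ := h1 y
    have hy' : S₂.f (φ.τ₁ y) = φ.τ₂ x.1 := (congrArg Subtype.val hy).trans (ci x)
    -- The image of x bounds; after subtraction of the boundary of a lift, x becomes a cycle in the
    -- kernel.
    obtain ⟨w, hw⟩ := hf (x.1 - S₁.f y) (by rw [map_sub, ← hy', c12, sub_self]) (by
      rw [map_sub, S₁.moduleCat_zero_apply, sub_zero]
      exact x.2)
    refine (Submodule.Quotient.mk_eq_zero _).2 ⟨w + y, Subtype.ext ?_⟩
    change S₁.f (w + y) = x.1
    rw [map_add, hw, sub_add_cancel]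
  · intro z
    obtain ⟨x, rfl⟩ := (LinearMap.range S₂.moduleCatToCycles).mkQ_surjective z
    obtain ⟨y, hy⟩ := h2 x.1
    -- A lift y of a cycle has its differential in the kernel, and is corrected by an element w of
    -- the kernel to become a cycle.
    obtain ⟨w, hw, hw'⟩ := hg y (by
      rw [← c23, hy]
      exact x.2)
    refine ⟨(LinearMap.range S₁.moduleCatToCycles).mkQ ⟨y - w, ?_⟩, ?_⟩
    · change S₁.g (y - w) = 0
      rw [map_sub, hw', sub_self]
    · rw [cπ]
      congr 1
      refine Subtype.ext ((ci _).trans ?_)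
      rw [map_sub, hw, sub_zero, hy]

namespace DSet

variable {X : DSet.{u}}

theorem quasiIso_chUnToCh (hX : X.IsNormal) (h : X.BoundaryDescends)
    (hd : ∀ n, d h n ∘ₗ d h (n + 1) = 0) (hD : ∀ n, X.D (n + 1) ≤ (X.D n).comap (d h n)) :
    QuasiIso (chUnToCh h hd hD) := by
  have hz : ∀ x ∈ X.D 0, x = 0 := fun x hx => (Submodule.mem_bot ℤ).1 (D_zero ▸ hx)
  have hs : ∀ n, Function.Surjective ((chUnToCh h hd hD).f n) := fun n => (X.D n).mkQ_surjective
  have hk : ∀ n (x : X.UnGroup n), (chUnToCh h hd hD).f n x = 0 ↔ x ∈ X.D n := fun n x =>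
    Submodule.Quotient.mk_eq_zero _
  have hdd : ∀ n, (chUn h hd).d (n + 1) n = ModuleCat.ofHom (d h n) := fun n =>
    ChainComplex.of_d (fun n => ModuleCat.of ℤ (X.UnGroup n)) (fun n => ModuleCat.ofHom (d h n)) n
  have hda : ∀ n (x : X.UnGroup (n + 1)), (chUn h hd).d (n + 1) n x = d h n x := fun n x =>
    congr($(hdd n) x)
  refine ⟨fun n => ?_⟩
  rcases n with _ | n
  · rw [quasiIsoAt_iff' _ 1 0 0 (by simp) (by simp)]
    -- In degree 0 the outgoing map of the short complex is the zero map from degree 0 to itself,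
    -- and the kernel vanishes there.
    have h0 : (chUn h hd).d 0 0 = 0 := (chUn h hd).shape 0 0 (by simp)
    refine ShortComplex.quasiIso_of_surjective _ (hs 1) (hs 0)
      (fun x hx _ => ⟨0, (map_zero _).trans (hz x ((hk 0 x).1 hx)).symm⟩)
      (fun x _ => ⟨0, map_zero _, ?_⟩)
    change (chUn h hd).d 0 0 _ = (chUn h hd).d 0 0 x
    rw [h0]
    rfl
  · rw [quasiIsoAt_iff' _ (n + 1 + 1) (n + 1) n (by simp) (by simp)]
    refine ShortComplex.quasiIso_of_surjective _ (hs _) (hs _) (fun x hx hx' => ?_)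
      (fun x hx => ?_)
    · obtain ⟨w, -, hw⟩ := exists_of_mem_D hX h ((hk _ x).1 hx) ((hda n x).symm.trans hx')
      exact ⟨w, (hda _ w).trans hw⟩
    · have h1 : d h n x ∈ X.D n := (hk n _).1 ((congrArg _ (hda n x).symm).trans hx)
      -- The differential of x is a cycle in D. In degree 0 it vanishes with D; in higher degrees it
      -- bounds in D by acyclicity.
      rcases n with _ | n
      · exact ⟨0, map_zero _, (map_zero _).trans ((hda 0 x).trans (hz _ h1)).symm⟩
      · obtain ⟨w, hw, hw'⟩ := exists_of_mem_D hX h h1 (LinearMap.congr_fun (hd n) x)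
        exact ⟨w, (hk _ w).2 hw, (hda _ w).trans (hw'.trans (hda _ x).symm)⟩

end DSet

theorem corollary5p5 (X : DSet.{u}) (hX : X.IsNormal) :
    ∃ (h : X.BoundaryDescends) (hd : ∀ n, DSet.d h n ∘ₗ DSet.d h (n + 1) = 0)
      (hD : ∀ n, X.D (n + 1) ≤ (X.D n).comap (DSet.d h n)),
      QuasiIso (DSet.chUnToCh h hd hD) :=
  ⟨DSet.boundaryDescends X, DSet.d_comp_d _, DSet.D_le_comap _, DSet.quasiIso_chUnToCh hX _ _ _⟩
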